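/- **Model.** Let $n,d\ge 1$ be fixed. For $i=1,2,\dots$ let $a_{0i}\in\mathbb R^{n}$ be nonrandom, $X_0\in\mathbb R^{n\times d}$, $c_{0i}=\begin{bmatrix}a_{0i}\\ X_0^\top a_{0i}\end{bmatrix}$, and let $c_i=\begin{bmatrix}a_i\\ b_i\end{bmatrix}=c_{0i}+\tilde c_i\in\mathbb R^{n+d}$ be observed with random errors $\tilde c_i=(\tilde c_{i1},\dots,\tilde c_{i,n+d})^\top$. For $X\in\mathbb R^{n\times d}$ put $Z=Z(X)=\begin{bmatrix}X\\-I_d\end{bmatrix}$, $Z_0=Z(X_0)$, and for $J\subset\{1,\dots,n+d\}$ let $Z_J$ be the submatrix of the rows of $Z$ with index in $J$. Let $A=[a_1,\dots,a_m]^\top$, $B=[b_1,\dots,b_m]^\top$, $C=[A,B]$, $A_0=[a_{01},\dots,a_{0m}]^\top$. **Assumptions.** (i) The vectors $\tilde c_i$ are independent, with zero mean and finite second moments. (ii) For a fixed $J$, $\mathbf E\tilde c_{ij}^2=0$ for all $i$ and $j\notin J$, and $\operatorname{cov}(\tilde c_{ij},j\in J)=\sigma^2\Sigma_i$ with $\sigma^2>0$.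 (iii) $\lambda_{\min}(\Sigma_i)\ge\varkappa^2$ for all $i$, for some $\varkappa>0$. (iv) $\operatorname{rank}(Z_{0J})=d$. (v) $\sup_{i,\,j\in J}\mathbf E|\tilde c_{ij}|^{2r}<\infty$ for some $r\ge2$ with $r>d\bigl(|J|-\tfrac{d+1}{2}\bigr)$. (viii) $\sup_{i,\,j\in J}\mathbf E|\tilde c_{ij}|^{4+2\delta}<\infty$ for some $\delta>0$. (ix) For this $\delta$, $m^{-1-\delta/2}\sum_{i=1}^m\|a_{0i}\|^{2+\delta}\to0$ as $m\to\infty$. (x) $\frac1mA_0^\top A_0\to V_A$ as $m\to\infty$, with $V_A$ nonsingular. (xi) $\Sigma_i$ converges as $i\to\infty$. (xii) $\mathbf E\tilde c_{ip}\tilde c_{iq}\tilde c_{il}=0$ for all $i$ and $p,q,l\in J$. (xiii) $\frac1m\sum_{i=1}^m\mathbf E\tilde c_{ip}\tilde c_{iq}\tilde c_{il}\tilde c_{iv}$ has a finite limit as $m\to\infty$, for all $p,q,l,v\in J$. **Estimator.** $\hat X$ is a Borel measurable function of $C$ with values in $\mathbb R^{n\times d}\cup\{\infty\}$ which is the $X$-component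 of a minimizer $(X,\Delta C)$, $\Delta C=[\Delta A,\Delta B]$, of $\sum_{i=1}^m\|\Sigma_i^{-1/2}\Delta c_i^J\|^2$, where $\Delta c_i^J=(\Delta c_{ij},\,j\in J)$, subject to $(A-\Delta A)X=B-\Delta B$, $\Delta c_{ij}=0$ for $j\notin J$, and $\operatorname{rank}(Z_J)=d$, if a minimizer exists, and $\hat X=\infty$ otherwise. **Notation.** Let $S_i=\sigma^{-2}\operatorname{cov}(\tilde c_i)$. Partition $S=\begin{bmatrix}S_a&S_{ab}\\S_{ba}&S_b\end{bmatrix}$ with $S_a\in\mathbb R^{n\times n}$. Put $$\tilde s(a,b,S;X)=ac^\top Z-[S_a,S_{ab}]\,Z(Z^\top SZ)^{-1}Z^\top cc^\top Z,\qquad c=\begin{bmatrix}a\\b\end{bmatrix}.$$ With bars denoting averages over $i=1,\dots,m$ and $\hat Z=Z(\hat X)$, put $$\hat\sigma^2=\tfrac1d\operatorname{tr}\bigl[(\hat Z^\top\overline{cc^\top}\hat Z)(\hat Z^\top\bar S\hat Z)^{-1}\bigr],\qquad \hat V_A=\overline{aa^\top}-\hat\sigma^2\,\bar S_a .$$ **Statement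 (Lemma 9).** The limit $S_\infty=\lim_{i\to\infty} S_i=\begin{bmatrix}S_a^\infty&S_{ab}^\infty\\S_{ba}^\infty&S_b^\infty\end{bmatrix}$ exists, and $$\frac1{\sqrt m}\sum_{i=1}^m\bigl(a_{0i}\tilde c_i^\top,\ \tilde c_i\tilde c_i^\top-\sigma^2S_i\bigr)$$ converges in distribution to a centered Gaussian pair $(\Gamma_1,\Gamma_2)$ of random matrices with independent components. Put $$\Gamma(X_0)=\Gamma_1Z_0+P_a\Gamma_2Z_0-[S_a^\infty,S_{ab}^\infty]\,Z_0(Z_0^\top S_\infty Z_0)^{-1}(Z_0^\top\Gamma_2Z_0),\qquad P_a=[I_n,0].$$ Let $u\in\mathbb R^d$, $u\ne0$. Then $\sqrt m(\hat Xu-X_0u)$ converges in distribution to $V_A^{-1}\Gamma(X_0)u\sim N(0,S_u)$ with $S_u=\operatorname{cov}(V_A^{-1}\Gamma(X_0)u)$. Moreover, with $\hat s_i=\tilde s(a_i,b_i,S_i;\hat X)$, the sandwich estimator $$\hat S_u=\hat V_A^{-1}\cdot\frac1m\sum_{i=1}^m\hat s_i\,uu^\top\hat s_i^\top\cdot\hat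 V_A^{-1}$$ is well defined with probability tending to one ($\hat X$ is finite, and $\hat Z^\top\bar S\hat Z$ and $\hat V_A$ are nonsingular), and $\hat S_u$ converges to $S_u$ in probability as $m\to\infty$. -/

import Mathlib

open MeasureTheory ProbabilityTheory Filter Topology Matrix
open scoped ENNReal NNReal

namespace EWTLS

noncomputable section

/-- Column indices of `C = [A, B]`: the `n` columns of `A`, then the `d` columns of `B`. -/
abbrev Col (n d : ℕ) : Type := Fin n ⊕ Fin d

/-- Borel structure on real matrices of finite size (the product one, entry by entry). -/
instance matrixMeasurableSpace {ι κ : Type*} : MeasurableSpace (Matrix ι κ ℝ) :=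
  inferInstanceAs (MeasurableSpace (ι → κ → ℝ))

instance matrixBorelSpace {ι κ : Type*} [Countable ι] [Countable κ] : BorelSpace (Matrix ι κ ℝ) :=
  inferInstanceAs (BorelSpace (ι → κ → ℝ))

instance matrixSecondCountable {ι κ : Type*} [Countable ι] [Countable κ] :
    SecondCountableTopology (Matrix ι κ ℝ) :=
  inferInstanceAs (SecondCountableTopology (ι → κ → ℝ))

/-- `Z(X) = [X; -I_d]`. -/
def Zmat {n d : ℕ} (X : Matrix (Fin n) (Fin d) ℝ) : Matrix (Col n d) (Fin d) ℝ :=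
  fromRows X (-1)

/-- `Z_J`: the rows of `Z` with index in `J`. -/
def rowsJ {n d : ℕ} (J : Finset (Col n d)) (Z : Matrix (Col n d) (Fin d) ℝ) : Matrix J (Fin d) ℝ :=
  Z.submatrix Subtype.val id

/-- `c₀ = [a₀; b₀]` with `b₀ = X₀ᵀ a₀`. -/
def trueRow {n d : ℕ} (X₀ : Matrix (Fin n) (Fin d) ℝ) (a₀ : Fin n → ℝ) : Col n d → ℝ :=
  Sum.elim a₀ (X₀ᵀ *ᵥ a₀)

/-- `S = σ⁻² cov(c̃)` for a random error vector `c̃`. -/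
def relCov {n d : ℕ} {Ω : Type*} [MeasurableSpace Ω] (P : Measure Ω) (σsq : ℝ)
    (e : Ω → Col n d → ℝ) : Matrix (Col n d) (Col n d) ℝ :=
  of fun j k => σsq⁻¹ * cov[fun ω => e ω j, fun ω => e ω k; P]

/-! ### The estimator -/

/-- The data matrix `C` formed by the first `m` rows `c_i`. -/
def dataMatrix {n d : ℕ} (c : ℕ → Col n d → ℝ) (m : ℕ) : Matrix (Fin m) (Col n d) ℝ :=
  of fun i j => c i j

/-- Feasibility of `(X, ΔC)`: `(A - ΔA) X = B - ΔB`, the columns outside `J` are not corrected,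
and `rank Z_J = d`. -/
def IsFeasible {n d m : ℕ} (J : Finset (Col n d)) (C : Matrix (Fin m) (Col n d) ℝ)
    (X : Matrix (Fin n) (Fin d) ℝ) (D : Matrix (Fin m) (Col n d) ℝ) : Prop :=
  (C.toCols₁ - D.toCols₁) * X = C.toCols₂ - D.toCols₂ ∧
    (∀ i, ∀ j ∉ J, D i j = 0) ∧ (rowsJ J (Zmat X)).rank = d

/-- The weighted sum of squared corrections `∑ ‖Σ_i^{-1/2} Δc_i^J‖²`, with
`‖Σ^{-1/2} v‖² = vᵀ Σ⁻¹ v`. -/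
def cost {n d m : ℕ} (J : Finset (Col n d)) (Sg : ℕ → Matrix J J ℝ)
    (D : Matrix (Fin m) (Col n d) ℝ) : ℝ :=
  ∑ i : Fin m, (fun j : J => D i j) ⬝ᵥ ((Sg i)⁻¹ *ᵥ fun j : J => D i j)

/-- `X` is the `X`-part of a solution of the constrained minimization problem. -/
def IsSolution {n d m : ℕ} (J : Finset (Col n d)) (Sg : ℕ → Matrix J J ℝ)
    (C : Matrix (Fin m) (Col n d) ℝ) (X : Matrix (Fin n) (Fin d) ℝ) : Prop :=
  ∃ D, IsFeasible J C X D ∧ ∀ X' D', IsFeasible J C X' D' → cost J Sg D ≤ cost J Sg D'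

/-- The EW-TLS estimator: for every number of rows `m`, a Borel map of the data matrix into
`ℝ^{n×d} ∪ {∞}` which solves the minimization problem if it has a solution and is `∞` otherwise. -/
structure IsEWTLS {n d : ℕ} (J : Finset (Col n d)) (Sg : ℕ → Matrix J J ℝ)
    (est : (m : ℕ) → Matrix (Fin m) (Col n d) ℝ → OnePoint (Matrix (Fin n) (Fin d) ℝ)) :
    Prop where
  measurable : ∀ m, @Measurable _ _ inferInstance (borel _) (est m)
  solves : ∀ m C, (∃ X, IsSolution J Sg C X) → ∃ X, est m C = OnePoint.some X ∧ IsSolution J Sg C X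
  infinite : ∀ m C, (¬ ∃ X, IsSolution J Sg C X) → est m C = OnePoint.infty

/-- The matrix value of the estimator; the value at `∞` is immaterial. -/
def finitePart {n d : ℕ} (x : OnePoint (Matrix (Fin n) (Fin d) ℝ)) : Matrix (Fin n) (Fin d) ℝ :=
  x.elim 0 id

/-! ### The sandwich estimator -/

/-- `s̃(a, b, S; X) = a cᵀ Z - [S_a, S_ab] Z (Zᵀ S Z)⁻¹ Zᵀ c cᵀ Z`, with `c = [a; b]`. -/
def score {n d : ℕ} (c : Col n d → ℝ) (S : Matrix (Col n d) (Col n d) ℝ)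
    (X : Matrix (Fin n) (Fin d) ℝ) : Matrix (Fin n) (Fin d) ℝ :=
  vecMulVec (fun k => c (Sum.inl k)) c * Zmat X -
    S.toRows₁ * Zmat X * ((Zmat X)ᵀ * S * Zmat X)⁻¹ * (Zmat X)ᵀ * vecMulVec c c * Zmat X

/-- The average of the first `m` terms of a sequence of matrices. -/
def avg {ι κ : Type*} (M : ℕ → Matrix ι κ ℝ) (m : ℕ) : Matrix ι κ ℝ :=
  (m : ℝ)⁻¹ • ∑ i ∈ Finset.range m, M i

/-- `σ̂² = d⁻¹ tr[(Ẑᵀ \overline{c cᵀ} Ẑ)(Ẑᵀ S̄ Ẑ)⁻¹]`. -/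
def sigmaSqHat {n d : ℕ} (c : ℕ → Col n d → ℝ) (S : ℕ → Matrix (Col n d) (Col n d) ℝ) (m : ℕ)
    (X : Matrix (Fin n) (Fin d) ℝ) : ℝ :=
  (d : ℝ)⁻¹ * trace (((Zmat X)ᵀ * avg (fun i => vecMulVec (c i) (c i)) m * Zmat X) *
    ((Zmat X)ᵀ * avg S m * Zmat X)⁻¹)

/-- `V̂_A = \overline{a aᵀ} - σ̂² S̄_a`. -/
def VHat {n d : ℕ} (c : ℕ → Col n d → ℝ) (S : ℕ → Matrix (Col n d) (Col n d) ℝ) (m : ℕ)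
    (X : Matrix (Fin n) (Fin d) ℝ) : Matrix (Fin n) (Fin n) ℝ :=
  avg (fun i => vecMulVec (fun k => c i (Sum.inl k)) (fun k => c i (Sum.inl k))) m -
    sigmaSqHat c S m X • (avg S m).toBlocks₁₁

/-- `Ŝ_u = V̂_A⁻¹ (m⁻¹ ∑ ŝ_i u uᵀ ŝ_iᵀ) V̂_A⁻¹`. -/
def sandwich {n d : ℕ} (c : ℕ → Col n d → ℝ) (S : ℕ → Matrix (Col n d) (Col n d) ℝ) (m : ℕ)
    (X : Matrix (Fin n) (Fin d) ℝ) (u : Fin d → ℝ) : Matrix (Fin n) (Fin n) ℝ :=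
  (VHat c S m X)⁻¹ *
    avg (fun i => score (c i) (S i) X * vecMulVec u u * (score (c i) (S i) X)ᵀ) m *
    (VHat c S m X)⁻¹

/-! ### The limit law -/

/-- Pairs of matrices in which `W_i` and `Γ = (Γ₁, Γ₂)` take their values. -/
abbrev MatPair (n d : ℕ) : Type :=
  Matrix (Fin n) (Col n d) ℝ × Matrix (Col n d) (Col n d) ℝ

/-- `W = (a₀ c̃ᵀ, c̃ c̃ᵀ - σ² S)`. -/
def pairW {n d : ℕ} (a₀ : Fin n → ℝ) (e : Col n d → ℝ) (σsq : ℝ)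
    (S : Matrix (Col n d) (Col n d) ℝ) : MatPair n d :=
  (vecMulVec a₀ e, vecMulVec e e - σsq • S)

/-- `ν` is the law of a centered Gaussian pair `(Γ₁, Γ₂)` with independent components. -/
structure IsCenteredGaussianIndep {n d : ℕ} (ν : Measure (MatPair n d)) : Prop where
  gaussian : IsGaussian ν
  centered₁ : ∀ i j, ∫ G, G.1 i j ∂ν = 0
  centered₂ : ∀ i j, ∫ G, G.2 i j ∂ν = 0
  indep : IndepFun (fun G : MatPair n d => G.1) (fun G : MatPair n d => G.2) ν

/-- `Γ(X) = Γ₁ Z + P_a Γ₂ Z - [S_a^∞, S_ab^∞] Z (Zᵀ S_∞ Z)⁻¹ (Zᵀ Γ₂ Z)`, where `P_a [a; b] = a`. -/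
def GammaOf {n d : ℕ} (Sinf : Matrix (Col n d) (Col n d) ℝ) (X : Matrix (Fin n) (Fin d) ℝ)
    (G : MatPair n d) : Matrix (Fin n) (Fin d) ℝ :=
  G.1 * Zmat X + (fromCols 1 0 : Matrix (Fin n) (Col n d) ℝ) * G.2 * Zmat X -
    Sinf.toRows₁ * Zmat X * ((Zmat X)ᵀ * Sinf * Zmat X)⁻¹ * ((Zmat X)ᵀ * G.2 * Zmat X)

/-- The covariance matrix of a random vector. -/
def covMatrix {n : ℕ} {Ω : Type*} [MeasurableSpace Ω] (P : Measure Ω) (Y : Ω → Fin n → ℝ) :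
    Matrix (Fin n) (Fin n) ℝ :=
  of fun j k => cov[fun ω => Y ω j, fun ω => Y ω k; P]

end

end EWTLS

/-!
The estimator is the minimizer of a profiled objective function. For fixed `X` of admissible rank
the optimal corrections of the rows are explicit, so that eliminating them leaves
`Q(X) = ∑ cᵢᵀ Z (Zᵀ Sᵢ Z)⁻¹ Zᵀ cᵢ` with `Z = Z(X)` (`isSolution_iff`). Differentiating along lines
gives the estimating equation `∑ s̃ᵢ(X̂) (Ẑᵀ Sᵢ Ẑ)⁻¹ = 0` (`sum_score_mul_inv_gram_eq_zero`).

Convergence in probability is treated as convergence along the filter `inProb P` on `ℕ × Ω`, whose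
members are the events of probability tending to one; this makes the topological lemmas of Mathlib
available for random quantities.

*Consistency.* The averages of `c cᵀ` converge to `[I; X₀ᵀ] V_A [I, X₀] + σ² S_∞`, which is positive
definite because `rank Z₀_J = d`. Together with `Sᵢ → S_∞` this bounds `Q(X) / m` from below,
simultaneously for all `X`, by `(1 - θ)` times its limit, and the limit exceeds `σ² d`, its value
at `X₀`, by an amount that controls `‖X - X₀‖² / (1 + ‖X‖²)`. Hence minimizers exist and are close
to `X₀` with probability tending to one (`IsModel.eventually_exists_isSolution`).

*Asymptotic normality.* The score is, exactly, a sum of terms linear in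
`Wᵢ = (a₀ᵢ c̃ᵢᵀ, c̃ᵢ c̃ᵢᵀ - σ² Sᵢ)` and of a drift containing `a₀ᵢ a₀ᵢᵀ (X - X₀)`
(`score_eq_add`), all with coefficients that are smooth functions of `(Sᵢ, X)`. Replacing these
coefficients by their values at `(S_∞, X₀)` costs `o(1) + o(√m ‖X̂ - X₀‖)`
(`isLittleO_normalized_sum_weight`), so that `V_A √m (X̂ - X₀) + Γ(T_m)` tends to zero in
probability, `T_m` being the normalized sum of the `Wᵢ` (`IsModel.tendsto_remainder`). Lyapunov's
central limit theorem, proved with characteristic functions, gives the limit law of `T_m`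
(`IsLyapunovSeq.tendstoInDistribution`); the two components are uncorrelated since the third
moments vanish, hence independent, and the minus sign disappears because the law is symmetric.

*Sandwich estimator.* The same decomposition shows that `ŝᵢ u` is close in mean square to
`Γ(X₀; Wᵢ) u` (`IsModel.negligibleSq_score`). The averaged outer products of the latter converge by
a truncated weak law of large numbers, and `V̂_A → V_A`.
-/

namespace EWTLS

noncomputable section

/-! ### Convergence in probability as convergence along a filter -/

section InProb

variable {Ω : Type*} [MeasurableSpace Ω] {P : Measure Ω}

/-- The filter on `ℕ × Ω` of the events of probability tending to one: `A` belongs to it if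
`P {ω | (m, ω) ∉ A} → 0` as `m → ∞`. Convergence along it is convergence in probability, so that
the calculus of limits applies to random sequences; no measurability is required. -/
def inProb (P : Measure Ω) : Filter (ℕ × Ω) where
  sets := {A | Tendsto (fun m : ℕ => P {ω | (m, ω) ∉ A}) atTop (𝓝 0)}
  univ_sets := by simp
  sets_of_superset {A B} hA hAB :=
    tendsto_of_tendsto_of_tendsto_of_le_of_le tendsto_const_nhds hA (fun _ => zero_le)
      fun m => measure_mono fun ω h hω => h (hAB hω)
  inter_sets {A B} hA hB := by
    refine tendsto_of_tendsto_of_tendsto_of_le_of_le tendsto_const_nhds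
      (by simpa using hA.add hB) (fun _ => zero_le) fun m => ?_
    refine (measure_mono fun ω h => ?_).trans (measure_union_le _ _)
    by_contra hc
    simp only [Set.mem_union, Set.mem_ofPred_eq, not_or, not_not] at hc
    exact h ⟨hc.1, hc.2⟩

lemma eventually_inProb {q : ℕ × Ω → Prop} :
    (∀ᶠ p in inProb P, q p) ↔ Tendsto (fun m : ℕ => P {ω | ¬ q (m, ω)}) atTop (𝓝 0) := Iff.rfl

lemma tendsto_fst_inProb : Tendsto Prod.fst (inProb P) atTop := by
  refine tendsto_atTop.2 fun b => ?_
  rw [eventually_inProb]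
  refine tendsto_const_nhds.congr' ?_
  filter_upwards [eventually_ge_atTop b] with m hm
  simp [hm]

lemma tendstoInMeasure_iff_inProb {f : ℕ → Ω → ℝ} {x : ℝ} :
    TendstoInMeasure P f atTop (fun _ => x) ↔
      Tendsto (fun p : ℕ × Ω => f p.1 p.2) (inProb P) (𝓝 x) := by
  rw [tendstoInMeasure_iff_dist, Metric.tendsto_nhds]
  refine forall₂_congr fun ε _ => ?_
  rw [eventually_inProb]
  simp only [not_lt]

lemma tendstoInMeasure_of_inProb {E : Type*} [SeminormedAddCommGroup E] {f : ℕ → Ω → E}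
    (h : Tendsto (fun p : ℕ × Ω => f p.1 p.2) (inProb P) (𝓝 0)) :
    TendstoInMeasure P f atTop 0 := by
  rw [tendstoInMeasure_iff_dist]
  intro ε hε
  have := Metric.tendsto_nhds.1 h ε hε
  rw [eventually_inProb] at this
  simpa only [not_lt, Pi.zero_apply] using this

/-- Boundedness in probability (tightness) of a sequence of real random variables. -/
def BddInProb (P : Measure Ω) (f : ℕ → Ω → ℝ) : Prop :=
  ∀ ε : ℝ≥0∞, 0 < ε → ∃ M : ℝ, ∀ᶠ m in atTop, P {ω | M < |f m ω|} ≤ ε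

lemma BddInProb.tendsto_mul {f : ℕ → Ω → ℝ} {g : ℕ × Ω → ℝ} (hf : BddInProb P f)
    (hg : Tendsto g (inProb P) (𝓝 0)) :
    Tendsto (fun p : ℕ × Ω => g p * f p.1 p.2) (inProb P) (𝓝 0) := by
  rw [Metric.tendsto_nhds]
  intro η hη
  rw [eventually_inProb, ENNReal.tendsto_nhds_zero]
  intro ε hε
  obtain ⟨M, hM⟩ := hf (ε / 2) (ENNReal.half_pos hε.ne')
  have h1 := Metric.tendsto_nhds.1 hg (η / (|M| + 1)) (by positivity)
  rw [eventually_inProb, ENNReal.tendsto_nhds_zero] at h1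
  filter_upwards [hM, h1 (ε / 2) (ENNReal.half_pos hε.ne')] with m h2 h3
  refine (measure_mono fun ω h => ?_).trans
    ((measure_union_le _ _).trans ((add_le_add h2 h3).trans_eq (ENNReal.add_halves ε)))
  by_contra hc
  simp only [Set.mem_union, Set.mem_ofPred_eq, not_or, not_lt, Real.dist_eq,
    sub_zero] at hc h
  have hM1 : 0 < |M| + 1 := by positivity
  have : |g (m, ω) * f m ω| < η := by
    rw [abs_mul]
    calc |g (m, ω)| * |f m ω| ≤ |g (m, ω)| * (|M| + 1) := by
          gcongr
          linarith [hc.1, le_abs_self M]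
      _ < η / (|M| + 1) * (|M| + 1) := by gcongr; exact not_le.1 hc.2
      _ = η := by field_simp
  linarith

lemma BddInProb.mono {f g : ℕ → Ω → ℝ} (hf : BddInProb P f) (h : ∀ m ω, |g m ω| ≤ |f m ω|) :
    BddInProb P g := by
  intro ε hε
  obtain ⟨M, hM⟩ := hf ε hε
  refine ⟨M, hM.mono fun m hm => (measure_mono fun ω hω => ?_).trans hm⟩
  exact lt_of_lt_of_le hω (h m ω)

lemma BddInProb.add {f g : ℕ → Ω → ℝ} (hf : BddInProb P f) (hg : BddInProb P g) :
    BddInProb P (fun m ω => f m ω + g m ω) := by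
  intro ε hε
  obtain ⟨M, hM⟩ := hf (ε / 2) (ENNReal.half_pos hε.ne')
  obtain ⟨K, hK⟩ := hg (ε / 2) (ENNReal.half_pos hε.ne')
  refine ⟨M + K, ?_⟩
  filter_upwards [hM, hK] with m h1 h2
  refine (measure_mono fun ω h => ?_).trans
    ((measure_union_le _ _).trans ((add_le_add h1 h2).trans_eq (ENNReal.add_halves ε)))
  by_contra hc
  simp only [Set.mem_union, Set.mem_ofPred_eq, not_or, not_lt] at hc h
  linarith [abs_add_le (f m ω) (g m ω)]

lemma bddInProb_const (x : ℝ) : BddInProb P (fun _ _ => x) := fun ε _ => ⟨|x|, by simp⟩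

lemma BddInProb.sum {ι : Type*} (s : Finset ι) {f : ι → ℕ → Ω → ℝ}
    (hf : ∀ k ∈ s, BddInProb P (f k)) : BddInProb P (fun m ω => ∑ k ∈ s, f k m ω) := by
  classical
  induction s using Finset.induction_on with
  | empty => simpa using bddInProb_const (P := P) 0
  | insert a s ha ih =>
    simp only [Finset.sum_insert ha]
    exact (hf a (by simp)).add (ih fun k hk => hf k (by simp [hk]))

/-- A variable which is `o_p(1)` up to an arbitrarily small multiple of a tight one is `o_p(1)`. -/
lemma tendsto_inProb_of_le_mul_add {f : ℕ × Ω → ℝ} {k : ℕ → Ω → ℝ} (hh : BddInProb P k)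
    (H : ∀ ε > 0, ∃ g : ℕ × Ω → ℝ, Tendsto g (inProb P) (𝓝 0) ∧
      ∀ᶠ p in inProb P, |f p| ≤ ε * |k p.1 p.2| + g p) :
    Tendsto f (inProb P) (𝓝 0) := by
  rw [Metric.tendsto_nhds]
  intro η hη
  rw [eventually_inProb, ENNReal.tendsto_nhds_zero]
  intro ε hε
  obtain ⟨M, hM⟩ := hh (ε / 2) (ENNReal.half_pos hε.ne')
  obtain ⟨g, hg, hfg⟩ := H (η / 2 / (|M| + 1)) (by positivity)
  have h1 := hfg.and (Metric.tendsto_nhds.1 hg (η / 2) (by positivity))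
  rw [eventually_inProb, ENNReal.tendsto_nhds_zero] at h1
  filter_upwards [hM, h1 (ε / 2) (ENNReal.half_pos hε.ne')] with m h2 h3
  refine (measure_mono fun ω h => ?_).trans
    ((measure_union_le _ _).trans ((add_le_add h2 h3).trans_eq (ENNReal.add_halves ε)))
  by_contra hc
  simp only [Set.mem_union, Set.mem_ofPred_eq, not_or, not_not, not_lt, Real.dist_eq,
    sub_zero] at hc h
  have hM1 : 0 < |M| + 1 := by positivity
  have : η / 2 / (|M| + 1) * |k m ω| ≤ η / 2 := by
    calc η / 2 / (|M| + 1) * |k m ω| ≤ η / 2 / (|M| + 1) * (|M| + 1) := by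
          gcongr
          linarith [hc.1, le_abs_self M]
      _ = η / 2 := by field_simp
  linarith [hc.2.1, hc.2.2, le_abs_self (g (m, ω))]

variable [IsProbabilityMeasure P]

lemma measure_lt_abs_le {f : Ω → ℝ} (hf : Integrable f P) {M : ℝ} (hM : 0 < M) :
    P {ω | M ≤ |f ω|} ≤ ENNReal.ofReal ((∫ ω, |f ω| ∂P) / M) := by
  have h1 := mul_meas_ge_le_integral_of_nonneg (μ := P) (f := fun ω => |f ω|)
    (ae_of_all _ fun ω => abs_nonneg _) hf.abs M
  rw [← ofReal_measureReal]
  apply ENNReal.ofReal_le_ofReal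
  rw [le_div_iff₀ hM, mul_comm]
  exact h1

/-- **Markov's inequality**: convergence to zero in mean implies convergence in probability. -/
lemma tendsto_inProb_of_integral {f : ℕ → Ω → ℝ} (hf : ∀ m, Integrable (f m) P)
    (h : Tendsto (fun m => ∫ ω, |f m ω| ∂P) atTop (𝓝 0)) :
    Tendsto (fun p : ℕ × Ω => f p.1 p.2) (inProb P) (𝓝 0) := by
  rw [Metric.tendsto_nhds]
  intro η hη
  rw [eventually_inProb]
  have h2 : Tendsto (fun m => ENNReal.ofReal ((∫ ω, |f m ω| ∂P) / η)) atTop (𝓝 0) := by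
    simpa using ENNReal.tendsto_ofReal (h.div_const η)
  refine tendsto_of_tendsto_of_tendsto_of_le_of_le tendsto_const_nhds h2 (fun _ => zero_le)
    fun m => ?_
  simpa using measure_lt_abs_le (hf m) hη

lemma bddInProb_of_integral {f : ℕ → Ω → ℝ} (hf : ∀ m, Integrable (f m) P) {C : ℝ}
    (h : ∀ m, ∫ ω, |f m ω| ∂P ≤ C) : BddInProb P f := by
  intro ε hε
  rcases eq_or_ne ε ⊤ with rfl | hε'
  · exact ⟨0, by simp⟩
  have hε0 : 0 < ε.toReal := ENNReal.toReal_pos hε.ne' hε'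
  refine ⟨(|C| + 1) / ε.toReal, Eventually.of_forall fun m => ?_⟩
  have hM : 0 < (|C| + 1) / ε.toReal := by positivity
  refine (measure_mono fun ω hω => ?_).trans ((measure_lt_abs_le (hf m) hM).trans ?_)
  · simp only [Set.mem_ofPred_eq] at hω ⊢
    exact hω.le
  · rw [ENNReal.ofReal_le_iff_le_toReal hε', div_div_eq_mul_div, div_le_iff₀ (by positivity)]
    rw [mul_comm]
    gcongr
    linarith [h m, le_abs_self C]

lemma integral_abs_le_sqrt {f : Ω → ℝ} (hf : MemLp f 2 P) :
    ∫ ω, |f ω| ∂P ≤ √(∫ ω, f ω ^ 2 ∂P) := by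
  apply Real.le_sqrt_of_sq_le
  have h := variance_nonneg |f| P
  rw [variance_eq_sub hf.abs] at h
  simp only [Pi.pow_apply, Pi.abs_apply, sq_abs] at h
  linarith

lemma integral_abs_le_of_sq {f : Ω → ℝ} (hf : MemLp f 2 P) :
    ∫ ω, |f ω| ∂P ≤ 1 + ∫ ω, f ω ^ 2 ∂P := by
  have h := integral_abs_le_sqrt hf
  have h0 : 0 ≤ ∫ ω, f ω ^ 2 ∂P := integral_nonneg fun _ => sq_nonneg _
  have := Real.sq_sqrt h0
  nlinarith [Real.sqrt_nonneg (∫ ω, f ω ^ 2 ∂P), sq_nonneg (√(∫ ω, f ω ^ 2 ∂P) - 1)]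

end InProb

/-! ### Averages with vanishing weights -/

section Averages

lemma tendsto_avg_mul {b δ : ℕ → ℝ} (hb : ∀ i, 0 ≤ b i) {C : ℝ}
    (hC : ∀ m : ℕ, (m : ℝ)⁻¹ * ∑ i ∈ Finset.range m, b i ≤ C) (hδ : Tendsto δ atTop (𝓝 0)) :
    Tendsto (fun m : ℕ => (m : ℝ)⁻¹ * ∑ i ∈ Finset.range m, b i * δ i) atTop (𝓝 0) := by
  have h1 : (fun i => b i * δ i) =o[atTop] fun i => b i + 1 := by
    rw [Asymptotics.isLittleO_iff]
    intro ε hε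
    filter_upwards [Metric.tendsto_nhds.1 hδ ε hε] with i hi
    rw [Real.dist_eq, sub_zero] at hi
    rw [norm_mul, Real.norm_of_nonneg (hb i), Real.norm_of_nonneg (by linarith [hb i] : 0 ≤ b i + 1),
      Real.norm_eq_abs]
    nlinarith [hb i, abs_nonneg (δ i)]
  have h2 := h1.sum_range (fun i => by linarith [hb i] : ∀ i, 0 ≤ b i + 1) (by
    refine tendsto_atTop_mono (fun m => ?_) (tendsto_natCast_atTop_atTop (R := ℝ))
    rw [Finset.sum_add_distrib]
    simpa using Finset.sum_nonneg fun i _ => hb i)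
  have h3 : (fun m : ℕ => ∑ i ∈ Finset.range m, (b i + 1)) =O[atTop] fun m : ℕ => (m : ℝ) := by
    refine Asymptotics.IsBigO.of_bound (C + 1) ?_
    filter_upwards [eventually_gt_atTop 0] with m hm
    have hm' : (0 : ℝ) < m := by exact_mod_cast hm
    rw [Real.norm_of_nonneg (Finset.sum_nonneg fun i _ => by linarith [hb i]),
      Real.norm_of_nonneg hm'.le, Finset.sum_add_distrib]
    have := hC m
    rw [inv_mul_le_iff₀ hm'] at this
    simp only [Finset.sum_const, Finset.card_range, nsmul_eq_mul, mul_one]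
    linarith
  have h4 := (h2.trans_isBigO h3).tendsto_div_nhds_zero
  refine h4.congr fun m => ?_
  rw [div_eq_inv_mul]

lemma tendsto_avg_of_tendsto {f : ℕ → ℝ} {l : ℝ} (h : Tendsto f atTop (𝓝 l)) :
    Tendsto (fun m : ℕ => (m : ℝ)⁻¹ * ∑ i ∈ Finset.range m, f i) atTop (𝓝 l) := h.cesaro

lemma bdd_of_tendsto {f : ℕ → ℝ} {l : ℝ} (h : Tendsto f atTop (𝓝 l)) : ∃ C, ∀ m, f m ≤ C := by
  obtain ⟨C, hC⟩ := h.bddAbove_range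
  exact ⟨C, fun m => hC ⟨m, rfl⟩⟩

variable {Ω : Type*} [MeasurableSpace Ω] {P : Measure Ω} [IsProbabilityMeasure P]

lemma integral_avg_abs {P : Measure Ω} {v : ℕ → Ω → ℝ} (hv : ∀ i, Integrable (v i) P) (m : ℕ) :
    ∫ ω, |(m : ℝ)⁻¹ * (∑ i ∈ Finset.range m, |v i ω|)| ∂P =
      (m : ℝ)⁻¹ * ∑ i ∈ Finset.range m, ∫ ω, |v i ω| ∂P := by
  rw [← integral_finsetSum _ fun i _ => (hv i).abs, ← integral_const_mul]
  refine integral_congr_ae (ae_of_all _ fun ω => ?_)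
  exact abs_of_nonneg (mul_nonneg (by positivity) (Finset.sum_nonneg fun i _ => abs_nonneg _))

lemma bddInProb_avg {v : ℕ → Ω → ℝ} (hv : ∀ i, Integrable (v i) P) {C : ℝ}
    (hC : ∀ m : ℕ, (m : ℝ)⁻¹ * ∑ i ∈ Finset.range m, ∫ ω, |v i ω| ∂P ≤ C) :
    BddInProb P (fun m ω => (m : ℝ)⁻¹ * ∑ i ∈ Finset.range m, |v i ω|) := by
  refine bddInProb_of_integral (C := C)
    (fun m => (integrable_finsetSum _ fun i _ => (hv i).abs).const_mul _) fun m => ?_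
  rw [integral_avg_abs hv]
  exact hC m

/-- A weighted average of variables bounded in mean tends to zero in probability if the weights
are functions `φ i` of a consistent estimator which vanish asymptotically, uniformly near the
limit `x₀` of the estimator. -/
lemma tendsto_avg_weight {α : Type*} [TopologicalSpace α] {x₀ : α} {φ : ℕ → α → ℝ}
    (h1 : Tendsto (fun q : ℕ × α => φ q.1 q.2) (atTop ×ˢ 𝓝 x₀) (𝓝 0))
    (h2 : ∀ i, ∃ B, ∀ᶠ x in 𝓝 x₀, |φ i x| ≤ B)
    {v : ℕ → Ω → ℝ} (hv : ∀ i, Integrable (v i) P) {C : ℝ}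
    (hC : ∀ m : ℕ, (m : ℝ)⁻¹ * ∑ i ∈ Finset.range m, ∫ ω, |v i ω| ∂P ≤ C)
    {xh : ℕ × Ω → α} (hx : Tendsto xh (inProb P) (𝓝 x₀)) :
    Tendsto (fun p : ℕ × Ω => (p.1 : ℝ)⁻¹ *
      ∑ i ∈ Finset.range p.1, |v i p.2| * |φ i (xh p)|) (inProb P) (𝓝 0) := by
  refine tendsto_inProb_of_le_mul_add (bddInProb_avg hv hC) fun ε hε => ?_
  obtain ⟨p1, hp1, p2, hp2, hpp⟩ := eventually_prod_iff.1 (Metric.tendsto_nhds.1 h1 ε hε)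
  obtain ⟨i₀, hi₀⟩ := eventually_atTop.1 hp1
  choose B hB using h2
  -- the terms with index below `i₀` are bounded individually
  let w : ℕ → Ω → ℝ := fun i ω => if i < i₀ then |B i| * |v i ω| else 0
  have hw : ∀ i, Integrable (w i) P := fun i => by
    by_cases h : i < i₀
    · simpa [w, h] using (hv i).abs.const_mul _
    · simp [w, h]
  refine ⟨fun p => (p.1 : ℝ)⁻¹ * ∑ i ∈ Finset.range p.1, |w i p.2|, ?_, ?_⟩
  · refine tendsto_inProb_of_integral (f := fun m ω => (m : ℝ)⁻¹ * ∑ i ∈ Finset.range m, |w i ω|)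
      (fun m => (integrable_finsetSum _ fun i _ => (hw i).abs).const_mul _) ?_
    simp_rw [integral_avg_abs hw]
    refine tendsto_avg_of_tendsto (tendsto_const_nhds.congr' ?_)
    filter_upwards [eventually_ge_atTop i₀] with i hi
    simp [w, not_lt.2 hi]
  · have hall : ∀ᶠ x in 𝓝 x₀, ∀ i ∈ Finset.range i₀, |φ i x| ≤ B i :=
      (Finset.eventually_all _).2 fun i _ => hB i
    filter_upwards [hx hp2, hx hall] with p hp hp'
    have hn : 0 ≤ (p.1 : ℝ)⁻¹ * ∑ i ∈ Finset.range p.1, |v i p.2| * |φ i (xh p)| :=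
      mul_nonneg (by positivity) (Finset.sum_nonneg fun i _ => by positivity)
    have hn' : 0 ≤ (p.1 : ℝ)⁻¹ * ∑ i ∈ Finset.range p.1, |v i p.2| :=
      mul_nonneg (by positivity) (Finset.sum_nonneg fun i _ => by positivity)
    rw [abs_of_nonneg hn, abs_of_nonneg hn', mul_left_comm, ← mul_add,
      Finset.mul_sum (Finset.range p.1) _ ε, ← Finset.sum_add_distrib]
    refine mul_le_mul_of_nonneg_left (Finset.sum_le_sum fun i _ => ?_) (by positivity)
    by_cases h : i < i₀
    · have := hp' i (Finset.mem_range.2 h)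
      have h3 : |v i p.2| * |φ i (xh p)| ≤ |w i p.2| := by
        simp only [w, h, if_true, abs_mul, abs_abs]
        rw [mul_comm]
        exact mul_le_mul_of_nonneg_right (this.trans (le_abs_self _)) (abs_nonneg _)
      have : 0 ≤ ε * |v i p.2| := by positivity
      linarith
    · have h4 := hpp (hi₀ i (not_lt.1 h)) hp
      rw [Real.dist_eq, sub_zero] at h4
      have h3 : |v i p.2| * |φ i (xh p)| ≤ ε * |v i p.2| := by
        rw [mul_comm]; gcongr
      have : 0 ≤ |w i p.2| := abs_nonneg _
      linarith

lemma eventually_forall_abs_le {α : Type*} [TopologicalSpace α] {x₀ : α} {φ : ℕ → α → ℝ} {l : ℝ}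
    (h1 : Tendsto (fun q : ℕ × α => φ q.1 q.2) (atTop ×ˢ 𝓝 x₀) (𝓝 l))
    (h2 : ∀ i, ∃ B, ∀ᶠ x in 𝓝 x₀, |φ i x| ≤ B) :
    ∃ B, ∀ᶠ x in 𝓝 x₀, ∀ i, |φ i x| ≤ B := by
  obtain ⟨p1, hp1, p2, hp2, hpp⟩ := eventually_prod_iff.1 (Metric.tendsto_nhds.1 h1 1 one_pos)
  obtain ⟨i₀, hi₀⟩ := eventually_atTop.1 hp1
  choose B hB using h2
  have hall : ∀ᶠ x in 𝓝 x₀, ∀ i ∈ Finset.range i₀, |φ i x| ≤ B i :=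
    (Finset.eventually_all _).2 fun i _ => hB i
  refine ⟨(|l| + 1) + ∑ i ∈ Finset.range i₀, |B i|, ?_⟩
  filter_upwards [hp2, hall] with x hx hx' i
  have hs : 0 ≤ ∑ i ∈ Finset.range i₀, |B i| := Finset.sum_nonneg fun i _ => abs_nonneg _
  by_cases h : i < i₀
  · have h3 := hx' i (Finset.mem_range.2 h)
    have h4 := Finset.single_le_sum (f := fun i => |B i|) (fun i _ => abs_nonneg _)
      (Finset.mem_range.2 h)
    linarith [le_abs_self (B i), abs_nonneg l]
  · have h4 := hpp (hi₀ i (not_lt.1 h)) hx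
    rw [Real.dist_eq] at h4
    have : |φ i x| ≤ |φ i x - l| + |l| := by
      have := abs_add_le (φ i x - l) l
      simpa using this
    linarith

end Averages

/-! ### Sums of independent centered variables -/

section Independent

variable {Ω : Type*} [MeasurableSpace Ω] {P : Measure Ω} [IsProbabilityMeasure P]

lemma integral_sq_sum_range {w : ℕ → Ω → ℝ} (hw : ∀ i, MemLp (w i) 2 P)
    (h0 : ∀ i, ∫ ω, w i ω ∂P = 0) (hi : iIndepFun w P) (m : ℕ) :
    ∫ ω, (∑ i ∈ Finset.range m, w i ω) ^ 2 ∂P = ∑ i ∈ Finset.range m, ∫ ω, w i ω ^ 2 ∂P := by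
  have h1 := IndepFun.variance_sum (X := w) (s := Finset.range m) (fun i _ => hw i)
    (fun i _ j _ hij => hi.indepFun hij)
  have h2 : ∫ ω, (∑ i ∈ Finset.range m, w i) ω ∂P = 0 := by
    simp only [Finset.sum_apply]
    rw [integral_finsetSum _ fun i _ => (hw i).integrable one_le_two]
    simp [h0]
  rw [variance_of_integral_eq_zero (memLp_finsetSum' _ fun i _ => hw i).aemeasurable h2] at h1
  simp only [Finset.sum_apply] at h1
  rw [h1]
  exact Finset.sum_congr rfl fun i _ => variance_of_integral_eq_zero (hw i).aemeasurable (h0 i)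

lemma memLp_scaled_sum {P : Measure Ω} {w : ℕ → Ω → ℝ} (hw : ∀ i, MemLp (w i) 2 P) (s : ℝ) (m : ℕ) :
    MemLp (fun ω => s * ∑ i ∈ Finset.range m, w i ω) 2 P :=
  (memLp_finsetSum _ fun i _ => hw i).const_mul s

lemma integral_sq_scaled_sum {w : ℕ → Ω → ℝ} (hw : ∀ i, MemLp (w i) 2 P)
    (h0 : ∀ i, ∫ ω, w i ω ∂P = 0) (hi : iIndepFun w P) (s : ℝ) (m : ℕ) :
    ∫ ω, (s * ∑ i ∈ Finset.range m, w i ω) ^ 2 ∂P =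
      s ^ 2 * ∑ i ∈ Finset.range m, ∫ ω, w i ω ^ 2 ∂P := by
  simp_rw [mul_pow]
  rw [integral_const_mul, integral_sq_sum_range hw h0 hi]

lemma inv_sqrt_sq (m : ℕ) : ((√(m : ℝ))⁻¹) ^ 2 = (m : ℝ)⁻¹ := by
  rw [inv_pow, Real.sq_sqrt (Nat.cast_nonneg m)]

/-- Normalized sums of independent centered variables are tight if the averaged variances are
bounded. -/
lemma bddInProb_normalized_sum {w : ℕ → Ω → ℝ} (hw : ∀ i, MemLp (w i) 2 P)
    (h0 : ∀ i, ∫ ω, w i ω ∂P = 0) (hi : iIndepFun w P) {C : ℝ}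
    (hC : ∀ m : ℕ, (m : ℝ)⁻¹ * ∑ i ∈ Finset.range m, ∫ ω, w i ω ^ 2 ∂P ≤ C) :
    BddInProb P (fun m ω => (√(m : ℝ))⁻¹ * ∑ i ∈ Finset.range m, w i ω) := by
  refine bddInProb_of_integral (C := 1 + C)
    (fun m => (memLp_scaled_sum hw _ m).integrable one_le_two) fun m => ?_
  refine (integral_abs_le_of_sq (memLp_scaled_sum hw _ m)).trans ?_
  rw [integral_sq_scaled_sum hw h0 hi, inv_sqrt_sq]
  linarith [hC m]

lemma tendsto_scaled_sum {w : ℕ → Ω → ℝ} (hw : ∀ i, MemLp (w i) 2 P)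
    (h0 : ∀ i, ∫ ω, w i ω ∂P = 0) (hi : iIndepFun w P) (s : ℕ → ℝ)
    (h : Tendsto (fun m : ℕ => s m ^ 2 * ∑ i ∈ Finset.range m, ∫ ω, w i ω ^ 2 ∂P) atTop (𝓝 0)) :
    Tendsto (fun p : ℕ × Ω => s p.1 * ∑ i ∈ Finset.range p.1, w i p.2) (inProb P) (𝓝 0) := by
  refine tendsto_inProb_of_integral (f := fun m ω => s m * ∑ i ∈ Finset.range m, w i ω)
    (fun m => (memLp_scaled_sum hw _ m).integrable one_le_two) ?_
  refine squeeze_zero (fun m => integral_nonneg fun _ => abs_nonneg _)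
    (fun m => integral_abs_le_sqrt (memLp_scaled_sum hw _ m)) ?_
  simp_rw [integral_sq_scaled_sum hw h0 hi]
  simpa using h.sqrt

/-- **Weak law of large numbers** for independent centered variables with bounded averaged
variances. -/
lemma tendsto_avg_centered {w : ℕ → Ω → ℝ} (hw : ∀ i, MemLp (w i) 2 P)
    (h0 : ∀ i, ∫ ω, w i ω ∂P = 0) (hi : iIndepFun w P) {C : ℝ}
    (hC : ∀ m : ℕ, (m : ℝ)⁻¹ * ∑ i ∈ Finset.range m, ∫ ω, w i ω ^ 2 ∂P ≤ C) :
    Tendsto (fun p : ℕ × Ω => (p.1 : ℝ)⁻¹ * ∑ i ∈ Finset.range p.1, w i p.2)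
      (inProb P) (𝓝 0) := by
  refine tendsto_scaled_sum hw h0 hi (fun m : ℕ => (m : ℝ)⁻¹) ?_
  have h1 : Tendsto (fun m : ℕ => (m : ℝ)⁻¹ * C) atTop (𝓝 0) := by
    simpa using (tendsto_inv_atTop_zero.comp tendsto_natCast_atTop_atTop).mul_const C
  refine squeeze_zero (fun m => ?_) (fun m => ?_) h1
  · exact mul_nonneg (sq_nonneg _) (Finset.sum_nonneg fun i _ => integral_nonneg fun _ =>
      sq_nonneg _)
  · rw [pow_two, mul_assoc]
    exact mul_le_mul_of_nonneg_left (hC m) (by positivity)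

/-- Vanishing deterministic weights make normalized sums of independent centered variables
negligible. -/
lemma tendsto_normalized_sum_weight {w : ℕ → Ω → ℝ} (hw : ∀ i, MemLp (w i) 2 P)
    (h0 : ∀ i, ∫ ω, w i ω ∂P = 0) (hi : iIndepFun w P) {C : ℝ}
    (hC : ∀ m : ℕ, (m : ℝ)⁻¹ * ∑ i ∈ Finset.range m, ∫ ω, w i ω ^ 2 ∂P ≤ C)
    {κ : ℕ → ℝ} (hκ : Tendsto κ atTop (𝓝 0)) :
    Tendsto (fun p : ℕ × Ω => (√(p.1 : ℝ))⁻¹ * ∑ i ∈ Finset.range p.1, κ i * w i p.2)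
      (inProb P) (𝓝 0) := by
  refine tendsto_scaled_sum (w := fun i ω => κ i * w i ω) (fun i => (hw i).const_mul _)
    (fun i => by rw [integral_const_mul, h0, mul_zero])
    (hi.comp (fun i x => κ i * x) fun i => by fun_prop) (fun m : ℕ => (√(m : ℝ))⁻¹) ?_
  have h1 := tendsto_avg_mul (b := fun i => ∫ ω, w i ω ^ 2 ∂P)
    (fun i => integral_nonneg fun _ => sq_nonneg _) hC (by simpa using hκ.pow 2)
  refine h1.congr fun m => ?_
  rw [inv_sqrt_sq]
  simp_rw [mul_pow, integral_const_mul, mul_comm]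

end Independent

/-! ### The Lyapunov central limit theorem -/

section CLT

lemma norm_prod_sub_prod_le {ι : Type*} (s : Finset ι) (a b : ι → ℂ) (ha : ∀ i ∈ s, ‖a i‖ ≤ 1)
    (hb : ∀ i ∈ s, ‖b i‖ ≤ 1) :
    ‖∏ i ∈ s, a i - ∏ i ∈ s, b i‖ ≤ ∑ i ∈ s, ‖a i - b i‖ := by
  classical
  induction s using Finset.induction_on with
  | empty => simp
  | insert j s hj ih =>
    rw [Finset.prod_insert hj, Finset.prod_insert hj, Finset.sum_insert hj]
    have h1 := ih (fun i hi => ha i (by simp [hi])) fun i hi => hb i (by simp [hi])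
    have h2 : ‖∏ i ∈ s, a i‖ ≤ 1 := by
      rw [norm_prod]
      exact Finset.prod_le_one (fun i _ => norm_nonneg _) fun i hi => ha i (by simp [hi])
    have h3 : a j * ∏ i ∈ s, a i - b j * ∏ i ∈ s, b i =
        (a j - b j) * ∏ i ∈ s, a i + b j * (∏ i ∈ s, a i - ∏ i ∈ s, b i) := by ring
    rw [h3]
    refine (norm_add_le _ _).trans (add_le_add ?_ ?_)
    · rw [norm_mul]
      exact mul_le_of_le_one_right (norm_nonneg _) h2
    · rw [norm_mul]
      exact (mul_le_of_le_one_left (norm_nonneg _) (hb j (by simp))).trans h1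

lemma abs_exp_neg_sub_le {y : ℝ} (hy : 0 ≤ y) : |Real.exp (-y) - (1 - y)| ≤ y ^ 2 := by
  have h1 := Real.add_one_le_exp (-y)
  have h2 : Real.exp (-y) ≤ 1 - y + y ^ 2 := by
    rw [Real.exp_neg]
    have h3 := Real.add_one_le_exp y
    have h4 : (0 : ℝ) < y + 1 := by linarith
    calc (Real.exp y)⁻¹ ≤ (y + 1)⁻¹ := inv_anti₀ h4 h3
      _ ≤ 1 - y + y ^ 2 := by
        rw [inv_le_iff_one_le_mul₀ h4]
        nlinarith [pow_nonneg hy 3]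
  rw [abs_le]
  constructor <;> nlinarith [sq_nonneg y]

/-- The Lindeberg tail is dominated by the Lyapunov moment. -/
lemma sq_le_rpow_of_lt {δ ε x : ℝ} (hδ : 0 < δ) (hε : 0 < ε) (h : ε < |x|) :
    x ^ 2 ≤ ε ^ (-δ) * |x| ^ (2 + δ) := by
  have hx : 0 < |x| := hε.trans h
  rw [Real.rpow_add hx, Real.rpow_neg hε.le, Real.rpow_ofNat, sq_abs]
  have h1 : ε ^ δ ≤ |x| ^ δ := Real.rpow_le_rpow hε.le h.le hδ.le
  have h2 : 0 < ε ^ δ := Real.rpow_pos_of_pos hε δ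
  rw [inv_mul_eq_div, le_div_iff₀ h2]
  exact mul_le_mul_of_nonneg_left h1 (sq_nonneg x)

lemma sq_le_sq_add_rpow {δ ε x : ℝ} (hδ : 0 < δ) (hε : 0 < ε) :
    x ^ 2 ≤ ε ^ 2 + ε ^ (-δ) * |x| ^ (2 + δ) := by
  rcases le_or_gt |x| ε with h | h
  · have : x ^ 2 ≤ ε ^ 2 := by rw [← sq_abs]; gcongr
    have : 0 ≤ ε ^ (-δ) * |x| ^ (2 + δ) := by positivity
    linarith
  · linarith [sq_le_rpow_of_lt hδ hε h, sq_nonneg ε]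

/-- Second order expansion of `exp (i x)` with a remainder adapted to Lyapunov's condition. -/
lemma norm_exp_mul_I_sub_le {δ ε : ℝ} (hδ : 0 < δ) (hε : 0 < ε) (hε1 : ε ≤ 1) (x : ℝ) :
    ‖Complex.exp (x * Complex.I) - (1 + x * Complex.I - (x ^ 2 / 2 : ℝ))‖ ≤
      4 * (ε * x ^ 2 + ε ^ (-δ) * |x| ^ (2 + δ)) := by
  have hsmall : |x| ≤ 1 →
      ‖Complex.exp (x * Complex.I) - (1 + x * Complex.I - (x ^ 2 / 2 : ℝ))‖ ≤ |x| ^ 3 := by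
    intro hx
    have h1 := Complex.exp_bound (x := x * Complex.I) (by simpa using hx) (n := 3) (by norm_num)
    have h2 : ∑ m ∈ Finset.range 3, ((x : ℂ) * Complex.I) ^ m / (m.factorial : ℂ) =
        1 + x * Complex.I - (x ^ 2 / 2 : ℝ) := by
      simp only [Finset.sum_range_succ, Finset.range_zero, Finset.sum_empty, mul_pow,
        Complex.I_sq, Nat.factorial]
      push_cast
      ring
    rw [h2] at h1
    refine h1.trans ?_
    simp only [norm_mul, Complex.norm_I, mul_one, Complex.norm_real, Real.norm_eq_abs]
    refine mul_le_of_le_one_right (by positivity) ?_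
    norm_num [Nat.factorial]
  have hr : 0 ≤ ε ^ (-δ) * |x| ^ (2 + δ) := by positivity
  rcases le_or_gt |x| ε with h | h
  · refine (hsmall (h.trans hε1)).trans ?_
    have : |x| ^ 3 ≤ ε * x ^ 2 := by
      rw [pow_succ, sq_abs, mul_comm]
      gcongr
    nlinarith [mul_nonneg hε.le (sq_nonneg x)]
  · have h1 := sq_le_rpow_of_lt hδ hε h
    have h2 : ‖Complex.exp (x * Complex.I) - (1 + x * Complex.I - (x ^ 2 / 2 : ℝ))‖ ≤
        4 * x ^ 2 := by
      rcases le_or_gt |x| 1 with h3 | h3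
      · refine (hsmall h3).trans ?_
        rw [pow_succ, sq_abs]
        nlinarith [sq_nonneg x]
      · have h4 : ‖(1 : ℂ) + x * Complex.I - (x ^ 2 / 2 : ℝ)‖ ≤ 1 + |x| + x ^ 2 / 2 := by
          refine (norm_sub_le _ _).trans (add_le_add ((norm_add_le _ _).trans ?_) ?_)
          · simp
          · rw [Complex.norm_real, Real.norm_of_nonneg (by positivity)]
        refine (norm_sub_le _ _).trans ?_
        rw [Complex.norm_exp_ofReal_mul_I]
        nlinarith [sq_abs x]
    nlinarith [mul_nonneg hε.le (sq_nonneg x)]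

variable {Ω : Type*} [MeasurableSpace Ω] {P : Measure Ω} [IsProbabilityMeasure P]

lemma norm_integral_exp_sub_le {δ ε : ℝ} (hδ : 0 < δ) (hε : 0 < ε) (hε1 : ε ≤ 1) {x : Ω → ℝ}
    (hx : MemLp x 2 P) (h0 : ∫ ω, x ω ∂P = 0) (hp : Integrable (fun ω => |x ω| ^ (2 + δ)) P) :
    ‖∫ ω, Complex.exp (x ω * Complex.I) ∂P - ((1 - (∫ ω, x ω ^ 2 ∂P) / 2 : ℝ) : ℂ)‖ ≤
      4 * (ε * ∫ ω, x ω ^ 2 ∂P + ε ^ (-δ) * ∫ ω, |x ω| ^ (2 + δ) ∂P) := by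
  have hx1 : Integrable x P := hx.integrable one_le_two
  have hx2 : Integrable (fun ω => x ω ^ 2) P := hx.integrable_sq
  have i1 : Integrable (fun ω => Complex.exp (x ω * Complex.I)) P := by
    refine Integrable.of_bound (C := 1) ?_ (ae_of_all _ fun ω => by
      rw [Complex.norm_exp_ofReal_mul_I])
    have := hx.aestronglyMeasurable.aemeasurable
    exact AEMeasurable.aestronglyMeasurable (by fun_prop)
  have i2 : Integrable (fun ω => (1 : ℂ) + x ω * Complex.I) P :=
    (integrable_const _).add (hx1.ofReal.mul_const _)
  have i3 : Integrable (fun ω => ((x ω ^ 2 / 2 : ℝ) : ℂ)) P := (hx2.div_const 2).ofReal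
  have h1 : ∫ ω, Complex.exp (x ω * Complex.I) ∂P - ((1 - (∫ ω, x ω ^ 2 ∂P) / 2 : ℝ) : ℂ) =
      ∫ ω, (Complex.exp (x ω * Complex.I) - (1 + x ω * Complex.I - (x ω ^ 2 / 2 : ℝ))) ∂P := by
    have e1 : ∫ ω, (Complex.exp (x ω * Complex.I) -
        (1 + x ω * Complex.I - (x ω ^ 2 / 2 : ℝ))) ∂P = ∫ ω, Complex.exp (x ω * Complex.I) ∂P -
        ∫ ω, ((1 : ℂ) + x ω * Complex.I - (x ω ^ 2 / 2 : ℝ)) ∂P := integral_sub i1 (i2.sub i3)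
    have e2 : ∫ ω, ((1 : ℂ) + x ω * Complex.I) ∂P = 1 + (∫ ω, (x ω : ℂ) ∂P) * Complex.I := by
      rw [integral_add (integrable_const _) (hx1.ofReal.mul_const _), integral_mul_const]
      simp
    rw [e1, integral_sub i2 i3, e2, integral_complex_ofReal, integral_complex_ofReal, h0,
      integral_div]
    simp
  rw [h1]
  refine (norm_integral_le_integral_norm _).trans ?_
  rw [← integral_const_mul, ← integral_const_mul, ← integral_add (hx2.const_mul _)
    (hp.const_mul _), ← integral_const_mul]
  refine integral_mono_ae (i1.sub (i2.sub i3)).norm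
    (((hx2.const_mul _).add (hp.const_mul _)).const_mul _) (ae_of_all _ fun ω => ?_)
  exact norm_exp_mul_I_sub_le hδ hε hε1 (x ω)

lemma rpow_inv_sqrt (m : ℕ) (δ : ℝ) :
    ((√(m : ℝ))⁻¹) ^ (2 + δ) = ((m : ℝ) ^ (1 + δ / 2))⁻¹ := by
  rw [Real.inv_rpow (Real.sqrt_nonneg _), Real.sqrt_eq_rpow, ← Real.rpow_mul (Nat.cast_nonneg m)]
  congr 2
  ring

/-- **Lyapunov's central limit theorem**, in terms of characteristic functions at the
point `1`. -/
theorem tendsto_integral_exp_normalized_sum {δ : ℝ} (hδ : 0 < δ) {x : ℕ → Ω → ℝ}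
    (hxm : ∀ i, Measurable (x i)) (hx : ∀ i, MemLp (x i) 2 P) (h0 : ∀ i, ∫ ω, x i ω ∂P = 0)
    (hi : iIndepFun x P) (hp : ∀ i, Integrable (fun ω => |x i ω| ^ (2 + δ)) P) {v : ℝ}
    (hv : Tendsto (fun m : ℕ => (m : ℝ)⁻¹ * ∑ i ∈ Finset.range m, ∫ ω, x i ω ^ 2 ∂P)
      atTop (𝓝 v))
    (hL : Tendsto (fun m : ℕ => ((m : ℝ) ^ (1 + δ / 2))⁻¹ *
      ∑ i ∈ Finset.range m, ∫ ω, |x i ω| ^ (2 + δ) ∂P) atTop (𝓝 0)) :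
    Tendsto (fun m : ℕ => ∫ ω,
        Complex.exp ((((√(m : ℝ))⁻¹ * ∑ i ∈ Finset.range m, x i ω : ℝ) : ℂ) * Complex.I) ∂P)
      atTop (𝓝 (Complex.exp ((-(v / 2) : ℝ) : ℂ))) := by
  set V : ℕ → ℝ := fun m => (m : ℝ)⁻¹ * ∑ i ∈ Finset.range m, ∫ ω, x i ω ^ 2 ∂P with hV
  set Lp : ℕ → ℝ := fun m => ((m : ℝ) ^ (1 + δ / 2))⁻¹ *
      ∑ i ∈ Finset.range m, ∫ ω, |x i ω| ^ (2 + δ) ∂P with hLp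
  have hv0 : 0 ≤ v := ge_of_tendsto' hv fun m => mul_nonneg (by positivity)
    (Finset.sum_nonneg fun i _ => integral_nonneg fun _ => sq_nonneg _)
  -- the characteristic function of the sum factorizes
  have hprod : ∀ m : ℕ, ∫ ω,
      Complex.exp ((((√(m : ℝ))⁻¹ * ∑ i ∈ Finset.range m, x i ω : ℝ) : ℂ) * Complex.I) ∂P =
      ∏ i ∈ Finset.range m,
        ∫ ω, Complex.exp ((((√(m : ℝ))⁻¹ * x i ω : ℝ) : ℂ) * Complex.I) ∂P := by
    intro m
    have h1 := congrFun ((hi.precomp (Subtype.val_injective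
      (p := fun i => i ∈ Finset.range m))).charFun_map_fun_finsetSum_eq_prod
        (s := Finset.range m) (X := x) fun i _ => (hxm i).aemeasurable) (√(m : ℝ))⁻¹
    rw [Finset.prod_apply, charFun_apply_real, integral_map
      (Finset.measurable_fun_sum _ fun i _ => hxm i).aemeasurable (by fun_prop)] at h1
    convert h1 using 1
    · refine integral_congr_ae (ae_of_all _ fun ω => ?_)
      simp only [Complex.ofReal_mul]
    · refine Finset.prod_congr rfl fun i _ => ?_
      rw [charFun_apply_real, integral_map (hxm i).aemeasurable (by fun_prop)]
      refine integral_congr_ae (ae_of_all _ fun ω => ?_)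
      simp only [Complex.ofReal_mul]
  simp_rw [hprod]
  have hsub : Tendsto (fun m : ℕ => (∏ i ∈ Finset.range m,
        ∫ ω, Complex.exp ((((√(m : ℝ))⁻¹ * x i ω : ℝ) : ℂ) * Complex.I) ∂P) -
        Complex.exp ((-(V m / 2) : ℝ) : ℂ)) atTop (𝓝 0) := by
    -- comparison factor by factor with the Gaussian characteristic functions
    have hbound : ∀ ε : ℝ, 0 < ε → ε ≤ 1 → ∀ m : ℕ, ‖(∏ i ∈ Finset.range m,
        ∫ ω, Complex.exp ((((√(m : ℝ))⁻¹ * x i ω : ℝ) : ℂ) * Complex.I) ∂P) -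
        Complex.exp ((-(V m / 2) : ℝ) : ℂ)‖ ≤
        4 * (ε * V m + ε ^ (-δ) * Lp m) + (ε ^ 2 + ε ^ (-δ) * Lp m) * V m := by
      intro ε hε hε1 m
      set s : ℝ := (√(m : ℝ))⁻¹ with hs
      have hs0 : 0 ≤ s := by positivity
      set q : ℕ → ℝ := fun i => ∫ ω, (s * x i ω) ^ 2 ∂P with hq
      set r : ℕ → ℝ := fun i => ∫ ω, |s * x i ω| ^ (2 + δ) ∂P with hr
      have hq0 : ∀ i, 0 ≤ q i := fun i => integral_nonneg fun _ => sq_nonneg _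
      have hr0 : ∀ i, 0 ≤ r i := fun i => integral_nonneg fun _ => by positivity
      have hpi : ∀ i, Integrable (fun ω => |s * x i ω| ^ (2 + δ)) P := fun i => by
        simp_rw [abs_mul, Real.mul_rpow (abs_nonneg _) (abs_nonneg _)]
        exact (hp i).const_mul _
      have hqV : ∑ i ∈ Finset.range m, q i = V m := by
        simp only [hq, hV, mul_pow, integral_const_mul, ← Finset.mul_sum, hs, inv_sqrt_sq]
      have hrL : ∑ i ∈ Finset.range m, r i = Lp m := by
        have h1 : ∀ i, r i = s ^ (2 + δ) * ∫ ω, |x i ω| ^ (2 + δ) ∂P := fun i => by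
          simp only [hr, abs_mul, abs_of_nonneg hs0]
          simp_rw [Real.mul_rpow hs0 (abs_nonneg _)]
          rw [integral_const_mul]
        simp only [h1, hLp, ← Finset.mul_sum]
        rw [hs, rpow_inv_sqrt]
      have hexp : Complex.exp ((-(V m / 2) : ℝ) : ℂ) =
          ∏ i ∈ Finset.range m, ((Real.exp (-(q i / 2)) : ℝ) : ℂ) := by
        rw [← hqV, ← Complex.ofReal_exp, ← Complex.ofReal_prod, ← Real.exp_sum,
          Finset.sum_neg_distrib, Finset.sum_div]
      rw [hexp]
      refine (norm_prod_sub_prod_le _ _ _ (fun i _ => ?_) fun i _ => ?_).trans ?_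
      · refine (norm_integral_le_integral_norm _).trans ?_
        simp only [Complex.norm_exp_ofReal_mul_I]
        simp
      · rw [Complex.norm_real, Real.norm_of_nonneg (Real.exp_nonneg _), Real.exp_le_one_iff]
        linarith [hq0 i]
      have hterm : ∀ i ∈ Finset.range m, ‖∫ ω, Complex.exp (((s * x i ω : ℝ) : ℂ) * Complex.I) ∂P -
          ((Real.exp (-(q i / 2)) : ℝ) : ℂ)‖ ≤
          4 * (ε * q i + ε ^ (-δ) * r i) + (ε ^ 2 + ε ^ (-δ) * Lp m) * q i := by
        intro i him
        have h1 := norm_integral_exp_sub_le hδ hε hε1 ((hx i).const_mul s)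
          (by rw [integral_const_mul, h0, mul_zero]) (hpi i)
        have h2 := abs_exp_neg_sub_le (y := q i / 2) (by linarith [hq0 i])
        have h3 : q i ≤ ε ^ 2 + ε ^ (-δ) * r i := by
          calc q i ≤ ∫ ω, (ε ^ 2 + ε ^ (-δ) * |s * x i ω| ^ (2 + δ)) ∂P := by
                refine integral_mono_ae ((hx i).const_mul s).integrable_sq
                  ((integrable_const _).add ((hpi i).const_mul _)) (ae_of_all _ fun ω => ?_)
                exact sq_le_sq_add_rpow hδ hε
            _ = ε ^ 2 + ε ^ (-δ) * r i := by
                rw [integral_add (integrable_const _) ((hpi i).const_mul _), integral_const_mul]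
                simp [hr]
        have h4 : r i ≤ Lp m := by
          rw [← hrL]
          exact Finset.single_le_sum (f := r) (fun i _ => hr0 i) him
        have h5 : ‖((1 - q i / 2 : ℝ) : ℂ) - ((Real.exp (-(q i / 2)) : ℝ) : ℂ)‖ ≤ (q i / 2) ^ 2 := by
          rw [← Complex.ofReal_sub, Complex.norm_real, Real.norm_eq_abs, abs_sub_comm]
          exact h2
        have h6 : 0 ≤ ε ^ (-δ) := by positivity
        have h7 : (q i / 2) ^ 2 ≤ (ε ^ 2 + ε ^ (-δ) * Lp m) * q i := by
          have h8 : q i ≤ ε ^ 2 + ε ^ (-δ) * Lp m :=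
            h3.trans (by have := mul_le_mul_of_nonneg_left h4 h6; linarith)
          nlinarith [hq0 i, mul_le_mul_of_nonneg_right h8 (hq0 i)]
        calc _ ≤ _ + _ := norm_sub_le_norm_sub_add_norm_sub _ ((1 - q i / 2 : ℝ) : ℂ) _
          _ ≤ _ := add_le_add h1 (h5.trans h7)
      refine (Finset.sum_le_sum hterm).trans_eq ?_
      rw [Finset.sum_add_distrib, ← Finset.mul_sum, ← Finset.mul_sum, Finset.sum_add_distrib,
        ← Finset.mul_sum, ← Finset.mul_sum, hqV, hrL]
    rw [Metric.tendsto_nhds]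
    intro η hη
    -- for `ε ≤ 1` the bound tends to `4 ε v + ε² v ≤ 5 ε v`
    set ε : ℝ := min 1 (η / (5 * v + 2)) with hε
    have hε0 : 0 < ε := lt_min one_pos (by positivity)
    have hε1 : ε ≤ 1 := min_le_left _ _
    have hε2 : ε * (5 * v + 2) ≤ η := by
      rw [← le_div_iff₀ (by positivity)]
      exact min_le_right _ _
    have hlim : Tendsto (fun m => 4 * (ε * V m + ε ^ (-δ) * Lp m) +
        (ε ^ 2 + ε ^ (-δ) * Lp m) * V m) atTop
        (𝓝 (4 * (ε * v + ε ^ (-δ) * 0) + (ε ^ 2 + ε ^ (-δ) * 0) * v)) :=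
      (((hv.const_mul ε).add (hL.const_mul _)).const_mul 4).add
        (((hL.const_mul _).const_add _).mul hv)
    have hlt : 4 * (ε * v + ε ^ (-δ) * 0) + (ε ^ 2 + ε ^ (-δ) * 0) * v < η := by
      have : ε ^ 2 * v ≤ ε * v := by
        refine mul_le_mul_of_nonneg_right ?_ hv0
        nlinarith
      nlinarith
    filter_upwards [hlim.eventually_lt_const hlt] with m hm
    rw [dist_zero_right]
    exact (hbound ε hε0 hε1 m).trans_lt hm
  have hV' : Tendsto (fun m : ℕ => Complex.exp ((-(V m / 2) : ℝ) : ℂ)) atTop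
      (𝓝 (Complex.exp ((-(v / 2) : ℝ) : ℂ))) :=
    ((Complex.continuous_exp.comp Complex.continuous_ofReal).tendsto _).comp (hv.div_const 2).neg
  simpa using hsub.add hV'

end CLT

/-! ### A weak law of large numbers under Lyapunov's condition -/

section WeakLaw

/-- Truncation of a real number at the level `τ`. -/
def trunc (τ x : ℝ) : ℝ := if |x| ≤ τ then x else 0

lemma measurable_trunc (τ : ℝ) : Measurable (trunc τ) :=
  Measurable.ite (measurableSet_le (by fun_prop) (by fun_prop)) measurable_id measurable_const

lemma abs_trunc_le (τ x : ℝ) : |trunc τ x| ≤ |x| := by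
  unfold trunc; split_ifs <;> simp

lemma trunc_sq_le {τ : ℝ} (hτ : 0 ≤ τ) (x : ℝ) : trunc τ x ^ 2 ≤ τ * |x| := by
  unfold trunc; split_ifs with h
  · rw [← sq_abs, pow_two]; gcongr
  · simp; positivity

lemma abs_sub_trunc_le {τ p : ℝ} (hτ : 0 < τ) (hp : 1 < p) (x : ℝ) :
    |x - trunc τ x| ≤ τ ^ (1 - p) * |x| ^ p := by
  unfold trunc; split_ifs with h
  · simp; positivity
  · have h1 : τ < |x| := not_le.1 h
    have hx : 0 < |x| := hτ.trans h1
    have h2 : |x| ^ (1 - p) ≤ τ ^ (1 - p) :=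
      Real.rpow_le_rpow_of_nonpos hτ h1.le (by linarith)
    calc |x - 0| = |x| ^ (1 - p) * |x| ^ p := by
          rw [← Real.rpow_add hx]; simp
      _ ≤ _ := by gcongr

variable {Ω : Type*} [MeasurableSpace Ω] {P : Measure Ω} [IsProbabilityMeasure P]

/-- **Weak law of large numbers** for independent integrable variables which satisfy a Lyapunov
condition of order `p > 1`, by truncation at a level proportional to the sample size. -/
theorem tendsto_avg_of_lyapunov {p : ℝ} (hp : 1 < p) {y : ℕ → Ω → ℝ}
    (hym : ∀ i, Measurable (y i)) (hy : ∀ i, Integrable (y i) P) (hi : iIndepFun y P)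
    (hyp : ∀ i, Integrable (fun ω => |y i ω| ^ p) P) {C : ℝ}
    (hC : ∀ m : ℕ, (m : ℝ)⁻¹ * ∑ i ∈ Finset.range m, ∫ ω, |y i ω| ∂P ≤ C)
    (hL : Tendsto (fun m : ℕ => ((m : ℝ) ^ p)⁻¹ *
      ∑ i ∈ Finset.range m, ∫ ω, |y i ω| ^ p ∂P) atTop (𝓝 0)) :
    Tendsto (fun q : ℕ × Ω => (q.1 : ℝ)⁻¹ *
      ∑ i ∈ Finset.range q.1, (y i q.2 - ∫ ω, y i ω ∂P)) (inProb P) (𝓝 0) := by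
  have hC0 : 0 ≤ C := by simpa using hC 0
  refine tendsto_inProb_of_integral
    (f := fun m ω => (m : ℝ)⁻¹ * ∑ i ∈ Finset.range m, (y i ω - ∫ ω, y i ω ∂P))
    (fun m => (integrable_finsetSum _ fun i _ => (hy i).sub (integrable_const _)).const_mul _) ?_
  set Lp : ℕ → ℝ := fun m => ((m : ℝ) ^ p)⁻¹ *
    ∑ i ∈ Finset.range m, ∫ ω, |y i ω| ^ p ∂P with hLp
  have hbound : ∀ ε : ℝ, 0 < ε → ∀ m : ℕ, 0 < m →
      ∫ ω, |(m : ℝ)⁻¹ * ∑ i ∈ Finset.range m, (y i ω - ∫ ω, y i ω ∂P)| ∂P ≤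
        2 * ((ε ^ 2) ^ (1 - p) * Lp m) + ε * √C := by
    intro ε hε m hm
    have hm' : (0 : ℝ) < m := by exact_mod_cast hm
    -- at this level the truncated average has variance at most `τ C / m = ε² C`, and the mean of
    -- the part cut off is controlled by the Lyapunov ratio
    set τ : ℝ := ε ^ 2 * m with hτ
    have hτ0 : 0 < τ := by positivity
    set z : ℕ → Ω → ℝ := fun i ω => trunc τ (y i ω) with hz
    have hzm : ∀ i, Measurable (z i) := fun i => (measurable_trunc τ).comp (hym i)
    have hz1 : ∀ i, Integrable (z i) P := fun i =>
      (hy i).mono (hzm i).aestronglyMeasurable (ae_of_all _ fun ω => abs_trunc_le _ _)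
    have hz2 : ∀ i, MemLp (z i) 2 P := fun i => by
      rw [memLp_two_iff_integrable_sq (hzm i).aestronglyMeasurable]
      refine ((hy i).abs.const_mul τ).mono ((hzm i).pow_const 2).aestronglyMeasurable
        (ae_of_all _ fun ω => ?_)
      rw [Real.norm_of_nonneg (sq_nonneg _), Real.norm_of_nonneg (by positivity)]
      exact trunc_sq_le hτ0.le _
    set r : ℕ → Ω → ℝ := fun i ω => y i ω - z i ω with hr
    have hr1 : ∀ i, Integrable (r i) P := fun i => (hy i).sub (hz1 i)
    have hrle : ∀ i, ∫ ω, |r i ω| ∂P ≤ τ ^ (1 - p) * ∫ ω, |y i ω| ^ p ∂P := fun i => by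
      rw [← integral_const_mul]
      exact integral_mono_ae (hr1 i).abs ((hyp i).const_mul _)
        (ae_of_all _ fun ω => abs_sub_trunc_le hτ0 hp _)
    -- centered truncated variables
    set w : ℕ → Ω → ℝ := fun i ω => z i ω - ∫ ω, z i ω ∂P with hw
    have hw2 : ∀ i, MemLp (w i) 2 P := fun i => (hz2 i).sub (memLp_const _)
    have hw0 : ∀ i, ∫ ω, w i ω ∂P = 0 := fun i => by
      rw [integral_sub (hz1 i) (integrable_const _)]; simp
    have hwi : iIndepFun w P :=
      hi.comp (fun i x => trunc τ x - ∫ ω, z i ω ∂P)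
        fun i => (measurable_trunc τ).sub_const _
    have hwle : ∀ i, ∫ ω, w i ω ^ 2 ∂P ≤ τ * ∫ ω, |y i ω| ∂P := fun i => by
      have h1 : ∫ ω, w i ω ^ 2 ∂P = Var[z i; P] :=
        (variance_eq_integral (hzm i).aemeasurable).symm
      rw [h1, ← integral_const_mul]
      refine (variance_le_expectation_sq (hzm i).aestronglyMeasurable).trans ?_
      exact integral_mono_ae (hz2 i).integrable_sq ((hy i).abs.const_mul _)
        (ae_of_all _ fun ω => trunc_sq_le hτ0.le _)
    -- both parts are centered, so that the truncation creates no bias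
    have hdec : ∀ ω, (m : ℝ)⁻¹ * ∑ i ∈ Finset.range m, (y i ω - ∫ ω, y i ω ∂P) =
        (m : ℝ)⁻¹ * ∑ i ∈ Finset.range m, (r i ω - ∫ ω, r i ω ∂P) +
          (m : ℝ)⁻¹ * ∑ i ∈ Finset.range m, w i ω := fun ω => by
      rw [← mul_add, ← Finset.sum_add_distrib]
      congr 1
      refine Finset.sum_congr rfl fun i _ => ?_
      simp only [hr, hw]
      rw [integral_sub (hy i) (hz1 i)]
      ring
    have hA : Integrable (fun ω => (m : ℝ)⁻¹ *
        ∑ i ∈ Finset.range m, (r i ω - ∫ ω, r i ω ∂P)) P :=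
      (integrable_finsetSum _ fun i _ => (hr1 i).sub (integrable_const _)).const_mul _
    have hB := memLp_scaled_sum hw2 (m : ℝ)⁻¹ m
    have h1 : ∫ ω, |(m : ℝ)⁻¹ * ∑ i ∈ Finset.range m, (r i ω - ∫ ω, r i ω ∂P)| ∂P ≤
        2 * ((ε ^ 2) ^ (1 - p) * Lp m) := by
      have h2 : ∀ ω, |(m : ℝ)⁻¹ * ∑ i ∈ Finset.range m, (r i ω - ∫ ω, r i ω ∂P)| ≤
          (m : ℝ)⁻¹ * ∑ i ∈ Finset.range m, (|r i ω| + ∫ ω, |r i ω| ∂P) := fun ω => by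
        rw [abs_mul, abs_of_nonneg (by positivity : (0 : ℝ) ≤ (m : ℝ)⁻¹)]
        refine mul_le_mul_of_nonneg_left ((Finset.abs_sum_le_sum_abs _ _).trans
          (Finset.sum_le_sum fun i _ => ?_)) (by positivity)
        exact (abs_sub _ _).trans (add_le_add le_rfl abs_integral_le_integral_abs)
      have hint : ∀ i, Integrable (fun ω => |r i ω| + ∫ ω, |r i ω| ∂P) P := fun i =>
        (hr1 i).abs.add (integrable_const _)
      refine (integral_mono hA.abs
        ((integrable_finsetSum _ fun i _ => hint i).const_mul _) h2).trans ?_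
      rw [integral_const_mul, integral_finsetSum _ fun i _ => hint i]
      have h3 : ∀ i, ∫ ω, (|r i ω| + ∫ ω, |r i ω| ∂P) ∂P ≤
          2 * (τ ^ (1 - p) * ∫ ω, |y i ω| ^ p ∂P) := fun i => by
        rw [integral_add (hr1 i).abs (integrable_const _)]
        simp only [integral_const, probReal_univ, one_smul]
        linarith [hrle i]
      refine (mul_le_mul_of_nonneg_left (Finset.sum_le_sum fun i _ => h3 i)
        (by positivity)).trans_eq ?_
      rw [← Finset.mul_sum, ← Finset.mul_sum, hLp, hτ, Real.mul_rpow (sq_nonneg _) hm'.le]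
      have h4 : (m : ℝ)⁻¹ * (m : ℝ) ^ (1 - p) = ((m : ℝ) ^ p)⁻¹ := by
        rw [← Real.rpow_neg_one, ← Real.rpow_add hm', ← Real.rpow_neg hm'.le]
        congr 1; ring
      simp only [← h4]
      ring
    have h2 : ∫ ω, |(m : ℝ)⁻¹ * ∑ i ∈ Finset.range m, w i ω| ∂P ≤ ε * √C := by
      refine (integral_abs_le_sqrt hB).trans ?_
      rw [integral_sq_scaled_sum hw2 hw0 hwi]
      have h3 : ε * √C = √(ε ^ 2 * C) := by rw [Real.sqrt_mul (sq_nonneg _), Real.sqrt_sq hε.le]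
      rw [h3]
      apply Real.sqrt_le_sqrt
      calc ((m : ℝ)⁻¹) ^ 2 * ∑ i ∈ Finset.range m, ∫ ω, w i ω ^ 2 ∂P
          ≤ ((m : ℝ)⁻¹) ^ 2 * ∑ i ∈ Finset.range m, τ * ∫ ω, |y i ω| ∂P := by
            gcongr with i _; exact hwle i
        _ = ε ^ 2 * ((m : ℝ)⁻¹ * ∑ i ∈ Finset.range m, ∫ ω, |y i ω| ∂P) := by
            rw [← Finset.mul_sum, hτ]; field_simp
        _ ≤ ε ^ 2 * C := by gcongr; exact hC m
    calc _ ≤ ∫ ω, (|(m : ℝ)⁻¹ * ∑ i ∈ Finset.range m, (r i ω - ∫ ω, r i ω ∂P)| +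
          |(m : ℝ)⁻¹ * ∑ i ∈ Finset.range m, w i ω|) ∂P := by
          refine integral_mono ((integrable_finsetSum _ fun i _ =>
            (hy i).sub (integrable_const _)).const_mul _).abs
            (hA.abs.add (hB.integrable one_le_two).abs) fun ω => ?_
          simp only [hdec ω]
          exact abs_add_le _ _
      _ = _ := integral_add hA.abs (hB.integrable one_le_two).abs
      _ ≤ _ := add_le_add h1 h2
  rw [Metric.tendsto_nhds]
  intro η hη
  set ε : ℝ := η / (2 * (√C + 1)) with hε
  have hε0 : 0 < ε := by positivity
  have hlim : Tendsto (fun m => 2 * ((ε ^ 2) ^ (1 - p) * Lp m) + ε * √C) atTop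
      (𝓝 (2 * ((ε ^ 2) ^ (1 - p) * 0) + ε * √C)) :=
    ((hL.const_mul _).const_mul 2).add_const _
  have hlt : 2 * ((ε ^ 2) ^ (1 - p) * 0) + ε * √C < η := by
    have : ε * (2 * (√C + 1)) = η := by rw [hε]; field_simp
    nlinarith [Real.sqrt_nonneg C]
  filter_upwards [hlim.eventually_lt_const hlt, eventually_gt_atTop 0] with m hm hm0
  rw [Real.dist_eq, sub_zero, abs_of_nonneg (integral_nonneg fun _ => abs_nonneg _)]
  exact (hbound ε hε0 m hm0).trans_lt hm

end WeakLaw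

/-! ### Independent random vectors under Lyapunov's condition -/

section Vectors

variable {Ω : Type*} [MeasurableSpace Ω] {κ : Type*}

lemma abs_mul_rpow_le {δ : ℝ} (hδ : 0 < δ) (a b : ℝ) :
    |a * b| ^ (1 + δ / 2) ≤ |a| ^ (2 + δ) + |b| ^ (2 + δ) := by
  have key : ∀ a b : ℝ, |a| ≤ |b| → |a * b| ^ (1 + δ / 2) ≤ |b| ^ (2 + δ) := fun a b hab => by
    calc |a * b| ^ (1 + δ / 2) ≤ (|b| ^ (2 : ℝ)) ^ (1 + δ / 2) := by
          refine Real.rpow_le_rpow (abs_nonneg _) ?_ (by linarith)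
          rw [abs_mul, Real.rpow_two, pow_two]
          gcongr
      _ = |b| ^ (2 + δ) := by
          rw [← Real.rpow_mul (abs_nonneg _)]; congr 1; ring
  have ha : 0 ≤ |a| ^ (2 + δ) := by positivity
  have hb : 0 ≤ |b| ^ (2 + δ) := by positivity
  rcases le_total |a| |b| with hab | hab
  · linarith [key a b hab]
  · rw [mul_comm]; linarith [key b a hab]

/-- Independent centered random vectors whose averaged covariance matrices converge to `V` and
whose coordinates satisfy Lyapunov's condition of order `2 + δ`. -/
structure IsLyapunovSeq (P : Measure Ω) (δ : ℝ) (W : ℕ → Ω → κ → ℝ) (V : Matrix κ κ ℝ) :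
    Prop where
  pos : 0 < δ
  meas : ∀ i, Measurable (W i)
  indep : iIndepFun W P
  memLp : ∀ i k, MemLp (fun ω => W i ω k) 2 P
  mean : ∀ i k, ∫ ω, W i ω k ∂P = 0
  integrable : ∀ i k, Integrable (fun ω => |W i ω k| ^ (2 + δ)) P
  cov : ∀ k l, Tendsto (fun m : ℕ => (m : ℝ)⁻¹ *
    ∑ i ∈ Finset.range m, ∫ ω, W i ω k * W i ω l ∂P) atTop (𝓝 (V k l))
  lyapunov : ∀ k, Tendsto (fun m : ℕ => ((m : ℝ) ^ (1 + δ / 2))⁻¹ *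
    ∑ i ∈ Finset.range m, ∫ ω, |W i ω k| ^ (2 + δ) ∂P) atTop (𝓝 0)

namespace IsLyapunovSeq

variable {P : Measure Ω} {δ : ℝ} {W : ℕ → Ω → κ → ℝ} {V : Matrix κ κ ℝ}

section Coordinates

variable (h : IsLyapunovSeq P δ W V)
include h

lemma meas_apply (i : ℕ) (k : κ) : Measurable fun ω => W i ω k :=
  (measurable_pi_apply k).comp (h.meas i)

lemma indep_apply (k : κ) : iIndepFun (fun i ω => W i ω k) P :=
  h.indep.comp (fun _ x => x k) fun _ => measurable_pi_apply k

lemma exists_avg_sq_le (k : κ) :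
    ∃ C, ∀ m : ℕ, (m : ℝ)⁻¹ * ∑ i ∈ Finset.range m, ∫ ω, W i ω k ^ 2 ∂P ≤ C := by
  obtain ⟨C, hC⟩ := bdd_of_tendsto (h.cov k k)
  exact ⟨C, fun m => by simpa only [pow_two] using hC m⟩

lemma integral_sq_linear [Fintype κ] (t : κ → ℝ) (i : ℕ) :
    ∫ ω, (∑ k, t k * W i ω k) ^ 2 ∂P =
      ∑ k, ∑ l, t k * t l * ∫ ω, W i ω k * W i ω l ∂P := by
  have hint : ∀ k l, Integrable (fun ω => t k * t l * (W i ω k * W i ω l)) P := fun k l =>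
    ((h.memLp i k).integrable_mul (h.memLp i l)).const_mul _
  have h1 : ∀ ω, (∑ k, t k * W i ω k) ^ 2 =
      ∑ k, ∑ l, t k * t l * (W i ω k * W i ω l) := fun ω => by
    rw [pow_two, Finset.sum_mul_sum]
    refine Finset.sum_congr rfl fun k _ => Finset.sum_congr rfl fun l _ => by ring
  simp_rw [h1]
  rw [integral_finsetSum _ fun k _ => integrable_finsetSum _ fun l _ => hint k l]
  refine Finset.sum_congr rfl fun k _ => ?_
  rw [integral_finsetSum _ fun l _ => hint k l]
  exact Finset.sum_congr rfl fun l _ => integral_const_mul _ _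

lemma tendsto_avg_sq_linear [Fintype κ] (t : κ → ℝ) :
    Tendsto (fun m : ℕ => (m : ℝ)⁻¹ *
      ∑ i ∈ Finset.range m, ∫ ω, (∑ k, t k * W i ω k) ^ 2 ∂P) atTop (𝓝 (t ⬝ᵥ V *ᵥ t)) := by
  have h1 : Tendsto (fun m : ℕ => ∑ k, ∑ l, t k * t l * ((m : ℝ)⁻¹ *
      ∑ i ∈ Finset.range m, ∫ ω, W i ω k * W i ω l ∂P)) atTop
      (𝓝 (∑ k, ∑ l, t k * t l * V k l)) :=
    tendsto_finsetSum _ fun k _ => tendsto_finsetSum _ fun l _ => (h.cov k l).const_mul _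
  have h2 : t ⬝ᵥ V *ᵥ t = ∑ k, ∑ l, t k * t l * V k l := by
    simp only [dotProduct, mulVec, Finset.mul_sum]
    refine Finset.sum_congr rfl fun k _ => Finset.sum_congr rfl fun l _ => by ring
  rw [h2]
  refine h1.congr fun m => ?_
  simp_rw [h.integral_sq_linear t, Finset.mul_sum]
  rw [Finset.sum_comm' (t' := Finset.univ) (s' := fun _ => Finset.range m) (by simp)]
  refine Finset.sum_congr rfl fun k _ => ?_
  rw [Finset.sum_comm]
  refine Finset.sum_congr rfl fun i _ => Finset.sum_congr rfl fun l _ => by ring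

lemma posSemidef [Fintype κ] : V.PosSemidef := by
  refine PosSemidef.of_dotProduct_mulVec_nonneg ?_ fun t => ?_
  · ext k l
    simp only [conjTranspose_apply, star_trivial]
    refine tendsto_nhds_unique (h.cov l k) ((h.cov k l).congr fun m => ?_)
    simp_rw [mul_comm]
  · rw [star_trivial]
    exact ge_of_tendsto' (h.tendsto_avg_sq_linear t) fun m => mul_nonneg (by positivity)
      (Finset.sum_nonneg fun i _ => integral_nonneg fun _ => sq_nonneg _)

variable [IsProbabilityMeasure P]

lemma bddInProb (k : κ) :
    BddInProb P (fun m ω => (√(m : ℝ))⁻¹ * ∑ i ∈ Finset.range m, W i ω k) := by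
  obtain ⟨C, hC⟩ := h.exists_avg_sq_le k
  exact bddInProb_normalized_sum (fun i => h.memLp i k) (fun i => h.mean i k) (h.indep_apply k) hC

lemma tendsto_avg (k : κ) :
    Tendsto (fun p : ℕ × Ω => (p.1 : ℝ)⁻¹ * ∑ i ∈ Finset.range p.1, W i p.2 k)
      (inProb P) (𝓝 0) := by
  obtain ⟨C, hC⟩ := h.exists_avg_sq_le k
  exact tendsto_avg_centered (w := fun i ω => W i ω k) (fun i => h.memLp i k) (fun i => h.mean i k) (h.indep_apply k) hC

/-- The empirical second moments converge in probability to the limit covariance matrix. -/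
lemma tendsto_avg_mul (k l : κ) :
    Tendsto (fun p : ℕ × Ω => (p.1 : ℝ)⁻¹ *
      ∑ i ∈ Finset.range p.1, W i p.2 k * W i p.2 l) (inProb P) (𝓝 (V k l)) := by
  have hδ := h.pos
  have hp : 1 < 1 + δ / 2 := by linarith
  have hpt : ∀ i ω, |W i ω k * W i ω l| ^ (1 + δ / 2) ≤
      |W i ω k| ^ (2 + δ) + |W i ω l| ^ (2 + δ) := fun i ω => abs_mul_rpow_le hδ _ _
  have hm : ∀ i, Measurable fun ω => W i ω k * W i ω l := fun i =>
    (h.meas_apply i k).mul (h.meas_apply i l)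
  have hint : ∀ i, Integrable (fun ω => W i ω k * W i ω l) P := fun i =>
    (h.memLp i k).integrable_mul (h.memLp i l)
  have hsum : ∀ i, Integrable (fun ω => |W i ω k| ^ (2 + δ) + |W i ω l| ^ (2 + δ)) P := fun i =>
    (h.integrable i k).add (h.integrable i l)
  have hintp : ∀ i, Integrable (fun ω => |W i ω k * W i ω l| ^ (1 + δ / 2)) P := fun i => by
    refine (hsum i).mono ((hm i).abs.pow_const _).aestronglyMeasurable (ae_of_all _ fun ω => ?_)
    rw [Real.norm_of_nonneg (by positivity), Real.norm_of_nonneg (by positivity)]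
    exact hpt i ω
  obtain ⟨C₁, hC₁⟩ := h.exists_avg_sq_le k
  obtain ⟨C₂, hC₂⟩ := h.exists_avg_sq_le l
  have hC : ∀ m : ℕ, (m : ℝ)⁻¹ * ∑ i ∈ Finset.range m, ∫ ω, |W i ω k * W i ω l| ∂P ≤
      C₁ + C₂ := by
    intro m
    refine le_trans ?_ (add_le_add (hC₁ m) (hC₂ m))
    rw [← mul_add, ← Finset.sum_add_distrib]
    gcongr with i _
    rw [← integral_add (h.memLp i k).integrable_sq (h.memLp i l).integrable_sq]
    refine integral_mono (hint i).abs ((h.memLp i k).integrable_sq.add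
      (h.memLp i l).integrable_sq) fun ω => ?_
    simp only [abs_mul]
    have := two_mul_le_add_sq |W i ω k| |W i ω l|
    simp only [sq_abs] at this
    nlinarith [abs_nonneg (W i ω k), abs_nonneg (W i ω l)]
  have hL : Tendsto (fun m : ℕ => ((m : ℝ) ^ (1 + δ / 2))⁻¹ *
      ∑ i ∈ Finset.range m, ∫ ω, |W i ω k * W i ω l| ^ (1 + δ / 2) ∂P) atTop (𝓝 0) := by
    have h0 := (h.lyapunov k).add (h.lyapunov l)
    rw [add_zero] at h0
    refine squeeze_zero (fun m => ?_) (fun m => ?_) h0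
    · exact mul_nonneg (by positivity) (Finset.sum_nonneg fun i _ => integral_nonneg fun _ => by
        positivity)
    · rw [← mul_add, ← Finset.sum_add_distrib]
      gcongr with i _
      rw [← integral_add (h.integrable i k) (h.integrable i l)]
      exact integral_mono (hintp i) (hsum i) fun ω => hpt i ω
  have h1 := tendsto_avg_of_lyapunov hp hm hint
    (h.indep.comp (fun _ x => x k * x l) fun _ =>
      (measurable_pi_apply k).mul (measurable_pi_apply l)) hintp hC hL
  have h2 := h1.add ((h.cov k l).comp tendsto_fst_inProb)
  rw [zero_add] at h2
  refine h2.congr fun p => ?_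
  simp only [Function.comp_apply, Finset.sum_sub_distrib]
  ring

end Coordinates

variable [Fintype κ] [DecidableEq κ] [IsProbabilityMeasure P]

/-- **Multivariate Lyapunov central limit theorem.** -/
theorem tendstoInDistribution (h : IsLyapunovSeq P δ W V) :
    TendstoInDistribution
      (fun (m : ℕ) ω => WithLp.toLp 2 ((√(m : ℝ))⁻¹ • ∑ i ∈ Finset.range m, W i ω))
      atTop id (fun _ => P) (multivariateGaussian (0 : EuclideanSpace ℝ κ) V) := by
  have hδ := h.pos
  have hmeas : ∀ m : ℕ, Measurable fun ω =>
      WithLp.toLp 2 ((√(m : ℝ))⁻¹ • ∑ i ∈ Finset.range m, W i ω) := fun m =>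
    (WithLp.measurable_toLp 2 _).comp
      ((Finset.measurable_fun_sum _ fun i _ => h.meas i).fun_const_smul _)
  refine ⟨fun m => (hmeas m).aemeasurable, aemeasurable_id, ?_⟩
  refine ProbabilityMeasure.tendsto_iff_tendsto_charFun.2 fun t => ?_
  simp only [ProbabilityMeasure.coe_mk, Measure.map_id]
  rw [charFun_multivariateGaussian h.posSemidef]
  have hx2 : ∀ i, MemLp (fun ω => ∑ k, t k * W i ω k) 2 P := fun i =>
    memLp_finsetSum _ fun k _ => (h.memLp i k).const_mul _
  have hxm : ∀ i, Measurable fun ω => ∑ k, t k * W i ω k := fun i =>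
    Finset.measurable_fun_sum _ fun k _ => (h.meas_apply i k).const_mul _
  have hpt : ∀ i ω, |∑ k, t k * W i ω k| ^ (2 + δ) ≤ (Fintype.card κ : ℝ) ^ (1 + δ) *
      ∑ k, |t k| ^ (2 + δ) * |W i ω k| ^ (2 + δ) := fun i ω => by
    have h1 := Real.rpow_sum_le_const_mul_sum_rpow Finset.univ (fun k => t k * W i ω k)
      (p := 2 + δ) (by linarith)
    have h2 : (2 + δ - 1) = 1 + δ := by ring
    rw [h2, Finset.card_univ] at h1
    refine (Real.rpow_le_rpow (abs_nonneg _) (Finset.abs_sum_le_sum_abs _ _)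
      (by linarith)).trans (h1.trans_eq ?_)
    congr 1
    refine Finset.sum_congr rfl fun k _ => ?_
    rw [abs_mul, Real.mul_rpow (abs_nonneg _) (abs_nonneg _)]
  have hdom : ∀ i, Integrable (fun ω => (Fintype.card κ : ℝ) ^ (1 + δ) *
      ∑ k, |t k| ^ (2 + δ) * |W i ω k| ^ (2 + δ)) P := fun i =>
    (integrable_finsetSum _ fun k _ => (h.integrable i k).const_mul _).const_mul _
  have hint : ∀ i, Integrable (fun ω => |∑ k, t k * W i ω k| ^ (2 + δ)) P := fun i => by
    refine (hdom i).mono ((hxm i).abs.pow_const _).aestronglyMeasurable (ae_of_all _ fun ω => ?_)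
    rw [Real.norm_of_nonneg (by positivity)]
    exact (hpt i ω).trans (le_abs_self _)
  have hL : Tendsto (fun m : ℕ => ((m : ℝ) ^ (1 + δ / 2))⁻¹ *
      ∑ i ∈ Finset.range m, ∫ ω, |∑ k, t k * W i ω k| ^ (2 + δ) ∂P) atTop (𝓝 0) := by
    have h1 : Tendsto (fun m : ℕ => (Fintype.card κ : ℝ) ^ (1 + δ) *
        ∑ k, |t k| ^ (2 + δ) * (((m : ℝ) ^ (1 + δ / 2))⁻¹ *
          ∑ i ∈ Finset.range m, ∫ ω, |W i ω k| ^ (2 + δ) ∂P)) atTop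
        (𝓝 ((Fintype.card κ : ℝ) ^ (1 + δ) * ∑ k, |t k| ^ (2 + δ) * 0)) :=
      (tendsto_finsetSum _ fun k _ => (h.lyapunov k).const_mul _).const_mul _
    simp only [mul_zero, Finset.sum_const_zero] at h1
    refine squeeze_zero (fun m => ?_) (fun m => ?_) h1
    · exact mul_nonneg (by positivity) (Finset.sum_nonneg fun i _ => integral_nonneg fun _ => by
        positivity)
    · have h2 : ∀ i, ∫ ω, |∑ k, t k * W i ω k| ^ (2 + δ) ∂P ≤ (Fintype.card κ : ℝ) ^ (1 + δ) *
          ∑ k, |t k| ^ (2 + δ) * ∫ ω, |W i ω k| ^ (2 + δ) ∂P := fun i => by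
        refine (integral_mono (hint i) (hdom i) (hpt i)).trans_eq ?_
        rw [integral_const_mul, integral_finsetSum _ fun k _ => (h.integrable i k).const_mul _]
        simp_rw [integral_const_mul]
      refine (mul_le_mul_of_nonneg_left (Finset.sum_le_sum fun i _ => h2 i)
        (by positivity)).trans_eq ?_
      simp_rw [Finset.mul_sum]
      rw [Finset.sum_comm]
      refine Finset.sum_congr rfl fun k _ => Finset.sum_congr rfl fun i _ => by ring
  have h1 := tendsto_integral_exp_normalized_sum hδ hxm hx2
    (fun i => by
      rw [integral_finsetSum _ fun k _ => ((h.memLp i k).integrable one_le_two).const_mul _]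
      simp [integral_const_mul, h.mean])
    (h.indep.comp (fun _ x => ∑ k, t k * x k) fun _ => by fun_prop) hint
    (h.tendsto_avg_sq_linear t) hL
  convert h1 using 1
  · funext m
    rw [charFun_apply, integral_map (hmeas m).aemeasurable (by fun_prop)]
    refine integral_congr_ae (ae_of_all _ fun ω => ?_)
    simp only [PiLp.inner_apply, Finset.sum_apply, Pi.smul_apply, smul_eq_mul, RCLike.inner_apply,
      conj_trivial]
    congr 3
    simp_rw [Finset.mul_sum]
    rw [Finset.sum_comm]
    refine Finset.sum_congr rfl fun k _ => Finset.sum_congr rfl fun i _ => by ring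
  · simp

end IsLyapunovSeq

end Vectors

/-! ### The limit law of the normalized error sums -/

section ErrorModel

variable {n d : ℕ} {Ω : Type*} [MeasurableSpace Ω]

/-- The probabilistic assumptions on the regressors `a₀ i` and the errors `e i`, stated for all
columns: `S i` is the relative covariance matrix of `e i`, `Sinf` its limit, `VA` the limit of
`m⁻¹ A₀ᵀ A₀`, and `μ₄` the limit of the averaged fourth moments. -/
structure IsErrorModel (P : Measure Ω) (δ : ℝ) (a₀ : ℕ → Fin n → ℝ) (e : ℕ → Ω → Col n d → ℝ)
    (σsq : ℝ) (S : ℕ → Matrix (Col n d) (Col n d) ℝ) (Sinf : Matrix (Col n d) (Col n d) ℝ)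
    (VA : Matrix (Fin n) (Fin n) ℝ) (μ₄ : Col n d → Col n d → Col n d → Col n d → ℝ) : Prop where
  pos : 0 < δ
  meas : ∀ i, Measurable (e i)
  indep : iIndepFun e P
  mean : ∀ i j, ∫ ω, e i ω j ∂P = 0
  moment : ∃ K : ℝ, ∀ i j, Integrable (fun ω => |e i ω j| ^ (4 + 2 * δ)) P ∧
    ∫ ω, |e i ω j| ^ (4 + 2 * δ) ∂P ≤ K
  second : ∀ i j k, ∫ ω, e i ω j * e i ω k ∂P = σsq * S i j k
  third : ∀ i j k l, ∫ ω, e i ω j * e i ω k * e i ω l ∂P = 0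
  fourth : ∀ j k l v, Tendsto (fun m : ℕ => (m : ℝ)⁻¹ *
    ∑ i ∈ Finset.range m, ∫ ω, e i ω j * e i ω k * e i ω l * e i ω v ∂P) atTop (𝓝 (μ₄ j k l v))
  tendsto_S : ∀ j k, Tendsto (fun i => S i j k) atTop (𝓝 (Sinf j k))
  tendsto_VA : ∀ j k, Tendsto (fun m : ℕ => (m : ℝ)⁻¹ *
    ∑ i ∈ Finset.range m, a₀ i j * a₀ i k) atTop (𝓝 (VA j k))
  lyapunov : Tendsto (fun m : ℕ => ((m : ℝ) ^ (1 + δ / 2))⁻¹ *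
      ∑ i ∈ Finset.range m, ‖WithLp.toLp 2 (a₀ i)‖ ^ (2 + δ)) atTop (𝓝 0)

/-- Index set of the entries of a pair of matrices `(G₁, G₂)`. -/
abbrev PairIdx (n d : ℕ) : Type := (Fin n × Col n d) ⊕ (Col n d × Col n d)

/-- The entries of `W = (a₀ c̃ᵀ, c̃ c̃ᵀ - σ² S)` as a single vector. -/
def vecW (a₀ : Fin n → ℝ) (e : Col n d → ℝ) (σsq : ℝ) (S : Matrix (Col n d) (Col n d) ℝ) :
    PairIdx n d → ℝ :=
  Sum.elim (fun q => a₀ q.1 * e q.2) fun q => e q.1 * e q.2 - σsq * S q.1 q.2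

/-- The limit covariance matrix of the normalized sums of `W`; the two blocks are uncorrelated. -/
def covW (σsq : ℝ) (Sinf : Matrix (Col n d) (Col n d) ℝ) (VA : Matrix (Fin n) (Fin n) ℝ)
    (μ₄ : Col n d → Col n d → Col n d → Col n d → ℝ) : Matrix (PairIdx n d) (PairIdx n d) ℝ :=
  fromBlocks (of fun p q => VA p.1 q.1 * (σsq * Sinf p.2 q.2)) 0 0
    (of fun p q => μ₄ p.1 p.2 q.1 q.2 - σsq * Sinf p.1 p.2 * (σsq * Sinf q.1 q.2))

lemma rpow_le_one_add_rpow {p q x : ℝ} (hx : 0 ≤ x) (hp : 0 ≤ p) (hpq : p ≤ q) :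
    x ^ p ≤ 1 + x ^ q := by
  rcases le_total x 1 with h | h
  · have := Real.rpow_le_one hx h hp
    have : 0 ≤ x ^ q := by positivity
    linarith
  · have := Real.rpow_le_rpow_of_exponent_le h hpq
    linarith

lemma tendsto_avg_mul_of_tendsto {x s : ℕ → ℝ} {l c C : ℝ}
    (hx : Tendsto (fun m : ℕ => (m : ℝ)⁻¹ * ∑ i ∈ Finset.range m, x i) atTop (𝓝 l))
    (hC : ∀ m : ℕ, (m : ℝ)⁻¹ * ∑ i ∈ Finset.range m, |x i| ≤ C) (hs : Tendsto s atTop (𝓝 c)) :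
    Tendsto (fun m : ℕ => (m : ℝ)⁻¹ * ∑ i ∈ Finset.range m, x i * s i) atTop (𝓝 (l * c)) := by
  have h1 := tendsto_avg_mul (b := fun i => |x i|) (fun i => abs_nonneg _) hC
    (δ := fun i => |s i - c|) (by simpa using (hs.sub_const c).abs)
  have h2 : Tendsto (fun m : ℕ => (m : ℝ)⁻¹ * ∑ i ∈ Finset.range m, x i * (s i - c))
      atTop (𝓝 0) := by
    refine squeeze_zero_norm (fun m => ?_) h1
    rw [norm_mul, Real.norm_of_nonneg (by positivity : (0 : ℝ) ≤ (m : ℝ)⁻¹)]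
    refine mul_le_mul_of_nonneg_left ((norm_sum_le _ _).trans_eq ?_) (by positivity)
    exact Finset.sum_congr rfl fun i _ => by rw [norm_mul, Real.norm_eq_abs, Real.norm_eq_abs]
  have h3 := h2.add (hx.mul_const c)
  rw [zero_add] at h3
  refine h3.congr fun m => ?_
  simp only [mul_sub, Finset.sum_sub_distrib, ← Finset.sum_mul]
  ring

namespace IsErrorModel

variable {P : Measure Ω} {δ : ℝ} {a₀ : ℕ → Fin n → ℝ}
  {e : ℕ → Ω → Col n d → ℝ} {σsq : ℝ} {S : ℕ → Matrix (Col n d) (Col n d) ℝ}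
  {Sinf : Matrix (Col n d) (Col n d) ℝ} {VA : Matrix (Fin n) (Fin n) ℝ}
  {μ₄ : Col n d → Col n d → Col n d → Col n d → ℝ}
  (h : IsErrorModel P δ a₀ e σsq S Sinf VA μ₄)

include h

lemma meas_apply (i : ℕ) (j : Col n d) : Measurable fun ω => e i ω j :=
  (measurable_pi_apply j).comp (h.meas i)

lemma exists_avg_regressor_sq_le :
    ∃ C, ∀ m : ℕ, (m : ℝ)⁻¹ * ∑ i ∈ Finset.range m, ∑ j, a₀ i j ^ 2 ≤ C := by
  have h1 : Tendsto (fun m : ℕ => ∑ j, (m : ℝ)⁻¹ * ∑ i ∈ Finset.range m, a₀ i j * a₀ i j) atTop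
      (𝓝 (∑ j, VA j j)) := tendsto_finsetSum _ fun j _ => h.tendsto_VA j j
  obtain ⟨C, hC⟩ := bdd_of_tendsto h1
  refine ⟨C, fun m => (hC m).trans_eq' ?_⟩
  rw [← Finset.mul_sum, Finset.sum_comm]
  simp only [pow_two]

lemma exists_avg_abs_mul_le (j k : Fin n) :
    ∃ C, ∀ m : ℕ, (m : ℝ)⁻¹ * ∑ i ∈ Finset.range m, |a₀ i j * a₀ i k| ≤ C := by
  obtain ⟨C, hC⟩ := h.exists_avg_regressor_sq_le
  refine ⟨C, fun m => (mul_le_mul_of_nonneg_left (Finset.sum_le_sum fun i _ => ?_)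
    (by positivity)).trans (hC m)⟩
  have h1 := Finset.single_le_sum (f := fun j => a₀ i j ^ 2) (fun j _ => sq_nonneg _)
    (Finset.mem_univ j)
  have h2 := Finset.single_le_sum (f := fun j => a₀ i j ^ 2) (fun j _ => sq_nonneg _)
    (Finset.mem_univ k)
  have h3 := two_mul_le_add_sq |a₀ i j| |a₀ i k|
  simp only [sq_abs] at h1 h2 h3
  rw [abs_mul]
  linarith

lemma exists_abs_S_le : ∃ B : ℝ, 0 ≤ B ∧ ∀ i j k, |S i j k| ≤ B := by
  have h1 : Tendsto (fun i => ∑ j, ∑ k, |S i j k|) atTop (𝓝 (∑ j, ∑ k, |Sinf j k|)) :=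
    tendsto_finsetSum _ fun j _ => tendsto_finsetSum _ fun k _ => (h.tendsto_S j k).abs
  obtain ⟨C, hC⟩ := bdd_of_tendsto h1
  refine ⟨|C|, abs_nonneg _, fun i j k => ?_⟩
  have h2 := Finset.single_le_sum (f := fun k => |S i j k|) (fun k _ => abs_nonneg _)
    (Finset.mem_univ k)
  have h3 := Finset.single_le_sum (f := fun j => ∑ k, |S i j k|)
    (fun j _ => Finset.sum_nonneg fun k _ => abs_nonneg _) (Finset.mem_univ j)
  exact (h2.trans h3).trans ((hC i).trans (le_abs_self C))

lemma abs_regressor_rpow_le (i : ℕ) (j : Fin n) :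
    |a₀ i j| ^ (2 + δ) ≤ ‖WithLp.toLp 2 (a₀ i)‖ ^ (2 + δ) := by
  refine Real.rpow_le_rpow (abs_nonneg _) ?_ (by linarith [h.pos])
  simpa using PiLp.norm_apply_le (WithLp.toLp 2 (a₀ i)) j

lemma abs_mul_sub_rpow_le (i : ℕ) (ω : Ω) (j k : Col n d) :
    |e i ω j * e i ω k - σsq * S i j k| ^ (2 + δ) ≤ 2 ^ (1 + δ) *
      ((|e i ω j| ^ (4 + 2 * δ) + |e i ω k| ^ (4 + 2 * δ)) + |σsq * S i j k| ^ (2 + δ)) := by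
  have hp := h.pos
  have h1 := abs_mul_rpow_le (δ := 2 + 2 * δ) (by linarith) (e i ω j) (e i ω k)
  have e1 : 1 + (2 + 2 * δ) / 2 = 2 + δ := by ring
  have e2 : 2 + (2 + 2 * δ) = 4 + 2 * δ := by ring
  rw [e1, e2] at h1
  have h2 := Real.rpow_sum_le_const_mul_sum_rpow (Finset.univ : Finset (Fin 2))
    ![e i ω j * e i ω k, σsq * S i j k] (p := 2 + δ) (by linarith)
  simp only [Fin.sum_univ_two, cons_val_zero, cons_val_one, Finset.card_univ,
    Fintype.card_fin] at h2
  have e3 : 2 + δ - 1 = 1 + δ := by ring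
  rw [e3] at h2
  refine (Real.rpow_le_rpow (abs_nonneg _) (abs_sub _ _) (by linarith)).trans (h2.trans ?_)
  push_cast
  gcongr

variable [IsProbabilityMeasure P]

lemma integrable_rpow {p : ℝ} (hp : 0 ≤ p) (hp' : p ≤ 4 + 2 * δ) (i : ℕ) (j : Col n d) :
    Integrable (fun ω => |e i ω j| ^ p) P := by
  obtain ⟨K, hK⟩ := h.moment
  refine ((integrable_const (1 : ℝ)).add (hK i j).1).mono
    ((h.meas_apply i j).abs.pow_const _).aestronglyMeasurable (ae_of_all _ fun ω => ?_)
  rw [Real.norm_of_nonneg (by positivity)]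
  exact (rpow_le_one_add_rpow (abs_nonneg _) hp hp').trans (le_abs_self _)

lemma exists_integral_rpow_le : ∃ K : ℝ, 0 ≤ K ∧ ∀ p : ℝ, 0 ≤ p → p ≤ 4 + 2 * δ → ∀ i j,
    ∫ ω, |e i ω j| ^ p ∂P ≤ K := by
  obtain ⟨K, hK⟩ := h.moment
  refine ⟨1 + |K|, by positivity, fun p hp hp' i j => ?_⟩
  refine (integral_mono (h.integrable_rpow hp hp' i j) ((integrable_const (1 : ℝ)).add (hK i j).1)
    fun ω => rpow_le_one_add_rpow (abs_nonneg _) hp hp').trans ?_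
  rw [integral_add' (integrable_const (1 : ℝ)) (hK i j).1]
  simp only [integral_const, probReal_univ, one_smul]
  linarith [(hK i j).2, le_abs_self K]

lemma memLp (i : ℕ) (j : Col n d) : MemLp (fun ω => e i ω j) 2 P := by
  rw [memLp_two_iff_integrable_sq (h.meas_apply i j).aestronglyMeasurable]
  have := h.integrable_rpow (p := 2) (by norm_num) (by linarith [h.pos]) i j
  simpa only [Real.rpow_two, sq_abs] using this

lemma memLp_mul (i : ℕ) (j k : Col n d) : MemLp (fun ω => e i ω j * e i ω k) 2 P := by
  have hm : Measurable fun ω => e i ω j * e i ω k := (h.meas_apply i j).mul (h.meas_apply i k)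
  rw [memLp_two_iff_integrable_sq hm.aestronglyMeasurable]
  have hp := h.pos
  have h4 : ∀ j, Integrable (fun ω => |e i ω j| ^ (2 + 2 : ℝ)) P := fun j =>
    h.integrable_rpow (by norm_num) (by linarith) i j
  refine ((h4 j).add (h4 k)).mono (hm.pow_const 2).aestronglyMeasurable (ae_of_all _ fun ω => ?_)
  rw [Real.norm_of_nonneg (sq_nonneg _)]
  have h1 := abs_mul_rpow_le two_pos (e i ω j) (e i ω k)
  have h2 : (1 + 2 / 2 : ℝ) = 2 := by norm_num
  rw [h2, Real.rpow_two, sq_abs] at h1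
  exact h1.trans (le_abs_self _)

lemma integrable_mul_mul (i : ℕ) (j k l : Col n d) :
    Integrable (fun ω => e i ω j * e i ω k * e i ω l) P :=
  (h.memLp_mul i j k).integrable_mul (h.memLp i l)

/-- The sequence `W i = (a₀ c̃ᵀ, c̃ c̃ᵀ - σ² S)` satisfies the assumptions of the central limit
theorem; the vanishing third moments make its two blocks uncorrelated. -/
theorem isLyapunovSeq :
    IsLyapunovSeq P δ (fun i ω => vecW (a₀ i) (e i ω) σsq (S i)) (covW σsq Sinf VA μ₄) := by
  have hp := h.pos
  have hl : ∀ i j k, Integrable (fun ω => |a₀ i j * e i ω k| ^ (2 + δ)) P := fun i j k => by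
    simp_rw [abs_mul, Real.mul_rpow (abs_nonneg _) (abs_nonneg _)]
    exact (h.integrable_rpow (by linarith) (by linarith) i k).const_mul _
  have hr' : ∀ i j k, Integrable (fun ω => 2 ^ (1 + δ) *
      ((|e i ω j| ^ (4 + 2 * δ) + |e i ω k| ^ (4 + 2 * δ)) + |σsq * S i j k| ^ (2 + δ))) P :=
    fun i j k => (((h.integrable_rpow (by linarith) le_rfl i j).add
      (h.integrable_rpow (by linarith) le_rfl i k)).add (integrable_const _)).const_mul _
  have hrm : ∀ i j k, Measurable fun ω => e i ω j * e i ω k - σsq * S i j k := fun i j k =>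
    ((h.meas_apply i j).mul (h.meas_apply i k)).sub_const _
  have hr : ∀ i j k, Integrable (fun ω => |e i ω j * e i ω k - σsq * S i j k| ^ (2 + δ)) P :=
    fun i j k => by
      refine (hr' i j k).mono ((hrm i j k).abs.pow_const _).aestronglyMeasurable
        (ae_of_all _ fun ω => ?_)
      rw [Real.norm_of_nonneg (by positivity)]
      exact (h.abs_mul_sub_rpow_le i ω j k).trans (le_abs_self _)
  have hmem : ∀ i k, MemLp (fun ω => vecW (a₀ i) (e i ω) σsq (S i) k) 2 P := by
    rintro i (⟨j, k⟩ | ⟨j, k⟩)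
    · exact (h.memLp i k).const_mul _
    · exact (h.memLp_mul i j k).sub (memLp_const _)
  have hint : ∀ i j k, Integrable (fun ω => e i ω j * e i ω k) P := fun i j k =>
    (h.memLp_mul i j k).integrable one_le_two
  obtain ⟨K, hK0, hK⟩ := h.exists_integral_rpow_le
  refine ⟨hp, fun i => ?_, ?_, hmem, ?_, ?_, ?_, ?_⟩
  · refine measurable_pi_lambda _ ?_
    rintro (⟨j, k⟩ | ⟨j, k⟩)
    · exact (h.meas_apply i k).const_mul _
    · exact hrm i j k
  · refine h.indep.comp (fun i x => vecW (a₀ i) x σsq (S i)) fun i => measurable_pi_lambda _ ?_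
    rintro (⟨j, k⟩ | ⟨j, k⟩)
    · exact (measurable_pi_apply k).const_mul _
    · exact ((measurable_pi_apply j).mul (measurable_pi_apply k)).sub_const _
  · rintro i (⟨j, k⟩ | ⟨j, k⟩)
    · simp [vecW, integral_const_mul, h.mean]
    · simp only [vecW, Sum.elim_inr]
      rw [integral_sub (hint i j k) (integrable_const _), h.second]
      simp
  · rintro i (⟨j, k⟩ | ⟨j, k⟩)
    · exact hl i j k
    · exact hr i j k
  · have hcross : ∀ i (p : Fin n × Col n d) (q : Col n d × Col n d),
        ∫ ω, a₀ i p.1 * e i ω p.2 * (e i ω q.1 * e i ω q.2 - σsq * S i q.1 q.2) ∂P = 0 := by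
      intro i p q
      have h1 : ∀ ω, a₀ i p.1 * e i ω p.2 * (e i ω q.1 * e i ω q.2 - σsq * S i q.1 q.2) =
          a₀ i p.1 * (e i ω q.1 * e i ω q.2 * e i ω p.2) -
            a₀ i p.1 * (σsq * S i q.1 q.2) * e i ω p.2 := fun ω => by ring
      simp_rw [h1]
      rw [integral_sub ((h.integrable_mul_mul i _ _ _).const_mul _)
        (((h.memLp i p.2).integrable one_le_two).const_mul _), integral_const_mul,
        integral_const_mul, h.third, h.mean]
      simp
    rintro (⟨j, k⟩ | ⟨j, k⟩) (⟨j', k'⟩ | ⟨j', k'⟩)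
    · obtain ⟨C, hC⟩ := h.exists_avg_abs_mul_le j j'
      refine (tendsto_avg_mul_of_tendsto (h.tendsto_VA j j') hC
        ((h.tendsto_S k k').const_mul σsq)).congr fun m => ?_
      congr 1
      refine Finset.sum_congr rfl fun i _ => ?_
      simp only [vecW, Sum.elim_inl]
      rw [← h.second, ← integral_const_mul]
      exact integral_congr_ae (ae_of_all _ fun ω => by ring)
    · simp only [vecW, Sum.elim_inl, Sum.elim_inr, covW, fromBlocks_apply₁₂, Matrix.zero_apply]
      refine tendsto_const_nhds.congr fun m => ?_
      simp only [hcross _ (j, k) (j', k'), Finset.sum_const_zero, mul_zero]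
    · simp only [vecW, Sum.elim_inl, Sum.elim_inr, covW, fromBlocks_apply₂₁, Matrix.zero_apply]
      refine tendsto_const_nhds.congr fun m => ?_
      simp only [mul_comm (_ - _), hcross _ (j', k') (j, k), Finset.sum_const_zero, mul_zero]
    · have h1 : Tendsto (fun i => σsq * S i j k * (σsq * S i j' k')) atTop
          (𝓝 (σsq * Sinf j k * (σsq * Sinf j' k'))) :=
        ((h.tendsto_S j k).const_mul _).mul ((h.tendsto_S j' k').const_mul _)
      refine ((h.fourth j k j' k').sub (tendsto_avg_of_tendsto h1)).congr fun m => ?_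
      rw [← mul_sub, ← Finset.sum_sub_distrib]
      congr 1
      refine Finset.sum_congr rfl fun i _ => ?_
      simp only [vecW, Sum.elim_inr]
      have i4 : Integrable (fun ω => e i ω j * e i ω k * e i ω j' * e i ω k') P := by
        have := (h.memLp_mul i j k).integrable_mul (h.memLp_mul i j' k')
        refine this.congr (ae_of_all _ fun ω => ?_)
        simp only [Pi.mul_apply]; ring
      have h2 : ∀ ω, (e i ω j * e i ω k - σsq * S i j k) * (e i ω j' * e i ω k' - σsq * S i j' k') =
          e i ω j * e i ω k * e i ω j' * e i ω k' - (σsq * S i j' k' * (e i ω j * e i ω k) +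
            σsq * S i j k * (e i ω j' * e i ω k')) + σsq * S i j k * (σsq * S i j' k') :=
        fun ω => by ring
      simp_rw [h2]
      have i2 : Integrable (fun ω => σsq * S i j' k' * (e i ω j * e i ω k) +
          σsq * S i j k * (e i ω j' * e i ω k')) P :=
        ((hint i j k).const_mul _).add ((hint i j' k').const_mul _)
      have i3 : Integrable (fun ω => e i ω j * e i ω k * e i ω j' * e i ω k' -
          (σsq * S i j' k' * (e i ω j * e i ω k) + σsq * S i j k * (e i ω j' * e i ω k'))) P :=
        i4.sub i2
      rw [integral_add i3 (integrable_const _), integral_sub i4 i2,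
        integral_add ((hint i j k).const_mul _) ((hint i j' k').const_mul _),
        integral_const_mul, integral_const_mul, h.second, h.second]
      simp only [integral_const, probReal_univ, one_smul]
      ring
  · rintro (⟨j, k⟩ | ⟨j, k⟩)
    · have h1 := h.lyapunov.mul_const K
      rw [zero_mul] at h1
      refine squeeze_zero (fun m => ?_) (fun m => ?_) h1
      · exact mul_nonneg (by positivity) (Finset.sum_nonneg fun i _ => integral_nonneg fun _ => by
          positivity)
      · rw [mul_assoc, Finset.sum_mul]
        refine mul_le_mul_of_nonneg_left (Finset.sum_le_sum fun i _ => ?_) (by positivity)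
        simp only [vecW, Sum.elim_inl, abs_mul]
        simp_rw [Real.mul_rpow (abs_nonneg _) (abs_nonneg _)]
        rw [integral_const_mul]
        exact mul_le_mul (h.abs_regressor_rpow_le i j) (hK _ (by linarith) (by linarith) i k)
          (integral_nonneg fun _ => by positivity) (by positivity)
    · obtain ⟨B, hB0, hB⟩ := h.exists_abs_S_le
      set C : ℝ := 2 ^ (1 + δ) * ((K + K) + (|σsq| * B) ^ (2 + δ)) with hC
      have hle : ∀ i, ∫ ω, |vecW (a₀ i) (e i ω) σsq (S i) (Sum.inr (j, k))| ^ (2 + δ) ∂P ≤ C := by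
        intro i
        refine (integral_mono (hr i j k) (hr' i j k) fun ω =>
          h.abs_mul_sub_rpow_le i ω j k).trans ?_
        have hi4 := fun j => h.integrable_rpow (p := 4 + 2 * δ) (by linarith) le_rfl i j
        have hi2 : Integrable (fun ω => |e i ω j| ^ (4 + 2 * δ) + |e i ω k| ^ (4 + 2 * δ)) P :=
          (hi4 j).add (hi4 k)
        rw [integral_const_mul, integral_add hi2 (integrable_const _),
          integral_add (hi4 j) (hi4 k)]
        simp only [integral_const, probReal_univ, one_smul]
        rw [hC]
        gcongr
        · exact hK _ (by linarith) le_rfl i j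
        · exact hK _ (by linarith) le_rfl i k
        · rw [abs_mul]
          gcongr
          exact hB i j k
      have hlim : Tendsto (fun m : ℕ => (m : ℝ) ^ (-(δ / 2)) * C) atTop (𝓝 0) := by
        have h2 := (tendsto_rpow_neg_atTop (y := δ / 2) (by linarith)).comp
          (tendsto_natCast_atTop_atTop (R := ℝ))
        simpa using h2.mul_const C
      refine squeeze_zero' (Eventually.of_forall fun m => ?_) ?_ hlim
      · exact mul_nonneg (by positivity) (Finset.sum_nonneg fun i _ => integral_nonneg fun _ => by
          positivity)
      · filter_upwards [eventually_gt_atTop 0] with m hm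
        have hm' : (0 : ℝ) < m := by exact_mod_cast hm
        refine (mul_le_mul_of_nonneg_left (Finset.sum_le_sum fun i _ => hle i)
          (by positivity)).trans_eq ?_
        simp only [Finset.sum_const, Finset.card_range, nsmul_eq_mul]
        rw [← mul_assoc, ← Real.rpow_neg hm'.le]
        congr 1
        nth_rewrite 2 [← Real.rpow_one (m : ℝ)]
        rw [← Real.rpow_add hm']
        congr 1; ring

end IsErrorModel

/-- Reassembly of a vector of entries into a pair of matrices. -/
def toPair (n d : ℕ) : EuclideanSpace ℝ (PairIdx n d) →L[ℝ] MatPair n d where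
  toFun x := (of fun j k => x (Sum.inl (j, k)), of fun j k => x (Sum.inr (j, k)))
  map_add' x y := by ext <;> simp
  map_smul' c x := by ext <;> simp
  cont := by
    refine Continuous.prodMk ?_ ?_ <;>
    · refine continuous_matrix fun j k => ?_
      simp only [of_apply]
      fun_prop

lemma measurable_toPair : Measurable (toPair n d) := (toPair n d).continuous.measurable

/-- The law of the Gaussian pair `(Γ₁, Γ₂)` whose vector of entries has covariance matrix `V`. -/
def pairLaw (V : Matrix (PairIdx n d) (PairIdx n d) ℝ) : ProbabilityMeasure (MatPair n d) :=
  ⟨(multivariateGaussian (0 : EuclideanSpace ℝ (PairIdx n d)) V).map (toPair n d),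
    Measure.isProbabilityMeasure_map measurable_toPair.aemeasurable⟩

lemma toPair_vecW (a₀ : Fin n → ℝ) (x : Col n d → ℝ) (σsq : ℝ)
    (S : Matrix (Col n d) (Col n d) ℝ) :
    toPair n d (WithLp.toLp 2 (vecW a₀ x σsq S)) = pairW a₀ x σsq S := by
  refine Prod.ext ?_ ?_ <;> ext j k <;> simp [toPair, vecW, pairW, vecMulVec_apply]

lemma isCenteredGaussianIndep_pairLaw {V : Matrix (PairIdx n d) (PairIdx n d) ℝ}
    (hV : V.PosSemidef) (h0 : ∀ p q, V (Sum.inl p) (Sum.inr q) = 0) :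
    IsCenteredGaussianIndep (pairLaw V : Measure (MatPair n d)) := by
  set μ := multivariateGaussian (0 : EuclideanSpace ℝ (PairIdx n d)) V with hμ
  have hcoe : (pairLaw V : Measure (MatPair n d)) = μ.map (toPair n d) := rfl
  have hcent : ∀ k, ∫ x : EuclideanSpace ℝ (PairIdx n d), x k ∂μ = 0 := fun k => by
    have h1 := ContinuousLinearMap.integral_comp_id_comm (μ := μ) IsGaussian.integrable_id
      (EuclideanSpace.proj k : EuclideanSpace ℝ (PairIdx n d) →L[ℝ] ℝ)
    simp only [hμ] at h1
    simpa using h1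
  have hm1 : ∀ j k, Measurable fun G : MatPair n d => G.1 j k := fun j k =>
    (measurable_pi_apply k).comp ((measurable_pi_apply j).comp measurable_fst)
  have hm2 : ∀ j k, Measurable fun G : MatPair n d => G.2 j k := fun j k =>
    (measurable_pi_apply k).comp ((measurable_pi_apply j).comp measurable_snd)
  refine ⟨?_, fun j k => ?_, fun j k => ?_, ?_⟩
  · rw [hcoe]
    exact isGaussian_map_of_measurable measurable_toPair
  · rw [hcoe, integral_map measurable_toPair.aemeasurable (hm1 j k).aestronglyMeasurable]
    exact hcent _
  · rw [hcoe, integral_map measurable_toPair.aemeasurable (hm2 j k).aestronglyMeasurable]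
    exact hcent _
  · have hlaw : HasGaussianLaw (fun x : EuclideanSpace ℝ (PairIdx n d) =>
        ((fun p => x (Sum.inl p) : Fin n × Col n d → ℝ),
          (fun q => x (Sum.inr q) : Col n d × Col n d → ℝ))) μ := by
      let L : EuclideanSpace ℝ (PairIdx n d) →L[ℝ]
          (Fin n × Col n d → ℝ) × (Col n d × Col n d → ℝ) :=
        { toFun := fun x => (fun p => x (Sum.inl p), fun q => x (Sum.inr q))
          map_add' := fun x y => rfl
          map_smul' := fun c x => rfl
          cont := by fun_prop }
      exact ⟨isGaussian_map L⟩
    have hind := hlaw.indepFun_of_covariance_eval (X := fun p (x : EuclideanSpace ℝ (PairIdx n d)) => x (Sum.inl p))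
      (Y := fun q (x : EuclideanSpace ℝ (PairIdx n d)) => x (Sum.inr q)) fun p q => by
        rw [hμ, covariance_eval_multivariateGaussian hV, h0]
    have hind2 := hind.comp
      (φ := fun x : Fin n × Col n d → ℝ => (of fun j k => x (j, k) : Matrix (Fin n) (Col n d) ℝ))
      (ψ := fun x : Col n d × Col n d → ℝ =>
        (of fun j k => x (j, k) : Matrix (Col n d) (Col n d) ℝ))
      (measurable_pi_lambda _ fun j => measurable_pi_lambda _ fun k => measurable_pi_apply (j, k))
      (measurable_pi_lambda _ fun j => measurable_pi_lambda _ fun k => measurable_pi_apply (j, k))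
    rw [hcoe, indepFun_iff_measure_inter_preimage_eq_mul]
    intro s t hs ht
    rw [Measure.map_apply measurable_toPair ((measurable_fst hs).inter (measurable_snd ht)),
      Measure.map_apply measurable_toPair (measurable_fst hs),
      Measure.map_apply measurable_toPair (measurable_snd ht)]
    exact (indepFun_iff_measure_inter_preimage_eq_mul.1 hind2) s t hs ht

/-- Covariances of linear statistics under the limit law. -/
lemma cov_pairLaw {V : Matrix (PairIdx n d) (PairIdx n d) ℝ} (hV : V.PosSemidef)
    {f g : MatPair n d → ℝ} (hf : Measurable f) (hg : Measurable g) (s t : PairIdx n d → ℝ)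
    (hfs : ∀ x, f (toPair n d x) = ∑ k, s k * x k) (hgt : ∀ x, g (toPair n d x) = ∑ k, t k * x k) :
    cov[f, g; (pairLaw V : Measure (MatPair n d))] = ∑ k, ∑ l, s k * t l * V k l := by
  set μ := multivariateGaussian (0 : EuclideanSpace ℝ (PairIdx n d)) V with hμ
  have hcoe : (pairLaw V : Measure (MatPair n d)) = μ.map (toPair n d) := rfl
  have hmem : ∀ k, MemLp (fun x : EuclideanSpace ℝ (PairIdx n d) => x k) 2 μ := fun k =>
    IsGaussian.memLp_dual μ
      (EuclideanSpace.proj k : EuclideanSpace ℝ (PairIdx n d) →L[ℝ] ℝ) 2 (by simp)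
  rw [hcoe, covariance_map_fun hf.aestronglyMeasurable hg.aestronglyMeasurable
    measurable_toPair.aemeasurable]
  simp_rw [hfs, hgt]
  rw [covariance_fun_sum_fun_sum (fun k => (hmem k).const_mul _) fun k => (hmem k).const_mul _]
  refine Finset.sum_congr rfl fun k _ => Finset.sum_congr rfl fun l _ => ?_
  rw [covariance_const_mul_left, covariance_const_mul_right,
    covariance_eval_multivariateGaussian hV]
  ring

end ErrorModel

/-! ### Smooth matrix functions -/

section SmoothEntries

variable {E : Type*} [NormedAddCommGroup E] [NormedSpace ℝ E] {ι κ η : Type*}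

/-- All entries of a matrix function are continuously differentiable near `x`. -/
def SmoothAt (A : E → Matrix ι κ ℝ) (x : E) : Prop :=
  ∀ i j, ContDiffAt ℝ 1 (fun y => A y i j) x

lemma smoothAt_const (A : Matrix ι κ ℝ) (x : E) : SmoothAt (fun _ => A) x :=
  fun _ _ => contDiffAt_const

namespace SmoothAt

variable {x : E}

lemma mul [Fintype κ] {A : E → Matrix ι κ ℝ} {B : E → Matrix κ η ℝ} (hA : SmoothAt A x)
    (hB : SmoothAt B x) : SmoothAt (fun y => A y * B y) x := fun i j => by
  simp only [mul_apply]
  exact ContDiffAt.sum fun k _ => (hA i k).mul (hB k j)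

lemma transpose {A : E → Matrix ι κ ℝ} (hA : SmoothAt A x) : SmoothAt (fun y => (A y)ᵀ) x :=
  fun i j => hA j i

lemma sub {A B : E → Matrix ι κ ℝ} (hA : SmoothAt A x) (hB : SmoothAt B x) :
    SmoothAt (fun y => A y - B y) x := fun i j => (hA i j).sub (hB i j)

lemma det [Fintype ι] [DecidableEq ι] {A : E → Matrix ι ι ℝ} (hA : SmoothAt A x) :
    ContDiffAt ℝ 1 (fun y => (A y).det) x := by
  simp only [det_apply]
  exact ContDiffAt.sum fun σ _ => (contDiffAt_prod fun i _ => hA _ _).const_smul _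

lemma inv [Fintype ι] [DecidableEq ι] {A : E → Matrix ι ι ℝ} (hA : SmoothAt A x)
    (h0 : IsUnit (A x).det) : SmoothAt (fun y => (A y)⁻¹) x := fun i j => by
  have h1 : (fun y => (A y)⁻¹ i j) =
      fun y => ((A y).det)⁻¹ * ((A y).updateRow j (Pi.single i 1)).det := by
    funext y
    rw [inv_def, Ring.inverse_eq_inv', Matrix.smul_apply, adjugate_apply, smul_eq_mul]
  rw [h1]
  refine (hA.det.inv h0.ne_zero).mul (SmoothAt.det fun k l => ?_)
  rcases eq_or_ne k j with rfl | hk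
  · simp only [updateRow_self]
    exact contDiffAt_const
  · simp only [updateRow_ne hk]
    exact hA k l

end SmoothAt

end SmoothEntries

/-! ### The profiled objective function -/

section Profile

variable {n d : ℕ}

/-- The matrix `Zᵀ S Z`. -/
def gram (S : Matrix (Col n d) (Col n d) ℝ) (X : Matrix (Fin n) (Fin d) ℝ) :
    Matrix (Fin d) (Fin d) ℝ := (Zmat X)ᵀ * S * Zmat X

/-- The minimal weighted squared correction `cᵀ Z (Zᵀ S Z)⁻¹ Zᵀ c` of a single row `c`. -/
def profile (S : Matrix (Col n d) (Col n d) ℝ) (c : Col n d → ℝ)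
    (X : Matrix (Fin n) (Fin d) ℝ) : ℝ :=
  ((Zmat X)ᵀ *ᵥ c) ⬝ᵥ (gram S X)⁻¹ *ᵥ ((Zmat X)ᵀ *ᵥ c)

/-- `S` is the symmetric matrix which vanishes outside the block `J` and restricts there to `Sg`,
whose quadratic form is bounded below by `ϰ²`. -/
structure IsWeight (J : Finset (Col n d)) (ϰ : ℝ) (Sg : Matrix J J ℝ)
    (S : Matrix (Col n d) (Col n d) ℝ) : Prop where
  pos : 0 < ϰ
  apply_mem : ∀ j k : J, S j k = Sg j k
  apply_left : ∀ j ∉ J, ∀ k, S j k = 0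
  symm : Sᵀ = S
  lower : ∀ v : J → ℝ, ϰ ^ 2 * (v ⬝ᵥ v) ≤ v ⬝ᵥ Sg *ᵥ v

lemma sum_subtype_of_zero (J : Finset (Col n d)) {f : Col n d → ℝ} (hf : ∀ j ∉ J, f j = 0) :
    ∑ j, f j = ∑ j : J, f j := by
  rw [Finset.sum_coe_sort J f]
  exact (Finset.sum_subset (Finset.subset_univ J) fun j _ hj => hf j hj).symm

lemma posDef_isUnit_det {ι : Type*} [Fintype ι] [DecidableEq ι] {M : Matrix ι ι ℝ}
    (hM : M.PosDef) : IsUnit M.det := isUnit_iff_ne_zero.2 hM.det_pos.ne'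

/-- Completion of the square: the quadratic form of the inverse as a supremum. -/
lemma two_mul_dotProduct_sub_le {ι : Type*} [Fintype ι] [DecidableEq ι] {M : Matrix ι ι ℝ}
    (hM : M.PosDef) (v x : ι → ℝ) : 2 * (v ⬝ᵥ x) - x ⬝ᵥ M *ᵥ x ≤ v ⬝ᵥ M⁻¹ *ᵥ v := by
  have hdet : IsUnit M.det := posDef_isUnit_det hM
  have hsymm : Mᵀ = M := hM.1
  have hsymm' : M⁻¹ᵀ = M⁻¹ := by rw [transpose_nonsing_inv, hsymm]
  have h1 := hM.inv.posSemidef.dotProduct_mulVec_nonneg (v - M *ᵥ x)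
  rw [star_trivial, mulVec_sub, mulVec_mulVec, nonsing_inv_mul _ hdet, one_mulVec,
    sub_dotProduct, dotProduct_sub, dotProduct_sub] at h1
  have h2 : (M *ᵥ x) ⬝ᵥ M⁻¹ *ᵥ v = v ⬝ᵥ x := by
    rw [dotProduct_mulVec, ← mulVec_transpose, hsymm', mulVec_mulVec, nonsing_inv_mul _ hdet,
      one_mulVec, dotProduct_comm]
  have h3 : (M *ᵥ x) ⬝ᵥ x = x ⬝ᵥ M *ᵥ x := dotProduct_comm _ _
  linarith

lemma dotProduct_mulVec_symm {ι : Type*} [Fintype ι] {M : Matrix ι ι ℝ} (hM : Mᵀ = M)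
    (x y : ι → ℝ) : x ⬝ᵥ M *ᵥ y = y ⬝ᵥ M *ᵥ x := by
  rw [dotProduct_mulVec, ← mulVec_transpose, hM, dotProduct_comm]

lemma quad_gram (S : Matrix (Col n d) (Col n d) ℝ) (X : Matrix (Fin n) (Fin d) ℝ)
    (y : Fin d → ℝ) : y ⬝ᵥ gram S X *ᵥ y = (Zmat X *ᵥ y) ⬝ᵥ S *ᵥ (Zmat X *ᵥ y) := by
  rw [gram, ← mulVec_mulVec, ← mulVec_mulVec, dotProduct_mulVec, vecMul_transpose]

lemma rank_eq_iff_injective {ι : Type*} [Finite ι] (A : Matrix ι (Fin d) ℝ) :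
    A.rank = d ↔ Function.Injective A.mulVec := by
  rw [mulVec_injective_iff, linearIndependent_iff_card_eq_finrank_span, rank_eq_finrank_span_cols,
    Set.finrank, Fintype.card_fin, eq_comm]

lemma rowsJ_mulVec (J : Finset (Col n d)) (Z : Matrix (Col n d) (Fin d) ℝ) (y : Fin d → ℝ) :
    rowsJ J Z *ᵥ y = fun j : J => (Z *ᵥ y) j := rfl

namespace IsWeight

variable {J : Finset (Col n d)} {ϰ : ℝ} {Sg : Matrix J J ℝ} {S : Matrix (Col n d) (Col n d) ℝ}
  (h : IsWeight J ϰ Sg S)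
include h

lemma apply_right (j : Col n d) {k : Col n d} (hk : k ∉ J) : S j k = 0 := by
  rw [← h.symm]
  exact h.apply_left k hk j

lemma mulVec_mem (x : Col n d → ℝ) (j : J) : (S *ᵥ x) j = (Sg *ᵥ fun k : J => x k) j := by
  simp only [mulVec, dotProduct]
  rw [sum_subtype_of_zero J fun k hk => by rw [h.apply_right _ hk, zero_mul]]
  exact Finset.sum_congr rfl fun k _ => by rw [h.apply_mem]

lemma mulVec_not_mem (x : Col n d → ℝ) {j : Col n d} (hj : j ∉ J) : (S *ᵥ x) j = 0 := by
  simp only [mulVec, dotProduct]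
  exact Finset.sum_eq_zero fun k _ => by rw [h.apply_left j hj, zero_mul]

lemma quad_eq (x : Col n d → ℝ) :
    x ⬝ᵥ S *ᵥ x = (fun j : J => x j) ⬝ᵥ Sg *ᵥ fun j : J => x j := by
  simp only [dotProduct]
  rw [sum_subtype_of_zero J fun j hj => by rw [h.mulVec_not_mem x hj, mul_zero]]
  exact Finset.sum_congr rfl fun j _ => by rw [h.mulVec_mem]

lemma lower_quad (x : Col n d → ℝ) : ϰ ^ 2 * ∑ j : J, x j ^ 2 ≤ x ⬝ᵥ S *ᵥ x := by
  rw [h.quad_eq]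
  refine (h.lower _).trans_eq' ?_
  simp only [dotProduct, pow_two]

lemma quad_nonneg (x : Col n d → ℝ) : 0 ≤ x ⬝ᵥ S *ᵥ x :=
  (h.lower_quad x).trans' (mul_nonneg (sq_nonneg _) (Finset.sum_nonneg fun _ _ => sq_nonneg _))

lemma posDef_block : Sg.PosDef := by
  have hs : Sgᵀ = Sg := by
    ext j k
    rw [transpose_apply, ← h.apply_mem, ← h.apply_mem, ← transpose_apply S, h.symm]
  refine PosDef.of_dotProduct_mulVec_pos hs fun x hx => ?_
  rw [star_trivial]
  refine lt_of_lt_of_le (mul_pos (pow_pos h.pos 2) ?_) (h.lower x)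
  exact lt_of_le_of_ne (Finset.sum_nonneg fun _ _ => mul_self_nonneg _) fun h0 =>
    hx (dotProduct_self_eq_zero.1 h0.symm)

lemma gram_symm (X : Matrix (Fin n) (Fin d) ℝ) : (gram S X)ᵀ = gram S X := by
  simp only [gram, transpose_mul, transpose_transpose, h.symm, Matrix.mul_assoc]

lemma gram_posDef {X : Matrix (Fin n) (Fin d) ℝ} (hX : (rowsJ J (Zmat X)).rank = d) :
    (gram S X).PosDef := by
  refine PosDef.of_dotProduct_mulVec_pos (h.gram_symm X) fun y hy => ?_
  rw [star_trivial, quad_gram]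
  refine lt_of_lt_of_le (mul_pos (pow_pos h.pos 2) ?_) (h.lower_quad _)
  have hne : rowsJ J (Zmat X) *ᵥ y ≠ 0 := fun h0 =>
    hy ((rank_eq_iff_injective _).1 hX (by rw [h0, mulVec_zero]))
  rw [rowsJ_mulVec] at hne
  obtain ⟨j, hj⟩ := Function.ne_iff.1 hne
  exact (Finset.sum_pos_iff_of_nonneg fun _ _ => sq_nonneg _).2
    ⟨j, Finset.mem_univ _, lt_of_le_of_ne (sq_nonneg _) (pow_ne_zero 2 hj).symm⟩

lemma rank_iff (X : Matrix (Fin n) (Fin d) ℝ) :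
    (rowsJ J (Zmat X)).rank = d ↔ IsUnit (gram S X).det := by
  refine ⟨fun hX => posDef_isUnit_det (h.gram_posDef hX), fun hu => ?_⟩
  rw [rank_eq_iff_injective]
  intro y y' hyy
  have h0 : rowsJ J (Zmat X) *ᵥ (y - y') = 0 := by rw [mulVec_sub, sub_eq_zero]; exact hyy
  rw [rowsJ_mulVec] at h0
  have h1 : S *ᵥ (Zmat X *ᵥ (y - y')) = 0 := by
    funext j
    by_cases hj : j ∈ J
    · rw [h.mulVec_mem _ ⟨j, hj⟩, h0, mulVec_zero]; rfl
    · exact h.mulVec_not_mem _ hj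
  have h2 : gram S X *ᵥ (y - y') = 0 := by
    rw [gram, ← mulVec_mulVec, ← mulVec_mulVec, h1, mulVec_zero]
  have h3 := congrArg ((gram S X)⁻¹ *ᵥ ·) h2
  simp only [mulVec_mulVec, nonsing_inv_mul _ hu, one_mulVec, mulVec_zero] at h3
  exact sub_eq_zero.1 h3

end IsWeight

lemma Zmat_transpose_mulVec (X : Matrix (Fin n) (Fin d) ℝ) (c : Col n d → ℝ) (l : Fin d) :
    ((Zmat X)ᵀ *ᵥ c) l = ∑ k, c (Sum.inl k) * X k l - c (Sum.inr l) := by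
  simp only [mulVec, dotProduct, transpose_apply, Zmat, Fintype.sum_sum_type, fromRows_apply_inl,
    fromRows_apply_inr, Matrix.neg_apply, Matrix.one_apply]
  simp [mul_comm, sub_eq_add_neg]

lemma feasible_eq_iff {m : ℕ} (C D : Matrix (Fin m) (Col n d) ℝ) (X : Matrix (Fin n) (Fin d) ℝ) :
    (C.toCols₁ - D.toCols₁) * X = C.toCols₂ - D.toCols₂ ↔
      ∀ i, (Zmat X)ᵀ *ᵥ D i = (Zmat X)ᵀ *ᵥ C i := by
  rw [← Matrix.ext_iff]
  refine forall_congr' fun i => ?_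
  rw [funext_iff]
  refine forall_congr' fun l => ?_
  rw [Zmat_transpose_mulVec, Zmat_transpose_mulVec]
  simp only [mul_apply, Matrix.sub_apply, toCols₁_apply, toCols₂_apply, sub_mul, Finset.sum_sub_distrib]
  constructor <;> intro h <;> linarith

section Rows

variable {m : ℕ} {J : Finset (Col n d)} {ϰ : ℝ} {Sg : ℕ → Matrix J J ℝ}
  {S : ℕ → Matrix (Col n d) (Col n d) ℝ} (hS : ∀ i, IsWeight J ϰ (Sg i) (S i))
  {C D : Matrix (Fin m) (Col n d) ℝ} {X : Matrix (Fin n) (Fin d) ℝ}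
include hS

lemma profile_le_cost (h : IsFeasible J C X D) :
    ∑ i : Fin m, profile (S i) (C i) X ≤ cost J Sg D := by
  refine Finset.sum_le_sum fun i _ => ?_
  set w := (Zmat X)ᵀ *ᵥ C i with hw
  set y := (gram (S i) X)⁻¹ *ᵥ w with hy
  set x := Zmat X *ᵥ y with hx
  have hdet := ((hS i).rank_iff X).1 h.2.2
  have h1 := two_mul_dotProduct_sub_le (hS i).posDef_block (fun j : J => D i j) fun j : J => x j
  rw [← (hS i).quad_eq, hx, ← quad_gram] at h1
  have h2 : (fun j : J => D i j) ⬝ᵥ (fun j : J => x j) = w ⬝ᵥ y := by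
    have h3 : (fun j : J => D i j) ⬝ᵥ (fun j : J => x j) = D i ⬝ᵥ x := by
      simp only [dotProduct]
      rw [sum_subtype_of_zero J fun j hj => by rw [h.2.1 i j hj, zero_mul]]
    rw [h3, hx, dotProduct_mulVec, ← mulVec_transpose, (feasible_eq_iff C D X).1 h.1 i]
  have h3 : gram (S i) X *ᵥ y = w := by
    rw [hy, mulVec_mulVec, mul_nonsing_inv _ hdet, one_mulVec]
  rw [h3, h2, dotProduct_comm y w] at h1
  have h4 : profile (S i) (C i) X = w ⬝ᵥ y := rfl
  linarith

/-- For every admissible `X` the optimal corrections are `S Z (Zᵀ S Z)⁻¹ Zᵀ c`. -/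
lemma exists_feasible_cost_eq (hX : (rowsJ J (Zmat X)).rank = d)
    (C : Matrix (Fin m) (Col n d) ℝ) :
    ∃ D, IsFeasible J C X D ∧ cost J Sg D = ∑ i : Fin m, profile (S i) (C i) X := by
  let x : Fin m → Col n d → ℝ := fun i => Zmat X *ᵥ ((gram (S i) X)⁻¹ *ᵥ ((Zmat X)ᵀ *ᵥ C i))
  refine ⟨of fun i => S i *ᵥ x i, ⟨?_, fun i j hj => (hS i).mulVec_not_mem _ hj, hX⟩, ?_⟩
  · rw [feasible_eq_iff]
    intro i
    have h1 : (of fun i : Fin m => S i *ᵥ x i) i = S i *ᵥ x i := rfl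
    have hdet := ((hS i).rank_iff X).1 hX
    rw [h1]
    simp only [x]
    rw [mulVec_mulVec, mulVec_mulVec]
    change gram (S i) X *ᵥ _ = _
    rw [mulVec_mulVec, mul_nonsing_inv _ hdet, one_mulVec]
  · refine Finset.sum_congr rfl fun i _ => ?_
    have hdet := ((hS i).rank_iff X).1 hX
    have h1 : (fun j : J => (of fun i : Fin m => S i *ᵥ x i) i j) =
        Sg i *ᵥ fun j : J => x i j := funext fun j => (hS i).mulVec_mem _ j
    rw [h1, mulVec_mulVec, nonsing_inv_mul _ (posDef_isUnit_det (hS i).posDef_block), one_mulVec,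
      dotProduct_comm, ← (hS i).quad_eq]
    simp only [x]
    have h2 : ∀ w : Fin d → ℝ, ((gram (S i) X)⁻¹ *ᵥ w) ⬝ᵥ gram (S i) X *ᵥ ((gram (S i) X)⁻¹ *ᵥ w) =
        w ⬝ᵥ (gram (S i) X)⁻¹ *ᵥ w := fun w => by
      rw [mulVec_mulVec, mul_nonsing_inv _ hdet, one_mulVec, dotProduct_comm]
    rw [← quad_gram, h2]
    rfl

/-- Elimination of the corrections: the estimator minimizes the profiled objective function over
the set of admissible `X`. -/
theorem isSolution_iff :
    IsSolution J Sg C X ↔ (rowsJ J (Zmat X)).rank = d ∧ ∀ X', (rowsJ J (Zmat X')).rank = d →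
      ∑ i : Fin m, profile (S i) (C i) X ≤ ∑ i : Fin m, profile (S i) (C i) X' := by
  constructor
  · rintro ⟨D, hD, hmin⟩
    refine ⟨hD.2.2, fun X' hX' => ?_⟩
    obtain ⟨D', hD', hc⟩ := exists_feasible_cost_eq hS hX' C
    rw [← hc]
    exact (profile_le_cost hS hD).trans (hmin X' D' hD')
  · rintro ⟨hX, hmin⟩
    obtain ⟨D, hD, hc⟩ := exists_feasible_cost_eq hS hX C
    refine ⟨D, hD, fun X' D' hD' => ?_⟩
    rw [hc]
    exact (hmin X' hD'.2.2).trans (profile_le_cost hS hD')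

end Rows

end Profile

/-! ### The estimating equation -/

section Estimating

variable {n d : ℕ}

lemma Zmat_add_smul_mulVec (X H : Matrix (Fin n) (Fin d) ℝ) (t : ℝ) (y : Fin d → ℝ) :
    Zmat (X + t • H) *ᵥ y = Zmat X *ᵥ y + t • (Sum.elim (H *ᵥ y) 0 : Col n d → ℝ) := by
  funext j
  rcases j with j | j
  · simp [Zmat, fromRows_mulVec, add_mulVec, smul_mulVec]
  · simp [Zmat, fromRows_mulVec]

lemma ContinuousAt.mulVec {α ι κ : Type*} [TopologicalSpace α] [Fintype κ]
    {A : α → Matrix ι κ ℝ} {v : α → κ → ℝ} {x : α} (hA : ContinuousAt A x)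
    (hv : ContinuousAt v x) : ContinuousAt (fun y => A y *ᵥ v y) x :=
  ((continuous_fst.matrix_mulVec continuous_snd).tendsto (A x, v x)).comp (hA.prodMk_nhds hv)

lemma continuous_Zmat : Continuous (Zmat : Matrix (Fin n) (Fin d) ℝ → _) := by
  refine continuous_matrix fun j l => ?_
  rcases j with j | j
  · exact continuous_id.matrix_elem j l
  · exact continuous_const

/-- The vector `(Zᵀ S Z)⁻¹ Zᵀ c`. -/
def dual (S : Matrix (Col n d) (Col n d) ℝ) (c : Col n d → ℝ) (X : Matrix (Fin n) (Fin d) ℝ) :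
    Fin d → ℝ := (gram S X)⁻¹ *ᵥ ((Zmat X)ᵀ *ᵥ c)

lemma continuousAt_inv {α ι : Type*} [TopologicalSpace α] [Fintype ι] [DecidableEq ι]
    {A : α → Matrix ι ι ℝ} {x : α} (hA : ContinuousAt A x) (h0 : IsUnit (A x).det) :
    ContinuousAt (fun y => (A y)⁻¹) x := by
  have h1 : (fun y => (A y)⁻¹) = fun y => ((A y).det)⁻¹ • (A y).adjugate := by
    funext y
    rw [inv_def, Ring.inverse_eq_inv']
  rw [h1]
  have hdet : ContinuousAt (fun y => (A y).det) x :=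
    (continuous_id.matrix_det.tendsto (A x)).comp hA
  have hadj : ContinuousAt (fun y => (A y).adjugate) x :=
    (continuous_id.matrix_adjugate.tendsto (A x)).comp hA
  exact (hdet.inv₀ h0.ne_zero).smul hadj

lemma continuous_gram (S : Matrix (Col n d) (Col n d) ℝ) : Continuous (gram S) :=
  (continuous_Zmat.matrix_transpose.matrix_mul continuous_const).matrix_mul continuous_Zmat

lemma continuousAt_dual {S : Matrix (Col n d) (Col n d) ℝ} (c : Col n d → ℝ)
    {X : Matrix (Fin n) (Fin d) ℝ} (h0 : IsUnit (gram S X).det) : ContinuousAt (dual S c) X :=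
  ContinuousAt.mulVec (continuousAt_inv (continuous_gram S).continuousAt h0)
    (continuous_Zmat.matrix_transpose.matrix_mulVec continuous_const).continuousAt

lemma profile_eq_dotProduct_dual (S : Matrix (Col n d) (Col n d) ℝ) (c : Col n d → ℝ)
    (X : Matrix (Fin n) (Fin d) ℝ) : profile S c X = ((Zmat X)ᵀ *ᵥ c) ⬝ᵥ dual S c X := rfl

lemma continuousAt_profile {S : Matrix (Col n d) (Col n d) ℝ} (c : Col n d → ℝ)
    {X : Matrix (Fin n) (Fin d) ℝ} (h0 : IsUnit (gram S X).det) : ContinuousAt (profile S c) X := by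
  have h1 : ContinuousAt (fun X : Matrix (Fin n) (Fin d) ℝ => (Zmat X)ᵀ *ᵥ c) X :=
    (continuous_Zmat.matrix_transpose.matrix_mulVec continuous_const).continuousAt
  have h2 := continuousAt_dual c h0
  simp only [ContinuousAt, profile_eq_dotProduct_dual, dotProduct]
  exact tendsto_finsetSum _ fun l _ => (tendsto_pi_nhds.1 h1 l).mul (tendsto_pi_nhds.1 h2 l)

lemma transpose_mulVec_dotProduct {ι κ : Type*} [Fintype ι] [Fintype κ] (A : Matrix ι κ ℝ)
    (c : ι → ℝ) (y : κ → ℝ) : (Aᵀ *ᵥ c) ⬝ᵥ y = c ⬝ᵥ A *ᵥ y := by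
  rw [mulVec_transpose, dotProduct_mulVec]

/-- One-sided bound for the increment of the profiled objective function. Bounding the value at `X`
from below by completion of the square at the dual vector of the perturbed point makes the first
order condition available without differentiating an inverse matrix. -/
lemma profile_sub_le {J : Finset (Col n d)} {ϰ : ℝ} {Sg : Matrix J J ℝ}
    {S : Matrix (Col n d) (Col n d) ℝ} (hS : IsWeight J ϰ Sg S) (c : Col n d → ℝ)
    {X H : Matrix (Fin n) (Fin d) ℝ} {t : ℝ} (hX : (rowsJ J (Zmat X)).rank = d)
    (hXt : (rowsJ J (Zmat (X + t • H))).rank = d) :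
    profile S c (X + t • H) - profile S c X ≤
      2 * t * ((Sum.elim (H *ᵥ dual S c (X + t • H)) 0 : Col n d → ℝ) ⬝ᵥ
        (c - S *ᵥ (Zmat X *ᵥ dual S c (X + t • H)))) := by
  set y := dual S c (X + t • H) with hy
  set h : Col n d → ℝ := Sum.elim (H *ᵥ y) 0 with hh
  set z := Zmat X *ᵥ y with hz
  have h1 := two_mul_dotProduct_sub_le (hS.gram_posDef hX) ((Zmat X)ᵀ *ᵥ c) y
  have h2 : gram S (X + t • H) *ᵥ y = (Zmat (X + t • H))ᵀ *ᵥ c := by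
    rw [hy, dual, mulVec_mulVec, mul_nonsing_inv _ ((hS.rank_iff _).1 hXt), one_mulVec]
  have h3 : profile S c (X + t • H) =
      2 * (c ⬝ᵥ (z + t • h)) - (z + t • h) ⬝ᵥ S *ᵥ (z + t • h) := by
    rw [← Zmat_add_smul_mulVec, ← quad_gram, h2, profile_eq_dotProduct_dual, ← hy,
      dotProduct_comm y, transpose_mulVec_dotProduct]
    ring
  rw [quad_gram, transpose_mulVec_dotProduct] at h1
  change _ ≤ profile S c X at h1
  have h4 := hS.quad_nonneg (t • h)
  have h5 : z ⬝ᵥ S *ᵥ h = h ⬝ᵥ S *ᵥ z := dotProduct_mulVec_symm hS.symm _ _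
  rw [h3]
  simp only [dotProduct_add, add_dotProduct, mulVec_add, mulVec_smul, dotProduct_smul,
    smul_dotProduct, smul_eq_mul, dotProduct_sub] at h1 h4 ⊢
  rw [h5, dotProduct_comm h c]
  nlinarith

lemma score_mul_inv_gram {S : Matrix (Col n d) (Col n d) ℝ} (hS : Sᵀ = S) (c : Col n d → ℝ)
    (X : Matrix (Fin n) (Fin d) ℝ) :
    score c S X * (gram S X)⁻¹ =
      vecMulVec (fun k => (c - S *ᵥ (Zmat X *ᵥ dual S c X)) (Sum.inl k)) (dual S c X) := by
  have hN : ((gram S X)⁻¹)ᵀ = (gram S X)⁻¹ := by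
    rw [transpose_nonsing_inv]
    simp only [gram, transpose_mul, transpose_transpose, hS, Matrix.mul_assoc]
  have h1 : (c ᵥ* Zmat X) ᵥ* (gram S X)⁻¹ = dual S c X := by
    rw [dual, ← mulVec_transpose, hN, ← mulVec_transpose]
  have h2 : (S.toRows₁ * Zmat X * (gram S X)⁻¹ * (Zmat X)ᵀ) *ᵥ c =
      fun k => (S *ᵥ (Zmat X *ᵥ dual S c X)) (Sum.inl k) := by
    rw [dual, ← mulVec_mulVec, ← mulVec_mulVec, ← mulVec_mulVec]
    rfl
  have h3 : score c S X = vecMulVec (fun k => c (Sum.inl k)) c * Zmat X -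
      (S.toRows₁ * Zmat X * (gram S X)⁻¹ * (Zmat X)ᵀ) * vecMulVec c c * Zmat X := rfl
  rw [h3, Matrix.sub_mul, mul_vecMulVec, h2, vecMulVec_mul, vecMulVec_mul, vecMulVec_mul,
    vecMulVec_mul, h1, ← sub_vecMulVec]
  rfl

/-- First order condition: a minimizer solves `∑ s̃_i(X) (Zᵀ S_i Z)⁻¹ = 0`. -/
theorem sum_score_mul_inv_gram_eq_zero {m : ℕ} {J : Finset (Col n d)} {ϰ : ℝ}
    {Sg : ℕ → Matrix J J ℝ} {S : ℕ → Matrix (Col n d) (Col n d) ℝ}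
    (hS : ∀ i, IsWeight J ϰ (Sg i) (S i)) {C : Matrix (Fin m) (Col n d) ℝ}
    {X : Matrix (Fin n) (Fin d) ℝ} (h : IsSolution J Sg C X) :
    ∑ i : Fin m, score (C i) (S i) X * (gram (S i) X)⁻¹ = 0 := by
  obtain ⟨hX, hmin⟩ := (isSolution_iff hS).1 h
  have hu : ∀ i, IsUnit (gram (S i) X).det := fun i => ((hS i).rank_iff X).1 hX
  -- the increment along `H` is at most `2 t f t`; dividing by `2 t > 0` and letting `t → 0`
  -- bounds the directional derivative from below
  have key : ∀ H : Matrix (Fin n) (Fin d) ℝ, 0 ≤ ∑ i : Fin m,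
      ((Sum.elim (H *ᵥ dual (S i) (C i) X) 0 : Col n d → ℝ) ⬝ᵥ
        (C i - S i *ᵥ (Zmat X *ᵥ dual (S i) (C i) X))) := by
    intro H
    let f : ℝ → ℝ := fun t => ∑ i : Fin m,
      ((Sum.elim (H *ᵥ dual (S i) (C i) (X + t • H)) 0 : Col n d → ℝ) ⬝ᵥ
        (C i - S i *ᵥ (Zmat X *ᵥ dual (S i) (C i) (X + t • H))))
    have hline : Continuous fun t : ℝ => X + t • H := by fun_prop
    have hline0 : X + (0 : ℝ) • H = X := by rw [zero_smul, add_zero]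
    have hf : ContinuousAt f 0 := by
      refine tendsto_finsetSum _ fun i _ => ?_
      have h1 : ContinuousAt (fun t : ℝ => dual (S i) (C i) (X + t • H)) 0 :=
        ContinuousAt.comp (f := fun t : ℝ => X + t • H) (x := 0)
          (continuousAt_dual (C i) (by rw [hline0]; exact hu i)) hline.continuousAt
      have h2 : Continuous fun y : Fin d → ℝ => (Sum.elim (H *ᵥ y) 0 : Col n d → ℝ) ⬝ᵥ
          (C i - S i *ᵥ (Zmat X *ᵥ y)) := by
        refine Continuous.dotProduct (continuous_pi fun j => ?_) ?_
        · rcases j with j | j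
          · exact (continuous_apply j).comp (continuous_const.matrix_mulVec continuous_id)
          · exact continuous_const
        · exact continuous_const.sub (continuous_const.matrix_mulVec
            (continuous_const.matrix_mulVec continuous_id))
      exact (h2.tendsto _).comp h1
    -- admissibility does not depend on the row: it is the nonvanishing of any one determinant
    have hadm : ∀ᶠ t : ℝ in 𝓝 0, (rowsJ J (Zmat (X + t • H))).rank = d := by
      have h1 : Tendsto (fun t : ℝ => (gram (S 0) (X + t • H)).det) (𝓝 0)
          (𝓝 (gram (S 0) X).det) := by
        have := (((continuous_gram (S 0)).comp hline).matrix_det).tendsto 0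
        simpa [hline0] using this
      filter_upwards [h1.eventually_ne (hu 0).ne_zero] with t ht
      exact ((hS 0).rank_iff _).2 (isUnit_iff_ne_zero.2 ht)
    have hpos : ∀ᶠ t : ℝ in 𝓝[>] 0, 0 ≤ f t := by
      filter_upwards [self_mem_nhdsWithin, nhdsWithin_le_nhds hadm] with t ht hXt
      have h1 : 0 ≤ ∑ i : Fin m,
          (profile (S i) (C i) (X + t • H) - profile (S i) (C i) X) := by
        rw [Finset.sum_sub_distrib, sub_nonneg]
        exact hmin _ hXt
      have h2 := h1.trans (Finset.sum_le_sum fun i _ => profile_sub_le (hS i) (C i) hX hXt)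
      rw [← Finset.mul_sum] at h2
      have ht' : (0 : ℝ) < 2 * t := mul_pos two_pos ht
      exact nonneg_of_mul_nonneg_right h2 ht'
    have h0 : f 0 = ∑ i : Fin m, ((Sum.elim (H *ᵥ dual (S i) (C i) X) 0 : Col n d → ℝ) ⬝ᵥ
        (C i - S i *ᵥ (Zmat X *ᵥ dual (S i) (C i) X))) := by
      simp only [f, hline0]
    rw [← h0]
    exact ge_of_tendsto (hf.tendsto.mono_left nhdsWithin_le_nhds) hpos
  -- the directional derivative is linear in `H`, so replacing `H` by `-H` reverses the inequality
  have hz : ∀ H : Matrix (Fin n) (Fin d) ℝ, ∑ i : Fin m,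
      ((Sum.elim (H *ᵥ dual (S i) (C i) X) 0 : Col n d → ℝ) ⬝ᵥ
        (C i - S i *ᵥ (Zmat X *ᵥ dual (S i) (C i) X))) = 0 := by
    intro H
    refine le_antisymm ?_ (key H)
    have h1 := key (-H)
    have h2 : ∀ y : Fin d → ℝ, (Sum.elim (-H *ᵥ y) 0 : Col n d → ℝ) =
        -Sum.elim (H *ᵥ y) 0 := fun y => by
      funext j
      rcases j with j | j <;> simp [neg_mulVec]
    simp only [h2, neg_dotProduct, Finset.sum_neg_distrib] at h1
    linarith
  -- the matrix units as directions pick out the entries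
  ext k l
  rw [Matrix.sum_apply, Matrix.zero_apply, ← hz (Matrix.single k l 1)]
  refine Finset.sum_congr rfl fun i _ => ?_
  rw [score_mul_inv_gram (hS i).symm, vecMulVec_apply]
  simp only [dotProduct, Fintype.sum_sum_type, Sum.elim_inl, Sum.elim_inr, Pi.zero_apply, zero_mul,
    Finset.sum_const_zero, add_zero]
  rw [Finset.sum_eq_single k]
  · simp [Matrix.single_mulVec, Function.update_self, mul_comm]
  · intro k' _ hk
    simp [Matrix.single_mulVec, hk]
  · exact fun hk => absurd (Finset.mem_univ k) hk

end Estimating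

/-! ### Quadratic forms -/

section Quadratic

variable {ι : Type*} [Fintype ι]

lemma dotProduct_self_eq_sum_sq (x : ι → ℝ) : x ⬝ᵥ x = ∑ j, x j ^ 2 := by
  simp only [dotProduct, pow_two]

lemma dotProduct_mulVec_eq_sum (M : Matrix ι ι ℝ) (x : ι → ℝ) :
    x ⬝ᵥ M *ᵥ x = ∑ j, ∑ k, M j k * (x j * x k) := by
  simp only [dotProduct, mulVec, Finset.mul_sum]
  exact Finset.sum_congr rfl fun j _ => Finset.sum_congr rfl fun k _ => by ring

lemma abs_quad_le (M : Matrix ι ι ℝ) (x : ι → ℝ) :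
    |x ⬝ᵥ M *ᵥ x| ≤ (∑ j, ∑ k, |M j k|) * (x ⬝ᵥ x) := by
  have h0 : ∀ j, x j ^ 2 ≤ x ⬝ᵥ x := fun j => by
    rw [dotProduct_self_eq_sum_sq]
    exact Finset.single_le_sum (f := fun j => x j ^ 2) (fun _ _ => sq_nonneg _)
      (Finset.mem_univ j)
  rw [dotProduct_mulVec_eq_sum, Finset.sum_mul]
  refine (Finset.abs_sum_le_sum_abs _ _).trans (Finset.sum_le_sum fun j _ => ?_)
  rw [Finset.sum_mul]
  refine (Finset.abs_sum_le_sum_abs _ _).trans (Finset.sum_le_sum fun k _ => ?_)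
  rw [abs_mul]
  refine mul_le_mul_of_nonneg_left ?_ (abs_nonneg _)
  rw [abs_le]
  have h1 := h0 j
  have h2 := h0 k
  constructor <;> nlinarith [sq_nonneg (x j + x k), sq_nonneg (x j - x k)]

lemma exists_lower_of_posDef [DecidableEq ι] {M : Matrix ι ι ℝ} (hM : M.PosDef) :
    ∃ lo > 0, ∀ x : ι → ℝ, lo * (x ⬝ᵥ x) ≤ x ⬝ᵥ M *ᵥ x := by
  set B := ∑ j, ∑ k, |M⁻¹ j k| with hB
  have hB0 : 0 ≤ B := Finset.sum_nonneg fun _ _ => Finset.sum_nonneg fun _ _ => abs_nonneg _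
  refine ⟨(1 + B)⁻¹, by positivity, fun x => ?_⟩
  have h1 := two_mul_dotProduct_sub_le hM ((1 + B)⁻¹ • x) x
  have h2 := (le_abs_self _).trans (abs_quad_le M⁻¹ ((1 + B)⁻¹ • x))
  rw [← hB] at h2
  simp only [smul_dotProduct, dotProduct_smul, smul_eq_mul, mulVec_smul] at h1 h2
  have h3 : B * ((1 + B)⁻¹ * ((1 + B)⁻¹ * (x ⬝ᵥ x))) ≤ (1 + B)⁻¹ * (x ⬝ᵥ x) := by
    have h4 : 0 ≤ x ⬝ᵥ x := by
      rw [dotProduct_self_eq_sum_sq]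
      exact Finset.sum_nonneg fun _ _ => sq_nonneg _
    have h5 : B * (1 + B)⁻¹ ≤ 1 := by
      rw [← div_eq_mul_inv, div_le_one (by positivity)]
      linarith
    calc B * ((1 + B)⁻¹ * ((1 + B)⁻¹ * (x ⬝ᵥ x)))
        = (B * (1 + B)⁻¹) * ((1 + B)⁻¹ * (x ⬝ᵥ x)) := by ring
      _ ≤ 1 * ((1 + B)⁻¹ * (x ⬝ᵥ x)) := mul_le_mul_of_nonneg_right h5 (by positivity)
      _ = _ := one_mul _
  linarith

lemma dotProduct_mulVec_eq_trace (M : Matrix ι ι ℝ) (b : ι → ℝ) :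
    b ⬝ᵥ M *ᵥ b = trace (M * vecMulVec b b) := by
  rw [mul_vecMulVec, trace_vecMulVec, dotProduct_comm]

/-- A positive semidefinite form is a sum of squares. -/
lemma exists_sum_sq {N : Matrix ι ι ℝ} (hN : N.PosSemidef) :
    ∃ (k : ℕ) (b : Fin k → ι → ℝ), (∀ v, v ⬝ᵥ N *ᵥ v = ∑ q, (b q ⬝ᵥ v) ^ 2) ∧
      ∀ M : Matrix ι ι ℝ, ∑ q, b q ⬝ᵥ M *ᵥ b q = trace (M * N) := by
  obtain ⟨k, b, hb⟩ := Matrix.posSemidef_iff_eq_sum_vecMulVec.1 hN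
  simp only [star_trivial] at hb
  refine ⟨k, b, fun v => ?_, fun M => ?_⟩
  · rw [dotProduct_mulVec_eq_trace, hb, Finset.sum_mul, trace_sum]
    refine Finset.sum_congr rfl fun q _ => ?_
    rw [← dotProduct_mulVec_eq_trace, vecMulVec_mulVec, dotProduct_smul, op_smul_eq_smul,
      smul_eq_mul, dotProduct_comm v, pow_two]
  · rw [hb, Finset.mul_sum, trace_sum]
    exact Finset.sum_congr rfl fun q _ => dotProduct_mulVec_eq_trace _ _

end Quadratic

/-! ### Comparison of the row weights with the limiting weight -/

section Comparison

variable {n d : ℕ} {J : Finset (Col n d)} {ϰ : ℝ} {Sg Sginf : Matrix J J ℝ}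
  {S Sinf : Matrix (Col n d) (Col n d) ℝ}

/-- The relative distance of the weight `Sg` to `Sginf`. -/
def weightGap (ϰ : ℝ) (Sg Sginf : Matrix J J ℝ) : ℝ := (∑ j, ∑ k, |Sg j k - Sginf j k|) / ϰ ^ 2

lemma weightGap_nonneg (ϰ : ℝ) (Sg Sginf : Matrix J J ℝ) : 0 ≤ weightGap ϰ Sg Sginf :=
  div_nonneg (Finset.sum_nonneg fun _ _ => Finset.sum_nonneg fun _ _ => abs_nonneg _)
    (sq_nonneg _)

lemma IsWeight.quad_le (h : IsWeight J ϰ Sg S) (h' : IsWeight J ϰ Sginf Sinf)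
    (x : Col n d → ℝ) : x ⬝ᵥ S *ᵥ x ≤ (1 + weightGap ϰ Sg Sginf) * (x ⬝ᵥ Sinf *ᵥ x) := by
  have h1 := (le_abs_self _).trans (abs_quad_le (Sg - Sginf) fun j : J => x j)
  rw [sub_mulVec, dotProduct_sub, ← h.quad_eq, ← h'.quad_eq] at h1
  have h2 : (∑ j, ∑ k, |(Sg - Sginf) j k|) = weightGap ϰ Sg Sginf * ϰ ^ 2 := by
    rw [weightGap, div_mul_cancel₀ _ (pow_ne_zero 2 h.pos.ne')]
    rfl
  have h3 := h'.lower (fun j : J => x j)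
  rw [← h'.quad_eq] at h3
  have h4 := mul_le_mul_of_nonneg_left h3 (weightGap_nonneg ϰ Sg Sginf)
  rw [h2] at h1
  nlinarith

/-- A weight which is at most `1 + ε` times the limiting one changes the profiled objective
function by a factor of at least `(1 + ε)⁻¹`, uniformly in `c` and `X`. -/
lemma IsWeight.profile_ge (h : IsWeight J ϰ Sg S) (h' : IsWeight J ϰ Sginf Sinf)
    (c : Col n d → ℝ) {X : Matrix (Fin n) (Fin d) ℝ} (hX : (rowsJ J (Zmat X)).rank = d) :
    (1 + weightGap ϰ Sg Sginf)⁻¹ * profile Sinf c X ≤ profile S c X := by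
  set s := 1 + weightGap ϰ Sg Sginf with hs
  have hs0 : 0 < s := by have := weightGap_nonneg ϰ Sg Sginf; linarith
  set w := (Zmat X)ᵀ *ᵥ c with hw
  set y := dual Sinf c X with hy
  have hM : gram Sinf X *ᵥ y = w := by
    rw [hy, dual, mulVec_mulVec, mul_nonsing_inv _ ((h'.rank_iff X).1 hX), one_mulVec]
  have h1 := two_mul_dotProduct_sub_le (h.gram_posDef hX) w (s⁻¹ • y)
  have h2 := h.quad_le h' (Zmat X *ᵥ y)
  rw [← quad_gram, ← quad_gram, hM, ← hs] at h2
  have h3 : profile Sinf c X = w ⬝ᵥ y := rfl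
  change _ ≤ profile S c X at h1
  rw [dotProduct_comm y w] at h2
  simp only [dotProduct_smul, smul_dotProduct, mulVec_smul, smul_eq_mul] at h1
  have h4 : s⁻¹ * (s⁻¹ * (y ⬝ᵥ gram S X *ᵥ y)) ≤ s⁻¹ * (w ⬝ᵥ y) := by
    have h5 := mul_le_mul_of_nonneg_left h2 (mul_nonneg (inv_nonneg.2 hs0.le) (inv_nonneg.2 hs0.le))
    have h6 : s⁻¹ * s⁻¹ * (s * (w ⬝ᵥ y)) = s⁻¹ * (w ⬝ᵥ y) := by field_simp
    linarith
  rw [h3]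
  linarith

/-- `[I; X₀ᵀ]`, which sends `a₀` to the true row `[a₀; X₀ᵀ a₀]`. -/
def lift (X₀ : Matrix (Fin n) (Fin d) ℝ) : Matrix (Col n d) (Fin n) ℝ := fromRows 1 X₀ᵀ

lemma lift_mulVec (X₀ : Matrix (Fin n) (Fin d) ℝ) (a : Fin n → ℝ) :
    lift X₀ *ᵥ a = trueRow X₀ a := by
  rw [lift, fromRows_mulVec, one_mulVec, trueRow]

lemma lift_transpose_mul_Zmat (X₀ X : Matrix (Fin n) (Fin d) ℝ) :
    (lift X₀)ᵀ * Zmat X = X - X₀ := by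
  ext k l
  simp [lift, Zmat, mul_apply, Fintype.sum_sum_type, Matrix.one_apply]
  ring

/-- The limit of the averaged `c cᵀ`. -/
def rowLimit (σsq : ℝ) (X₀ : Matrix (Fin n) (Fin d) ℝ) (VA : Matrix (Fin n) (Fin n) ℝ)
    (Sinf : Matrix (Col n d) (Col n d) ℝ) : Matrix (Col n d) (Col n d) ℝ :=
  lift X₀ * VA * (lift X₀)ᵀ + σsq • Sinf

lemma quad_rowLimit (σsq : ℝ) (X₀ : Matrix (Fin n) (Fin d) ℝ) (VA : Matrix (Fin n) (Fin n) ℝ)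
    (Sinf : Matrix (Col n d) (Col n d) ℝ) (x : Col n d → ℝ) :
    x ⬝ᵥ rowLimit σsq X₀ VA Sinf *ᵥ x =
      ((lift X₀)ᵀ *ᵥ x) ⬝ᵥ VA *ᵥ ((lift X₀)ᵀ *ᵥ x) + σsq * (x ⬝ᵥ Sinf *ᵥ x) := by
  rw [rowLimit, add_mulVec, dotProduct_add, smul_mulVec, dotProduct_smul, smul_eq_mul,
    transpose_mulVec_dotProduct, mulVec_mulVec, mulVec_mulVec, Matrix.mul_assoc]

/-- Condition `rank Z_{0J} = d` makes the limit of the averaged `c cᵀ` positive definite, although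
the errors vanish outside `J`. -/
lemma rowLimit_posDef {σsq : ℝ} (hσ : 0 < σsq) {X₀ : Matrix (Fin n) (Fin d) ℝ}
    {VA : Matrix (Fin n) (Fin n) ℝ} (hVA : VA.PosDef) (h : IsWeight J ϰ Sginf Sinf)
    (hX : (rowsJ J (Zmat X₀)).rank = d) : (rowLimit σsq X₀ VA Sinf).PosDef := by
  have hs : (rowLimit σsq X₀ VA Sinf)ᵀ = rowLimit σsq X₀ VA Sinf := by
    have hV : VAᵀ = VA := hVA.1
    simp only [rowLimit, transpose_add, transpose_mul, transpose_transpose, transpose_smul, h.symm,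
      hV, Matrix.mul_assoc]
  refine PosDef.of_dotProduct_mulVec_pos hs fun x hx => ?_
  rw [star_trivial, quad_rowLimit]
  have h1 : 0 ≤ ((lift X₀)ᵀ *ᵥ x) ⬝ᵥ VA *ᵥ ((lift X₀)ᵀ *ᵥ x) := by
    simpa using hVA.posSemidef.dotProduct_mulVec_nonneg ((lift X₀)ᵀ *ᵥ x)
  have h2 := mul_nonneg hσ.le (h.quad_nonneg x)
  refine lt_of_le_of_ne (add_nonneg h1 h2) fun h0 => hx ?_
  have h3 : (lift X₀)ᵀ *ᵥ x = 0 := by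
    by_contra hne
    have := hVA.dotProduct_mulVec_pos hne
    rw [star_trivial] at this
    linarith
  have h4 : x ⬝ᵥ Sinf *ᵥ x = 0 := by nlinarith
  have h5 : ∀ j : J, x j = 0 := by
    have h6 := h.lower_quad x
    rw [h4] at h6
    have h7 : ∑ j : J, x j ^ 2 = 0 := le_antisymm
      (by by_contra hlt; nlinarith [mul_pos (pow_pos h.pos 2) (not_le.1 hlt)])
      (Finset.sum_nonneg fun _ _ => sq_nonneg _)
    intro j
    exact pow_eq_zero_iff two_ne_zero |>.1
      ((Finset.sum_eq_zero_iff_of_nonneg fun _ _ => sq_nonneg _).1 h7 j (Finset.mem_univ j))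
  -- the kernel of `[I, X₀]` is the range of `Z₀`
  have h6 : Zmat X₀ *ᵥ (fun l => -x (Sum.inr l)) = x := by
    funext j
    rcases j with j | j
    · have h7 : x (Sum.inl j) + (X₀ *ᵥ fun l => x (Sum.inr l)) j = 0 := by
        have h8 := congrFun h3 j
        rw [lift, transpose_fromRows, transpose_one, transpose_transpose, fromCols_mulVec,
          one_mulVec] at h8
        exact h8
      have h8 : (fun l => -x (Sum.inr l)) = -fun l => x (Sum.inr l) := rfl
      rw [Zmat, fromRows_mulVec, Sum.elim_inl, h8, mulVec_neg, Pi.neg_apply]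
      linarith
    · simp [Zmat, fromRows_mulVec, neg_mulVec]
  have h7 : rowsJ J (Zmat X₀) *ᵥ (fun l => -x (Sum.inr l)) = rowsJ J (Zmat X₀) *ᵥ 0 := by
    rw [rowsJ_mulVec, h6, mulVec_zero]
    exact funext h5
  have h8 := (rank_eq_iff_injective _).1 hX h7
  rw [← h6, h8, mulVec_zero]

lemma IsWeight.exists_profile_factor (h : IsWeight J ϰ Sginf Sinf) {X : Matrix (Fin n) (Fin d) ℝ}
    (hX : (rowsJ J (Zmat X)).rank = d) : ∃ (k : ℕ) (b : Fin k → Fin d → ℝ),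
      (∀ v, v ⬝ᵥ (gram Sinf X)⁻¹ *ᵥ v = ∑ q, (b q ⬝ᵥ v) ^ 2) ∧
      ∑ q, (Zmat X *ᵥ b q) ⬝ᵥ Sinf *ᵥ (Zmat X *ᵥ b q) = d := by
  obtain ⟨k, b, hb, hM⟩ := exists_sum_sq (h.gram_posDef hX).inv.posSemidef
  refine ⟨k, b, hb, ?_⟩
  simp only [← quad_gram]
  rw [hM, mul_nonsing_inv _ ((h.rank_iff X).1 hX), trace_one, Fintype.card_fin]

end Comparison

/-! ### Laws of large numbers for the rows -/

lemma tendsto_avg_sum {α κ : Type*} [Fintype κ] {F : Filter (ℕ × α)} {f : κ → ℕ → α → ℝ}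
    {l : κ → ℝ} (t : κ → ℝ) (h : ∀ k, Tendsto (fun p : ℕ × α => (p.1 : ℝ)⁻¹ *
      ∑ i ∈ Finset.range p.1, f k i p.2) F (𝓝 (l k))) :
    Tendsto (fun p : ℕ × α => (p.1 : ℝ)⁻¹ * ∑ i ∈ Finset.range p.1, ∑ k, t k * f k i p.2) F
      (𝓝 (∑ k, t k * l k)) := by
  refine (tendsto_finsetSum Finset.univ fun k _ => (h k).const_mul (t k)).congr fun p => ?_
  rw [Finset.sum_comm, Finset.mul_sum]
  refine Finset.sum_congr rfl fun k _ => ?_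
  rw [← Finset.mul_sum]
  ring

section WeightLimit

variable {Ω : Type*} [MeasurableSpace Ω] {P : Measure Ω} [IsProbabilityMeasure P]

/-- Averages with random weights that converge, uniformly for large indices, to a constant. -/
lemma tendsto_avg_weight_sub {α : Type*} [TopologicalSpace α] {x₀ : α} {g : ℕ → α → ℝ} {l₀ : ℝ}
    (h1 : Tendsto (fun q : ℕ × α => g q.1 q.2) (atTop ×ˢ 𝓝 x₀) (𝓝 l₀))
    (h2 : ∀ i, ∃ B, ∀ᶠ x in 𝓝 x₀, |g i x| ≤ B)
    {v : ℕ → Ω → ℝ} (hv : ∀ i, Integrable (v i) P) {C : ℝ}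
    (hC : ∀ m : ℕ, (m : ℝ)⁻¹ * ∑ i ∈ Finset.range m, ∫ ω, |v i ω| ∂P ≤ C)
    {xh : ℕ × Ω → α} (hx : Tendsto xh (inProb P) (𝓝 x₀)) :
    Tendsto (fun p : ℕ × Ω => (p.1 : ℝ)⁻¹ *
      ∑ i ∈ Finset.range p.1, v i p.2 * (g i (xh p) - l₀)) (inProb P) (𝓝 0) := by
  have h3 := tendsto_avg_weight (φ := fun i x => g i x - l₀) (by simpa using h1.sub_const l₀)
    (fun i => by
      obtain ⟨B, hB⟩ := h2 i
      exact ⟨B + |l₀|, hB.mono fun x hx => (abs_sub _ _).trans (by linarith)⟩) hv hC hx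
  refine squeeze_zero_norm (fun p => ?_) h3
  rw [norm_mul, Real.norm_of_nonneg (by positivity : (0 : ℝ) ≤ (p.1 : ℝ)⁻¹)]
  refine mul_le_mul_of_nonneg_left ((norm_sum_le _ _).trans_eq ?_) (by positivity)
  exact Finset.sum_congr rfl fun i _ => by rw [norm_mul, Real.norm_eq_abs, Real.norm_eq_abs]

lemma tendsto_avg_weight_mul {α : Type*} [TopologicalSpace α] {x₀ : α} {g : ℕ → α → ℝ} {l₀ : ℝ}
    (h1 : Tendsto (fun q : ℕ × α => g q.1 q.2) (atTop ×ˢ 𝓝 x₀) (𝓝 l₀))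
    (h2 : ∀ i, ∃ B, ∀ᶠ x in 𝓝 x₀, |g i x| ≤ B)
    {v : ℕ → Ω → ℝ} (hv : ∀ i, Integrable (v i) P) {C : ℝ}
    (hC : ∀ m : ℕ, (m : ℝ)⁻¹ * ∑ i ∈ Finset.range m, ∫ ω, |v i ω| ∂P ≤ C)
    {xh : ℕ × Ω → α} (hx : Tendsto xh (inProb P) (𝓝 x₀)) {l : ℝ}
    (hl : Tendsto (fun p : ℕ × Ω => (p.1 : ℝ)⁻¹ * ∑ i ∈ Finset.range p.1, v i p.2)
      (inProb P) (𝓝 l)) :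
    Tendsto (fun p : ℕ × Ω => (p.1 : ℝ)⁻¹ *
      ∑ i ∈ Finset.range p.1, v i p.2 * g i (xh p)) (inProb P) (𝓝 (l * l₀)) := by
  have h3 := (tendsto_avg_weight_sub h1 h2 hv hC hx).add (hl.mul_const l₀)
  rw [zero_add] at h3
  refine h3.congr fun p => ?_
  simp only [mul_sub, Finset.sum_sub_distrib, ← Finset.sum_mul]
  ring

/-- Averages with deterministic converging weights. -/
lemma tendsto_avg_mul_seq {v : ℕ → Ω → ℝ} (hv : ∀ i, Integrable (v i) P) {C : ℝ}
    (hC : ∀ m : ℕ, (m : ℝ)⁻¹ * ∑ i ∈ Finset.range m, ∫ ω, |v i ω| ∂P ≤ C) {l l₀ : ℝ}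
    (hl : Tendsto (fun p : ℕ × Ω => (p.1 : ℝ)⁻¹ * ∑ i ∈ Finset.range p.1, v i p.2)
      (inProb P) (𝓝 l)) {g : ℕ → ℝ} (hg : Tendsto g atTop (𝓝 l₀)) :
    Tendsto (fun p : ℕ × Ω => (p.1 : ℝ)⁻¹ *
      ∑ i ∈ Finset.range p.1, v i p.2 * g i) (inProb P) (𝓝 (l * l₀)) :=
  tendsto_avg_weight_mul (α := Unit) (x₀ := ()) (g := fun i _ => g i) (hg.comp tendsto_fst)
    (fun i => ⟨|g i|, by simp⟩) hv hC (xh := fun _ => ()) tendsto_const_nhds hl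

end WeightLimit

/-- The errors-in-variables model: the probabilistic assumptions, the weights of the rows and of
the limit, and the two rank conditions. -/
structure IsModel {n d : ℕ} {Ω : Type*} [MeasurableSpace Ω] (P : Measure Ω) (δ ϰ σsq : ℝ)
    (J : Finset (Col n d)) (X₀ : Matrix (Fin n) (Fin d) ℝ) (a₀ : ℕ → Fin n → ℝ)
    (e : ℕ → Ω → Col n d → ℝ) (Sg : ℕ → Matrix J J ℝ) (S : ℕ → Matrix (Col n d) (Col n d) ℝ)
    (Sginf : Matrix J J ℝ) (Sinf : Matrix (Col n d) (Col n d) ℝ) (VA : Matrix (Fin n) (Fin n) ℝ)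
    (μ₄ : Col n d → Col n d → Col n d → Col n d → ℝ) : Prop where
  error : IsErrorModel P δ a₀ e σsq S Sinf VA μ₄
  weight : ∀ i, IsWeight J ϰ (Sg i) (S i)
  weight_inf : IsWeight J ϰ Sginf Sinf
  sigma_pos : 0 < σsq
  rank : (rowsJ J (Zmat X₀)).rank = d
  isUnit_VA : IsUnit VA.det

namespace IsModel

variable {n d : ℕ} {Ω : Type*} [MeasurableSpace Ω] {P : Measure Ω} {δ ϰ σsq : ℝ}
  {J : Finset (Col n d)} {X₀ : Matrix (Fin n) (Fin d) ℝ} {a₀ : ℕ → Fin n → ℝ}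
  {e : ℕ → Ω → Col n d → ℝ} {Sg : ℕ → Matrix J J ℝ} {S : ℕ → Matrix (Col n d) (Col n d) ℝ}
  {Sginf : Matrix J J ℝ} {Sinf : Matrix (Col n d) (Col n d) ℝ} {VA : Matrix (Fin n) (Fin n) ℝ}
  {μ₄ : Col n d → Col n d → Col n d → Col n d → ℝ}
  (h : IsModel P δ ϰ σsq J X₀ a₀ e Sg S Sginf Sinf VA μ₄)
include h

lemma posDef_VA : VA.PosDef := by
  have hs : VAᵀ = VA := by
    ext j k
    refine tendsto_nhds_unique (h.error.tendsto_VA k j) ((h.error.tendsto_VA j k).congr fun m => ?_)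
    simp only [mul_comm (a₀ _ j)]
  have hp : VA.PosSemidef := by
    refine PosSemidef.of_dotProduct_mulVec_nonneg hs fun x => ?_
    rw [star_trivial]
    have h1 : Tendsto (fun m : ℕ => (m : ℝ)⁻¹ * ∑ i ∈ Finset.range m, (a₀ i ⬝ᵥ x) ^ 2) atTop
        (𝓝 (x ⬝ᵥ VA *ᵥ x)) := by
      rw [dotProduct_mulVec_eq_sum]
      refine (tendsto_finsetSum Finset.univ fun j _ => tendsto_finsetSum Finset.univ fun k _ =>
        (h.error.tendsto_VA j k).mul_const (x j * x k)).congr fun m => ?_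
      have h2 : ∀ i, (a₀ i ⬝ᵥ x) ^ 2 = ∑ j, ∑ k, a₀ i j * a₀ i k * (x j * x k) := fun i => by
        rw [dotProduct, pow_two, Finset.sum_mul_sum]
        exact Finset.sum_congr rfl fun j _ => Finset.sum_congr rfl fun k _ => by ring
      simp only [h2]
      conv_rhs => rw [Finset.sum_comm, Finset.mul_sum]
      refine Finset.sum_congr rfl fun j _ => ?_
      conv_rhs => rw [Finset.sum_comm, Finset.mul_sum]
      refine Finset.sum_congr rfl fun k _ => ?_
      rw [← Finset.sum_mul, mul_assoc]
    exact ge_of_tendsto' h1 fun m =>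
      mul_nonneg (by positivity) (Finset.sum_nonneg fun _ _ => sq_nonneg _)
  exact hp.posDef_iff_isUnit.2 ((isUnit_iff_isUnit_det _).2 h.isUnit_VA)

lemma exists_integral_error_sq_le : ∃ K : ℝ, 0 ≤ K ∧ ∀ i j, ∫ ω, e i ω j ^ 2 ∂P ≤ K := by
  obtain ⟨B, hB, hS⟩ := h.error.exists_abs_S_le
  refine ⟨σsq * B, mul_nonneg h.sigma_pos.le hB, fun i j => ?_⟩
  simp only [pow_two]
  rw [h.error.second]
  exact mul_le_mul_of_nonneg_left ((le_abs_self _).trans (hS i j j)) h.sigma_pos.le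

lemma exists_avg_trueRow_sq_le (j : Col n d) :
    ∃ C, ∀ m : ℕ, (m : ℝ)⁻¹ * ∑ i ∈ Finset.range m, trueRow X₀ (a₀ i) j ^ 2 ≤ C := by
  obtain ⟨C, hC⟩ := h.error.exists_avg_regressor_sq_le
  refine ⟨(∑ p, lift X₀ j p ^ 2) * C, fun m => ?_⟩
  have h1 : ∀ i, trueRow X₀ (a₀ i) j ^ 2 ≤ (∑ p, lift X₀ j p ^ 2) * ∑ p, a₀ i p ^ 2 := fun i => by
    rw [← lift_mulVec]
    exact Finset.sum_mul_sq_le_sq_mul_sq Finset.univ (lift X₀ j) (a₀ i)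
  refine le_trans ?_ (mul_le_mul_of_nonneg_left (hC m) (Finset.sum_nonneg fun _ _ => sq_nonneg _))
  rw [mul_left_comm, Finset.mul_sum (Finset.range m) _ (∑ p, lift X₀ j p ^ 2)]
  exact mul_le_mul_of_nonneg_left (Finset.sum_le_sum fun i _ => h1 i) (by positivity)

variable [IsProbabilityMeasure P]

lemma tendsto_avg_regressor_mul_error (p : Fin n) (k : Col n d) :
    Tendsto (fun q : ℕ × Ω => (q.1 : ℝ)⁻¹ * ∑ i ∈ Finset.range q.1, a₀ i p * e i q.2 k)
      (inProb P) (𝓝 0) :=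
  h.error.isLyapunovSeq.tendsto_avg (Sum.inl (p, k))

lemma tendsto_avg_error_mul (j k : Col n d) :
    Tendsto (fun q : ℕ × Ω => (q.1 : ℝ)⁻¹ * ∑ i ∈ Finset.range q.1, e i q.2 j * e i q.2 k)
      (inProb P) (𝓝 (σsq * Sinf j k)) := by
  have h1 : Tendsto (fun q : ℕ × Ω => (q.1 : ℝ)⁻¹ * ∑ i ∈ Finset.range q.1,
      (e i q.2 j * e i q.2 k - σsq * S i j k)) (inProb P) (𝓝 0) :=
    h.error.isLyapunovSeq.tendsto_avg (Sum.inr (j, k))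
  have h2 := (tendsto_avg_of_tendsto ((h.error.tendsto_S j k).const_mul σsq)).comp
    (tendsto_fst_inProb (P := P))
  have h3 := h1.add h2
  rw [zero_add] at h3
  refine h3.congr fun q => ?_
  simp only [Function.comp_apply, Finset.sum_sub_distrib]
  ring

lemma exists_avg_integral_abs_error_mul_le (j k : Col n d) :
    ∃ C, ∀ m : ℕ, (m : ℝ)⁻¹ * ∑ i ∈ Finset.range m, ∫ ω, |e i ω j * e i ω k| ∂P ≤ C := by
  obtain ⟨K, hK, hE⟩ := h.exists_integral_error_sq_le
  refine ⟨K + K, fun m => ?_⟩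
  rcases Nat.eq_zero_or_pos m with rfl | hm
  · simp; linarith
  have h1 : ∀ i ∈ Finset.range m, ∫ ω, |e i ω j * e i ω k| ∂P ≤ K + K := fun i _ => by
    have hj := (h.error.memLp i j).integrable_sq
    have hk := (h.error.memLp i k).integrable_sq
    calc ∫ ω, |e i ω j * e i ω k| ∂P ≤ ∫ ω, (e i ω j ^ 2 + e i ω k ^ 2) ∂P := by
          refine integral_mono_of_nonneg (ae_of_all _ fun _ => abs_nonneg _) (hj.add hk)
            (ae_of_all _ fun ω => ?_)
          rw [abs_le]
          constructor <;> nlinarith [sq_nonneg (e i ω j + e i ω k), sq_nonneg (e i ω j - e i ω k),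
            sq_nonneg (e i ω j), sq_nonneg (e i ω k)]
      _ = _ := integral_add hj hk
      _ ≤ K + K := add_le_add (hE i j) (hE i k)
  rw [inv_mul_le_iff₀ (by positivity)]
  refine (Finset.sum_le_sum h1).trans_eq ?_
  rw [Finset.sum_const, Finset.card_range, nsmul_eq_mul]

lemma integrable_row_mul (i : ℕ) (j k : Col n d) : Integrable
    (fun ω => (trueRow X₀ (a₀ i) + e i ω) j * (trueRow X₀ (a₀ i) + e i ω) k) P := by
  have h1 : ∀ j, MemLp (fun ω => trueRow X₀ (a₀ i) j + e i ω j) 2 P := fun j =>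
    (memLp_const (trueRow X₀ (a₀ i) j)).add (h.error.memLp i j)
  exact (h1 j).integrable_mul (h1 k)

lemma exists_avg_integral_abs_row_mul_le (j k : Col n d) :
    ∃ C, ∀ m : ℕ, (m : ℝ)⁻¹ * ∑ i ∈ Finset.range m,
      ∫ ω, |(trueRow X₀ (a₀ i) + e i ω) j * (trueRow X₀ (a₀ i) + e i ω) k| ∂P ≤ C := by
  obtain ⟨K, hK, hE⟩ := h.exists_integral_error_sq_le
  obtain ⟨C₁, hC₁⟩ := h.exists_avg_trueRow_sq_le j
  obtain ⟨C₂, hC₂⟩ := h.exists_avg_trueRow_sq_le k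
  refine ⟨2 * C₁ + 2 * C₂ + 4 * K, fun m => ?_⟩
  have h1 : ∀ i ∈ Finset.range m,
      ∫ ω, |(trueRow X₀ (a₀ i) + e i ω) j * (trueRow X₀ (a₀ i) + e i ω) k| ∂P ≤
        2 * trueRow X₀ (a₀ i) j ^ 2 + 2 * trueRow X₀ (a₀ i) k ^ 2 + 4 * K := fun i _ => by
    have hj := (h.error.memLp i j).integrable_sq
    have hk := (h.error.memLp i k).integrable_sq
    have hint : Integrable (fun ω => 2 * e i ω j ^ 2 + 2 * e i ω k ^ 2) P :=
      (hj.const_mul 2).add (hk.const_mul 2)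
    calc ∫ ω, |(trueRow X₀ (a₀ i) + e i ω) j * (trueRow X₀ (a₀ i) + e i ω) k| ∂P
        ≤ ∫ ω, (2 * trueRow X₀ (a₀ i) j ^ 2 + 2 * trueRow X₀ (a₀ i) k ^ 2 +
            (2 * e i ω j ^ 2 + 2 * e i ω k ^ 2)) ∂P := by
          refine integral_mono_of_nonneg (ae_of_all _ fun _ => abs_nonneg _)
            ((integrable_const _).add hint) (ae_of_all _ fun ω => ?_)
          simp only [Pi.add_apply]
          set s := trueRow X₀ (a₀ i) j
          set t := trueRow X₀ (a₀ i) k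
          rw [abs_le]
          constructor <;> nlinarith [sq_nonneg (s + e i ω j + (t + e i ω k)),
            sq_nonneg (s + e i ω j - (t + e i ω k)), sq_nonneg (s - e i ω j),
            sq_nonneg (t - e i ω k), sq_nonneg (s + e i ω j), sq_nonneg (t + e i ω k)]
      _ = 2 * trueRow X₀ (a₀ i) j ^ 2 + 2 * trueRow X₀ (a₀ i) k ^ 2 +
            (2 * ∫ ω, e i ω j ^ 2 ∂P + 2 * ∫ ω, e i ω k ^ 2 ∂P) := by
          rw [integral_add (integrable_const _) hint, integral_const, probReal_univ, one_smul,
            integral_add (hj.const_mul 2) (hk.const_mul 2), integral_const_mul, integral_const_mul]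
      _ ≤ _ := by linarith [hE i j, hE i k]
  have h2 : (m : ℝ)⁻¹ * ∑ _i ∈ Finset.range m, 4 * K ≤ 4 * K := by
    rw [Finset.sum_const, Finset.card_range, nsmul_eq_mul, ← mul_assoc]
    exact mul_le_of_le_one_left (by linarith) (inv_mul_le_one_of_le₀ le_rfl (by positivity))
  refine (mul_le_mul_of_nonneg_left (Finset.sum_le_sum h1) (by positivity)).trans ?_
  rw [Finset.sum_add_distrib, Finset.sum_add_distrib, ← Finset.mul_sum, ← Finset.mul_sum]
  linarith [hC₁ m, hC₂ m]

/-- The averaged `c cᵀ` converges in probability. -/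
lemma tendsto_avg_row_mul (j k : Col n d) :
    Tendsto (fun q : ℕ × Ω => (q.1 : ℝ)⁻¹ * ∑ i ∈ Finset.range q.1,
      (trueRow X₀ (a₀ i) + e i q.2) j * (trueRow X₀ (a₀ i) + e i q.2) k)
      (inProb P) (𝓝 (rowLimit σsq X₀ VA Sinf j k)) := by
  have h1 := tendsto_avg_sum (F := inProb P) (f := fun (p : Fin n × Fin n) i (_ : Ω) =>
      a₀ i p.1 * a₀ i p.2) (fun p => lift X₀ j p.1 * lift X₀ k p.2)
    fun p => (h.error.tendsto_VA p.1 p.2).comp (tendsto_fst_inProb (P := P))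
  have h2 := tendsto_avg_sum (f := fun p i ω => a₀ i p * e i ω k) (lift X₀ j)
    fun p => h.tendsto_avg_regressor_mul_error p k
  have h3 := tendsto_avg_sum (f := fun p i ω => a₀ i p * e i ω j) (lift X₀ k)
    fun p => h.tendsto_avg_regressor_mul_error p j
  have h4 := ((h1.add h2).add h3).add (h.tendsto_avg_error_mul j k)
  have h5 : ∑ p : Fin n × Fin n, lift X₀ j p.1 * lift X₀ k p.2 * VA p.1 p.2 +
      ∑ p, lift X₀ j p * 0 + ∑ p, lift X₀ k p * 0 + σsq * Sinf j k =
      rowLimit σsq X₀ VA Sinf j k := by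
    simp only [mul_zero, Finset.sum_const_zero, add_zero]
    rw [rowLimit, Matrix.add_apply, Matrix.smul_apply, smul_eq_mul]
    congr 1
    simp only [mul_apply, transpose_apply, ← Finset.univ_product_univ, Finset.sum_product,
      Finset.sum_mul]
    rw [Finset.sum_comm]
    exact Finset.sum_congr rfl fun p _ => Finset.sum_congr rfl fun q _ => by ring
  rw [h5] at h4
  refine h4.congr fun q => ?_
  rw [← mul_add, ← mul_add, ← mul_add, ← Finset.sum_add_distrib, ← Finset.sum_add_distrib,
    ← Finset.sum_add_distrib]
  refine congrArg _ (Finset.sum_congr rfl fun i _ => ?_)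
  have h6 : ∀ j, trueRow X₀ (a₀ i) j = ∑ p, lift X₀ j p * a₀ i p := fun j => by
    rw [← lift_mulVec]
    rfl
  have h7 : trueRow X₀ (a₀ i) j * trueRow X₀ (a₀ i) k =
      ∑ p : Fin n × Fin n, lift X₀ j p.1 * lift X₀ k p.2 * (a₀ i p.1 * a₀ i p.2) := by
    rw [h6, h6, Finset.sum_mul_sum, ← Finset.univ_product_univ, Finset.sum_product]
    exact Finset.sum_congr rfl fun p _ => Finset.sum_congr rfl fun q _ => by ring
  have h8 : ∀ j k, ∑ p, lift X₀ j p * (a₀ i p * e i q.2 k) = trueRow X₀ (a₀ i) j * e i q.2 k :=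
    fun j k => by
      rw [h6, Finset.sum_mul]
      exact Finset.sum_congr rfl fun p _ => by ring
  rw [← h7, h8, h8, Pi.add_apply, Pi.add_apply]
  ring

end IsModel

/-! ### Consistency -/

section Frobenius

variable {n d : ℕ}

/-- The squared Frobenius norm. -/
def frobSq (X : Matrix (Fin n) (Fin d) ℝ) : ℝ := ∑ k, X k ⬝ᵥ X k

lemma dotProduct_self_nonneg_real {ι : Type*} [Fintype ι] (x : ι → ℝ) : 0 ≤ x ⬝ᵥ x :=
  Finset.sum_nonneg fun _ _ => mul_self_nonneg _

lemma frobSq_nonneg (X : Matrix (Fin n) (Fin d) ℝ) : 0 ≤ frobSq X :=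
  Finset.sum_nonneg fun _ _ => dotProduct_self_nonneg_real _

lemma sq_le_frobSq (X : Matrix (Fin n) (Fin d) ℝ) (k : Fin n) (l : Fin d) :
    X k l ^ 2 ≤ frobSq X := by
  have h1 : X k l ^ 2 ≤ X k ⬝ᵥ X k := by
    rw [dotProduct_self_eq_sum_sq]
    exact Finset.single_le_sum (f := fun l => X k l ^ 2) (fun _ _ => sq_nonneg _)
      (Finset.mem_univ l)
  exact h1.trans (Finset.single_le_sum (f := fun k => X k ⬝ᵥ X k)
    (fun _ _ => dotProduct_self_nonneg_real _) (Finset.mem_univ k))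

lemma frobSq_le_two_mul (X Y : Matrix (Fin n) (Fin d) ℝ) :
    frobSq X ≤ 2 * frobSq (X - Y) + 2 * frobSq Y := by
  simp only [frobSq, dotProduct_self_eq_sum_sq, Finset.mul_sum, ← Finset.sum_add_distrib]
  refine Finset.sum_le_sum fun k _ => Finset.sum_le_sum fun l _ => ?_
  rw [Matrix.sub_apply]
  nlinarith [sq_nonneg (X k l - Y k l - Y k l)]

lemma mulVec_dotProduct_self_le (X : Matrix (Fin n) (Fin d) ℝ) (y : Fin d → ℝ) :
    (X *ᵥ y) ⬝ᵥ (X *ᵥ y) ≤ frobSq X * (y ⬝ᵥ y) := by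
  rw [dotProduct_self_eq_sum_sq, frobSq, Finset.sum_mul]
  refine Finset.sum_le_sum fun k _ => ?_
  rw [dotProduct_self_eq_sum_sq, dotProduct_self_eq_sum_sq]
  exact Finset.sum_mul_sq_le_sq_mul_sq Finset.univ (X k) y

lemma quad_gram_le (S : Matrix (Col n d) (Col n d) ℝ) (X : Matrix (Fin n) (Fin d) ℝ)
    (y : Fin d → ℝ) :
    y ⬝ᵥ gram S X *ᵥ y ≤ (∑ j, ∑ k, |S j k|) * (1 + frobSq X) * (y ⬝ᵥ y) := by
  rw [quad_gram, mul_assoc]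
  refine (le_abs_self _).trans ((abs_quad_le S _).trans (mul_le_mul_of_nonneg_left ?_
    (Finset.sum_nonneg fun _ _ => Finset.sum_nonneg fun _ _ => abs_nonneg _)))
  have h1 : (Zmat X *ᵥ y) ⬝ᵥ (Zmat X *ᵥ y) = (X *ᵥ y) ⬝ᵥ (X *ᵥ y) + y ⬝ᵥ y := by
    rw [Zmat, fromRows_mulVec, neg_mulVec, one_mulVec]
    simp [dotProduct, Fintype.sum_sum_type]
  rw [h1]
  linarith [mulVec_dotProduct_self_le X y]

lemma inv_mul_le_quad_inv {ι : Type*} [Fintype ι] [DecidableEq ι] {M : Matrix ι ι ℝ}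
    (hM : M.PosDef) {B : ℝ} (hB : 0 < B) {v : ι → ℝ} (h : v ⬝ᵥ M *ᵥ v ≤ B * (v ⬝ᵥ v)) :
    B⁻¹ * (v ⬝ᵥ v) ≤ v ⬝ᵥ M⁻¹ *ᵥ v := by
  have h1 := two_mul_dotProduct_sub_le hM v (B⁻¹ • v)
  simp only [smul_dotProduct, dotProduct_smul, smul_eq_mul, mulVec_smul] at h1
  have h2 : B⁻¹ * (B⁻¹ * (v ⬝ᵥ M *ᵥ v)) ≤ B⁻¹ * (v ⬝ᵥ v) := by
    refine mul_le_mul_of_nonneg_left ?_ (inv_nonneg.2 hB.le)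
    rwa [inv_mul_le_iff₀ hB]
  linarith

lemma profile_congr {S : Matrix (Col n d) (Col n d) ℝ} {c c' : Col n d → ℝ}
    {X : Matrix (Fin n) (Fin d) ℝ} (h : (Zmat X)ᵀ *ᵥ c = (Zmat X)ᵀ *ᵥ c') :
    profile S c X = profile S c' X := by
  rw [profile, profile, h]

lemma profile_eq_sum (S : Matrix (Col n d) (Col n d) ℝ) (c : Col n d → ℝ)
    (X : Matrix (Fin n) (Fin d) ℝ) : profile S c X =
      ∑ j, ∑ k, (Zmat X * (gram S X)⁻¹ * (Zmat X)ᵀ) j k * (c j * c k) := by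
  rw [← dotProduct_mulVec_eq_sum, profile, transpose_mulVec_dotProduct, mulVec_mulVec,
    mulVec_mulVec]

lemma Zmat_transpose_mulVec_trueRow (X₀ X : Matrix (Fin n) (Fin d) ℝ) (a : Fin n → ℝ) :
    (Zmat X)ᵀ *ᵥ trueRow X₀ a = (X - X₀)ᵀ *ᵥ a := by
  rw [← lift_mulVec, mulVec_mulVec, ← transpose_transpose (lift X₀), ← transpose_mul,
    lift_transpose_mul_Zmat]

end Frobenius

lemma tendsto_inv_gram {n d : ℕ} {α : Type*} {F : Filter α} {S : α → Matrix (Col n d) (Col n d) ℝ}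
    {Sinf : Matrix (Col n d) (Col n d) ℝ} (hS : Tendsto S F (𝓝 Sinf))
    {X : α → Matrix (Fin n) (Fin d) ℝ} {X₀ : Matrix (Fin n) (Fin d) ℝ}
    (hX : Tendsto X F (𝓝 X₀)) (h0 : IsUnit (gram Sinf X₀).det) :
    Tendsto (fun i => (gram (S i) (X i))⁻¹) F (𝓝 (gram Sinf X₀)⁻¹) := by
  have h1 : Continuous fun q : Matrix (Col n d) (Col n d) ℝ × Matrix (Fin n) (Fin d) ℝ =>
      gram q.1 q.2 :=
    ((continuous_Zmat.comp continuous_snd).matrix_transpose.matrix_mul continuous_fst).matrix_mul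
      (continuous_Zmat.comp continuous_snd)
  have h2 : Tendsto (fun i => gram (S i) (X i)) F (𝓝 (gram Sinf X₀)) :=
    Tendsto.comp (g := fun q : Matrix (Col n d) (Col n d) ℝ × Matrix (Fin n) (Fin d) ℝ =>
      gram q.1 q.2) (f := fun i => (S i, X i)) (h1.tendsto (Sinf, X₀)) (hS.prodMk_nhds hX)
  have h3 : ContinuousAt (fun M : Matrix (Fin d) (Fin d) ℝ => M⁻¹) (gram Sinf X₀) :=
    continuousAt_inv continuousAt_id h0
  exact h3.tendsto.comp h2

namespace IsModel

variable {n d : ℕ} {Ω : Type*} [MeasurableSpace Ω] {P : Measure Ω} {δ ϰ σsq : ℝ}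
  {J : Finset (Col n d)} {X₀ : Matrix (Fin n) (Fin d) ℝ} {a₀ : ℕ → Fin n → ℝ}
  {e : ℕ → Ω → Col n d → ℝ} {Sg : ℕ → Matrix J J ℝ} {S : ℕ → Matrix (Col n d) (Col n d) ℝ}
  {Sginf : Matrix J J ℝ} {Sinf : Matrix (Col n d) (Col n d) ℝ} {VA : Matrix (Fin n) (Fin n) ℝ}
  {μ₄ : Col n d → Col n d → Col n d → Col n d → ℝ}
  (h : IsModel P δ ϰ σsq J X₀ a₀ e Sg S Sginf Sinf VA μ₄)
include h

lemma tendsto_S : Tendsto S atTop (𝓝 Sinf) :=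
  tendsto_pi_nhds.2 fun j => tendsto_pi_nhds.2 fun k => h.error.tendsto_S j k

lemma isUnit_gram_inf : IsUnit (gram Sinf X₀).det := (h.weight_inf.rank_iff X₀).1 h.rank

lemma isUnit_gram (i : ℕ) : IsUnit (gram (S i) X₀).det := ((h.weight i).rank_iff X₀).1 h.rank

lemma tendsto_weightGap : Tendsto (fun i => weightGap ϰ (Sg i) Sginf) atTop (𝓝 0) := by
  have h1 : ∀ j k : J, Tendsto (fun i => |Sg i j k - Sginf j k|) atTop (𝓝 0) := fun j k => by
    have h2 := ((h.error.tendsto_S j k).sub_const (Sinf j k)).abs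
    rw [sub_self, abs_zero] at h2
    exact h2.congr fun i => by rw [(h.weight i).apply_mem, h.weight_inf.apply_mem]
  have h3 := (tendsto_finsetSum Finset.univ fun j _ => tendsto_finsetSum Finset.univ
    fun k _ => h1 j k).div_const (ϰ ^ 2)
  rw [show (0 : ℝ) = (∑ _j : J, ∑ _k : J, (0 : ℝ)) / ϰ ^ 2 by simp]
  exact h3

variable [IsProbabilityMeasure P]

/-- At the true parameter the profiled objective function depends on the errors only, because
`Z₀ᵀ c₀ = 0`; its average tends to `σ² tr (S_∞ Z₀ (Z₀ᵀ S_∞ Z₀)⁻¹ Z₀ᵀ) = σ² d`. -/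
lemma tendsto_avg_profile : Tendsto (fun q : ℕ × Ω => (q.1 : ℝ)⁻¹ *
    ∑ i ∈ Finset.range q.1, profile (S i) (trueRow X₀ (a₀ i) + e i q.2) X₀)
    (inProb P) (𝓝 (σsq * d)) := by
  let G : Matrix (Col n d) (Col n d) ℝ → Matrix (Col n d) (Col n d) ℝ :=
    fun S => Zmat X₀ * (gram S X₀)⁻¹ * (Zmat X₀)ᵀ
  have hG : Tendsto (fun i => G (S i)) atTop (𝓝 (G Sinf)) := by
    have h1 := tendsto_inv_gram h.tendsto_S (tendsto_const_nhds (x := X₀)) h.isUnit_gram_inf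
    exact ((((continuous_const (y := Zmat X₀)).matrix_mul continuous_id).matrix_mul
      (continuous_const (y := (Zmat X₀)ᵀ))).tendsto _).comp h1
  have h2 : ∀ j k, Tendsto (fun q : ℕ × Ω => (q.1 : ℝ)⁻¹ *
      ∑ i ∈ Finset.range q.1, e i q.2 j * e i q.2 k * G (S i) j k)
      (inProb P) (𝓝 (σsq * Sinf j k * G Sinf j k)) := fun j k => by
    obtain ⟨C, hC⟩ := h.exists_avg_integral_abs_error_mul_le j k
    exact tendsto_avg_mul_seq (v := fun i ω => e i ω j * e i ω k)
      (fun i => (h.error.memLp i j).integrable_mul (h.error.memLp i k)) hC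
      (h.tendsto_avg_error_mul j k) (g := fun i => G (S i) j k)
      (tendsto_pi_nhds.1 (tendsto_pi_nhds.1 hG j) k)
  have h3 := tendsto_finsetSum Finset.univ fun j _ => tendsto_finsetSum Finset.univ
    fun k _ => h2 j k
  have h4 : ∑ j, ∑ k, σsq * Sinf j k * G Sinf j k = σsq * d := by
    have h5 : trace (Sinf * (G Sinf)ᵀ) = d := by
      have hs : (G Sinf)ᵀ = G Sinf := by
        simp only [G, transpose_mul, transpose_transpose, transpose_nonsing_inv,
          h.weight_inf.gram_symm, Matrix.mul_assoc]
      rw [hs]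
      have h6 : Sinf * G Sinf = (Sinf * Zmat X₀ * (gram Sinf X₀)⁻¹) * (Zmat X₀)ᵀ := by
        simp only [G, Matrix.mul_assoc]
      rw [h6, trace_mul_comm, ← Matrix.mul_assoc, ← Matrix.mul_assoc]
      change trace (gram Sinf X₀ * _) = _
      rw [mul_nonsing_inv _ h.isUnit_gram_inf, trace_one, Fintype.card_fin]
    rw [← h5, trace, Finset.mul_sum]
    refine Finset.sum_congr rfl fun j _ => ?_
    rw [diag_apply, mul_apply, Finset.mul_sum]
    exact Finset.sum_congr rfl fun k _ => by rw [transpose_apply, mul_assoc]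
  rw [h4] at h3
  refine h3.congr fun q => ?_
  have h5 : ∀ i, profile (S i) (trueRow X₀ (a₀ i) + e i q.2) X₀ =
      ∑ j, ∑ k, e i q.2 j * e i q.2 k * G (S i) j k := fun i => by
    rw [profile_congr (c' := e i q.2), profile_eq_sum]
    · exact Finset.sum_congr rfl fun j _ => Finset.sum_congr rfl fun k _ => mul_comm _ _
    · rw [mulVec_add, Zmat_transpose_mulVec_trueRow, sub_self, transpose_zero, zero_mulVec,
        zero_add]
  simp only [h5]
  conv_rhs => rw [Finset.sum_comm, Finset.mul_sum]
  refine Finset.sum_congr rfl fun j _ => ?_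
  conv_rhs => rw [Finset.sum_comm, Finset.mul_sum]

/-- The averaged `c cᵀ`, weighted by the relative distances of the weights to their limit, dominates
`(1 - θ)` times the limit of the averaged `c cᵀ` in the order of quadratic forms. -/
lemma eventually_lower_quad {θ : ℝ} (hθ : 0 < θ) : ∀ᶠ q : ℕ × Ω in inProb P, ∀ x : Col n d → ℝ,
    (1 - θ) * (x ⬝ᵥ rowLimit σsq X₀ VA Sinf *ᵥ x) ≤ (q.1 : ℝ)⁻¹ * ∑ i ∈ Finset.range q.1,
      (1 + weightGap ϰ (Sg i) Sginf)⁻¹ * (x ⬝ᵥ (trueRow X₀ (a₀ i) + e i q.2)) ^ 2 := by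
  obtain ⟨lo, hlo, hquad⟩ := exists_lower_of_posDef
    (rowLimit_posDef h.sigma_pos h.posDef_VA h.weight_inf h.rank)
  let c : ℕ → Ω → Col n d → ℝ := fun i ω => trueRow X₀ (a₀ i) + e i ω
  let Q : ℕ × Ω → Matrix (Col n d) (Col n d) ℝ := fun q => of fun j k =>
    (q.1 : ℝ)⁻¹ * ∑ i ∈ Finset.range q.1, c i q.2 j * c i q.2 k *
      (1 + weightGap ϰ (Sg i) Sginf)⁻¹
  have hκ : Tendsto (fun i => (1 + weightGap ϰ (Sg i) Sginf)⁻¹) atTop (𝓝 1) := by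
    have h1 := (h.tendsto_weightGap.const_add 1).inv₀ (by norm_num)
    simpa using h1
  have hQ : ∀ j k, Tendsto (fun q => |Q q j k - rowLimit σsq X₀ VA Sinf j k|)
      (inProb P) (𝓝 0) := fun j k => by
    obtain ⟨C, hC⟩ := h.exists_avg_integral_abs_row_mul_le j k
    have h1 := tendsto_avg_mul_seq (v := fun i ω => c i ω j * c i ω k)
      (fun i => h.integrable_row_mul i j k) hC (h.tendsto_avg_row_mul j k) hκ
    rw [mul_one] at h1
    have h2 := (h1.sub_const (rowLimit σsq X₀ VA Sinf j k)).abs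
    rw [sub_self, abs_zero] at h2
    exact h2
  have hsum : Tendsto (fun q => ∑ j, ∑ k, |Q q j k - rowLimit σsq X₀ VA Sinf j k|)
      (inProb P) (𝓝 0) := by
    simpa using tendsto_finsetSum Finset.univ fun j _ => tendsto_finsetSum Finset.univ
      fun k _ => hQ j k
  filter_upwards [hsum.eventually_le_const (mul_pos hθ hlo)] with q hq x
  have h1 := (neg_abs_le _).trans' (neg_le_neg (abs_quad_le (Q q - rowLimit σsq X₀ VA Sinf) x))
  rw [sub_mulVec, dotProduct_sub] at h1
  have h2 : (∑ j, ∑ k, |(Q q - rowLimit σsq X₀ VA Sinf) j k|) * (x ⬝ᵥ x) ≤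
      θ * (x ⬝ᵥ rowLimit σsq X₀ VA Sinf *ᵥ x) := by
    refine (mul_le_mul_of_nonneg_right hq (dotProduct_self_nonneg_real x)).trans ?_
    rw [mul_assoc]
    exact mul_le_mul_of_nonneg_left (hquad x) hθ.le
  have h3 : x ⬝ᵥ Q q *ᵥ x = (q.1 : ℝ)⁻¹ * ∑ i ∈ Finset.range q.1,
      (1 + weightGap ϰ (Sg i) Sginf)⁻¹ * (x ⬝ᵥ (trueRow X₀ (a₀ i) + e i q.2)) ^ 2 := by
    have h4 : ∀ i, (1 + weightGap ϰ (Sg i) Sginf)⁻¹ * (x ⬝ᵥ c i q.2) ^ 2 =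
        ∑ j, ∑ k, c i q.2 j * c i q.2 k * (1 + weightGap ϰ (Sg i) Sginf)⁻¹ * (x j * x k) := by
      intro i
      rw [dotProduct, pow_two, Finset.sum_mul_sum, Finset.mul_sum]
      refine Finset.sum_congr rfl fun j _ => ?_
      rw [Finset.mul_sum]
      exact Finset.sum_congr rfl fun k _ => by ring
    change _ = (q.1 : ℝ)⁻¹ * ∑ i ∈ Finset.range q.1,
      (1 + weightGap ϰ (Sg i) Sginf)⁻¹ * (x ⬝ᵥ c i q.2) ^ 2
    simp only [h4]
    rw [dotProduct_mulVec_eq_sum]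
    conv_rhs => rw [Finset.sum_comm, Finset.mul_sum]
    refine Finset.sum_congr rfl fun j _ => ?_
    conv_rhs => rw [Finset.sum_comm, Finset.mul_sum]
    refine Finset.sum_congr rfl fun k _ => ?_
    rw [← Finset.sum_mul, ← mul_assoc ((q.1 : ℝ)⁻¹)]
    rfl
  rw [← h3]
  linarith

/-- Uniform lower bound for the profiled objective function. -/
lemma exists_eventually_lower_profile : ∃ K > 0, ∀ θ : ℝ, 0 < θ → θ < 1 →
    ∀ᶠ q : ℕ × Ω in inProb P, ∀ X, (rowsJ J (Zmat X)).rank = d →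
      (1 - θ) * (σsq * d + K * frobSq (X - X₀) / (1 + frobSq X)) ≤ (q.1 : ℝ)⁻¹ *
        ∑ i ∈ Finset.range q.1, profile (S i) (trueRow X₀ (a₀ i) + e i q.2) X := by
  obtain ⟨lo, hlo, hVA⟩ := exists_lower_of_posDef h.posDef_VA
  set B := 1 + ∑ j, ∑ k, |Sinf j k| with hB
  have hB0 : 0 < B := by
    have : 0 ≤ ∑ j, ∑ k, |Sinf j k| :=
      Finset.sum_nonneg fun _ _ => Finset.sum_nonneg fun _ _ => abs_nonneg _
    linarith
  refine ⟨lo * B⁻¹, by positivity, fun θ hθ hθ' => ?_⟩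
  filter_upwards [h.eventually_lower_quad hθ] with q hq X hX
  -- the form of `(Zᵀ S_∞ Z)⁻¹` is the sum of the squares of the linear forms `b t`
  obtain ⟨K, b, hb, htr⟩ := h.weight_inf.exists_profile_factor hX
  have hfX : 0 < 1 + frobSq X := by have := frobSq_nonneg X; linarith
  have h1 : ∀ t, (lift X₀)ᵀ *ᵥ (Zmat X *ᵥ b t) = (X - X₀) *ᵥ b t := fun t => by
    rw [mulVec_mulVec, lift_transpose_mul_Zmat]
  have h2 : ∑ t, ((X - X₀) *ᵥ b t) ⬝ᵥ ((X - X₀) *ᵥ b t) =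
      ∑ k, (X - X₀) k ⬝ᵥ (gram Sinf X)⁻¹ *ᵥ (X - X₀) k := by
    simp only [hb, dotProduct_self_eq_sum_sq]
    rw [Finset.sum_comm]
    refine Finset.sum_congr rfl fun k _ => Finset.sum_congr rfl fun t _ => ?_
    rw [mulVec, dotProduct_comm]
  have h3 : B⁻¹ * (frobSq (X - X₀) / (1 + frobSq X)) ≤
      ∑ t, ((X - X₀) *ᵥ b t) ⬝ᵥ ((X - X₀) *ᵥ b t) := by
    rw [h2, frobSq, Finset.sum_div, Finset.mul_sum]
    refine Finset.sum_le_sum fun k _ => ?_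
    have h4 := inv_mul_le_quad_inv (h.weight_inf.gram_posDef hX) (mul_pos hB0 hfX)
      (v := (X - X₀) k) ((quad_gram_le Sinf X _).trans (mul_le_mul_of_nonneg_right
        (mul_le_mul_of_nonneg_right (by linarith) hfX.le) (dotProduct_self_nonneg_real _)))
    refine h4.trans_eq' ?_
    rw [mul_inv, div_eq_mul_inv]
    ring
  have h5 : σsq * d + lo * B⁻¹ * frobSq (X - X₀) / (1 + frobSq X) ≤
      ∑ t, (Zmat X *ᵥ b t) ⬝ᵥ rowLimit σsq X₀ VA Sinf *ᵥ (Zmat X *ᵥ b t) := by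
    simp only [quad_rowLimit, h1, Finset.sum_add_distrib]
    rw [← Finset.mul_sum, htr, add_comm]
    refine add_le_add ?_ le_rfl
    rw [mul_div_assoc, mul_assoc]
    refine (mul_le_mul_of_nonneg_left h3 hlo.le).trans ?_
    rw [Finset.mul_sum]
    exact Finset.sum_le_sum fun t _ => hVA _
  refine (mul_le_mul_of_nonneg_left h5 (by linarith)).trans ?_
  rw [Finset.mul_sum]
  refine (Finset.sum_le_sum fun t _ => hq _).trans ?_
  rw [← Finset.mul_sum, Finset.sum_comm]
  refine mul_le_mul_of_nonneg_left (Finset.sum_le_sum fun i _ => ?_) (by positivity)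
  refine ((h.weight i).profile_ge h.weight_inf _ hX).trans_eq' ?_
  rw [← Finset.mul_sum, profile, hb]
  refine congrArg _ (Finset.sum_congr rfl fun t _ => ?_)
  rw [dotProduct_comm (b t), transpose_mulVec_dotProduct, dotProduct_comm]

/-- Admissible matrices that do at least as well as `X₀` are close to `X₀`. -/
lemma eventually_frobSq_le {ρ : ℝ} (hρ : 0 < ρ) : ∀ᶠ q : ℕ × Ω in inProb P, ∀ X,
    (rowsJ J (Zmat X)).rank = d →
      ∑ i ∈ Finset.range q.1, profile (S i) (trueRow X₀ (a₀ i) + e i q.2) X ≤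
        ∑ i ∈ Finset.range q.1, profile (S i) (trueRow X₀ (a₀ i) + e i q.2) X₀ →
      frobSq (X - X₀) ≤ ρ := by
  obtain ⟨K, hK, hlow⟩ := h.exists_eventually_lower_profile
  have hs : 0 ≤ σsq * d := mul_nonneg h.sigma_pos.le (Nat.cast_nonneg d)
  have hf := frobSq_nonneg X₀
  -- `τ` is the factor in `‖X - X₀‖² ≤ τ (1 + ‖X‖²)`
  obtain ⟨τ, hτ0, hτ1, hτ2⟩ : ∃ τ > 0, τ ≤ 1 / 4 ∧ 2 * τ * (1 + 2 * frobSq X₀) ≤ ρ := by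
    refine ⟨min (1 / 4) (ρ / (2 * (1 + 2 * frobSq X₀))), by positivity, min_le_left _ _, ?_⟩
    have h1 := min_le_right (1 / 4 : ℝ) (ρ / (2 * (1 + 2 * frobSq X₀)))
    rw [le_div_iff₀ (by positivity)] at h1
    linarith
  -- `θ` makes the loss in the lower bound small relative to the gain `K τ`
  obtain ⟨θ, hθ0, hθ1, hθ2⟩ : ∃ θ > 0, θ ≤ 1 / 2 ∧ 2 * θ * (1 + σsq * d) ≤ τ * K := by
    refine ⟨min (1 / 2) (τ * K / (2 * (1 + σsq * d))), by positivity, min_le_left _ _, ?_⟩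
    have h1 := min_le_right (1 / 2 : ℝ) (τ * K / (2 * (1 + σsq * d)))
    rw [le_div_iff₀ (by positivity)] at h1
    linarith
  filter_upwards [hlow θ hθ0 (by linarith), h.tendsto_avg_profile.eventually_le_const
    (lt_add_of_pos_right (σsq * d) hθ0)] with q h1 h2 X hX hle
  have h3 := (h1 X hX).trans ((mul_le_mul_of_nonneg_left hle (by positivity)).trans h2)
  have hfX : 0 < 1 + frobSq X := by have := frobSq_nonneg X; linarith
  set F := frobSq (X - X₀) with hF
  have hF0 : 0 ≤ F := frobSq_nonneg _
  set R := F / (1 + frobSq X) with hR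
  have hR0 : 0 ≤ R := div_nonneg hF0 hfX.le
  have h4 : R ≤ τ := by
    rw [mul_div_assoc, ← hR] at h3
    have h5 : K * R ≤ 2 * ((1 - θ) * (K * R)) := by nlinarith [mul_nonneg hK.le hR0]
    have h6 : K * R ≤ K * τ := by nlinarith
    exact le_of_mul_le_mul_left h6 hK
  have h5 : F ≤ τ * (1 + frobSq X) := by rwa [hR, div_le_iff₀ hfX] at h4
  have h6 := frobSq_le_two_mul X X₀
  rw [← hF] at h6
  have h7 : τ * (1 + frobSq X) ≤ τ * (1 + 2 * frobSq X₀) + 2 * τ * F := by nlinarith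
  nlinarith

section Norm

-- the entrywise maximum norm, which induces the product topology
attribute [local instance] Matrix.normedAddCommGroup Matrix.normedSpace

/-- With probability tending to one the minimization problem has a solution, and all solutions lie
in a given neighbourhood of `X₀`. -/
lemma eventually_exists_isSolution {U : Set (Matrix (Fin n) (Fin d) ℝ)} (hU : U ∈ 𝓝 X₀) :
    ∀ᶠ q : ℕ × Ω in inProb P,
      (∃ X, IsSolution J Sg (dataMatrix (fun i => trueRow X₀ (a₀ i) + e i q.2) q.1) X) ∧
      ∀ X, IsSolution J Sg (dataMatrix (fun i => trueRow X₀ (a₀ i) + e i q.2) q.1) X → X ∈ U := by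
  have hdet : ∀ᶠ X in 𝓝 X₀, (gram Sinf X).det ≠ 0 :=
    ((continuous_gram Sinf).matrix_det.tendsto X₀).eventually_ne h.isUnit_gram_inf.ne_zero
  obtain ⟨r, hr, hball⟩ := Metric.nhds_basis_closedBall.mem_iff.1 (inter_mem hU hdet)
  filter_upwards [h.eventually_frobSq_le (pow_pos hr 2)] with q hq
  set c : ℕ → Col n d → ℝ := fun i => trueRow X₀ (a₀ i) + e i q.2 with hc
  have hsum : ∀ X, ∑ i : Fin q.1, profile (S i) (dataMatrix c q.1 i) X =
      ∑ i ∈ Finset.range q.1, profile (S i) (c i) X := fun X =>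
    Fin.sum_univ_eq_sum_range (fun i => profile (S i) (c i) X) q.1
  have hmem : ∀ X, (rowsJ J (Zmat X)).rank = d →
      ∑ i ∈ Finset.range q.1, profile (S i) (c i) X ≤
        ∑ i ∈ Finset.range q.1, profile (S i) (c i) X₀ → X ∈ Metric.closedBall X₀ r := by
    intro X hX hle
    rw [mem_closedBall_iff_norm, Matrix.norm_le_iff hr.le]
    intro k l
    exact abs_le_of_sq_le_sq ((sq_le_frobSq _ k l).trans (hq X hX hle)) hr.le
  have hadm : ∀ X ∈ Metric.closedBall X₀ r, (rowsJ J (Zmat X)).rank = d := fun X hX =>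
    (h.weight_inf.rank_iff X).2 (isUnit_iff_ne_zero.2 (hball hX).2)
  -- a minimizer over a compact ball around `X₀` is a global one, since every competitor which is
  -- at least as good as `X₀` lies in the ball
  constructor
  · have hcont : ContinuousOn (fun X => ∑ i ∈ Finset.range q.1, profile (S i) (c i) X)
        (Metric.closedBall X₀ r) := fun X hX =>
      (tendsto_finsetSum _ fun i _ => (continuousAt_profile (c i)
        (((h.weight i).rank_iff X).1 (hadm X hX))).tendsto).mono_left nhdsWithin_le_nhds
    obtain ⟨X, hX, hmin⟩ := (isCompact_closedBall X₀ r).exists_isMinOn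
      ⟨X₀, Metric.mem_closedBall_self hr.le⟩ hcont
    refine ⟨X, (isSolution_iff h.weight).2 ⟨hadm X hX, fun X' hX' => ?_⟩⟩
    rw [hsum, hsum]
    rcases le_total (∑ i ∈ Finset.range q.1, profile (S i) (c i) X')
      (∑ i ∈ Finset.range q.1, profile (S i) (c i) X₀) with hle | hle
    · exact hmin (hmem X' hX' hle)
    · exact (hmin (Metric.mem_closedBall_self hr.le)).trans hle
  · intro X hX
    obtain ⟨h1, h2⟩ := (isSolution_iff h.weight).1 hX
    have h3 := h2 X₀ h.rank
    rw [hsum, hsum] at h3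
    exact (hball (hmem X h1 h3)).1

end Norm

variable {est : (m : ℕ) → Matrix (Fin m) (Col n d) ℝ → OnePoint (Matrix (Fin n) (Fin d) ℝ)}
  (hest : IsEWTLS J Sg est) {Xhat : ℕ → Ω → OnePoint (Matrix (Fin n) (Fin d) ℝ)}
  (hXhat : ∀ m ω, Xhat m ω = est m (dataMatrix (fun i => trueRow X₀ (a₀ i) + e i ω) m))
include hest hXhat

lemma eventually_isSolution : ∀ᶠ q : ℕ × Ω in inProb P,
    Xhat q.1 q.2 = OnePoint.some (finitePart (Xhat q.1 q.2)) ∧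
      IsSolution J Sg (dataMatrix (fun i => trueRow X₀ (a₀ i) + e i q.2) q.1)
        (finitePart (Xhat q.1 q.2)) := by
  filter_upwards [h.eventually_exists_isSolution univ_mem] with q hq
  obtain ⟨X, hX, hsol⟩ := hest.solves _ _ hq.1
  rw [← hXhat] at hX
  rw [hX]
  exact ⟨rfl, hsol⟩

/-- Weak consistency of the estimator. -/
theorem tendsto_estimator :
    Tendsto (fun q : ℕ × Ω => finitePart (Xhat q.1 q.2)) (inProb P) (𝓝 X₀) := by
  refine tendsto_iff_forall_eventually_mem.2 fun U hU => ?_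
  filter_upwards [h.eventually_exists_isSolution hU, h.eventually_isSolution hest hXhat]
    with q h1 h2
  exact h1.2 _ h2.2

end IsModel

/-! ### Normalized sums with estimated smooth weights -/

section SmoothWeights

open Asymptotics

lemma isLittleO_one_add {α : Type*} {l : Filter α} {a u v : α → ℝ} {K : ℝ}
    (ha : Tendsto a l (𝓝 0)) (hu : ∀ x, 0 ≤ u x) (hv : ∀ x, |v x| ≤ K * u x) :
    (fun x => a x * v x) =o[l] fun x => 1 + u x := by
  have h1 : v =O[l] fun x => 1 + u x := by
    refine IsBigO.of_bound |K| (Eventually.of_forall fun x => (hv x).trans ?_)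
    rw [Real.norm_eq_abs, abs_of_nonneg (by linarith [hu x] : (0 : ℝ) ≤ 1 + u x)]
    nlinarith [le_abs_self K, abs_nonneg K, hu x, mul_le_mul_of_nonneg_right (le_abs_self K) (hu x)]
  simpa using ((isLittleO_one_iff ℝ).2 ha).mul_isBigO h1

lemma inv_sqrt_eq (m : ℕ) : (√(m : ℝ))⁻¹ = (m : ℝ)⁻¹ * √(m : ℝ) := by
  rw [← inv_sqrt_sq, pow_two, mul_assoc]
  rcases Nat.eq_zero_or_pos m with rfl | hm
  · simp
  · rw [inv_mul_cancel₀ (by positivity), mul_one]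

/-- A sequence of independent centered variables with bounded averaged variances. -/
structure IsCenteredSeq {Ω : Type*} [MeasurableSpace Ω] (P : Measure Ω) (w : ℕ → Ω → ℝ) : Prop where
  memLp : ∀ i, MemLp (w i) 2 P
  mean : ∀ i, ∫ ω, w i ω ∂P = 0
  indep : iIndepFun w P
  bdd : ∃ C, ∀ m : ℕ, (m : ℝ)⁻¹ * ∑ i ∈ Finset.range m, ∫ ω, w i ω ^ 2 ∂P ≤ C

variable {Ω : Type*} [MeasurableSpace Ω] {P : Measure Ω} [IsProbabilityMeasure P]

lemma IsCenteredSeq.exists_avg_abs_le {w : ℕ → Ω → ℝ} (hw : IsCenteredSeq P w) :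
    ∃ C, ∀ m : ℕ, (m : ℝ)⁻¹ * ∑ i ∈ Finset.range m, ∫ ω, |w i ω| ∂P ≤ C := by
  obtain ⟨C, hC⟩ := hw.bdd
  refine ⟨1 + C, fun m => ?_⟩
  refine (mul_le_mul_of_nonneg_left (Finset.sum_le_sum fun i _ => integral_abs_le_of_sq (hw.memLp i))
    (by positivity)).trans ?_
  rw [Finset.sum_add_distrib, mul_add, Finset.sum_const, Finset.card_range, nsmul_eq_mul, mul_one]
  exact add_le_add (inv_mul_le_one_of_le₀ le_rfl (by positivity)) (hC m)

variable {E F : Type*} [NormedAddCommGroup E] [NormedSpace ℝ E] [NormedAddCommGroup F]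
  [NormedSpace ℝ F] {g : E × F → ℝ} {s : ℕ → E} {sinf : E} {x₀ : F}

/-- Strict differentiability at `(s_∞, x₀)` linearizes `g (s i, ·)` at `x₀` uniformly for large `i`,
with the derivative at the limit point. -/
lemma tendsto_diff_quotient (hg : ContDiffAt ℝ 1 g (sinf, x₀)) (hs : Tendsto s atTop (𝓝 sinf)) :
    Tendsto (fun q : ℕ × F => ‖q.2 - x₀‖⁻¹ * (g (s q.1, q.2) - g (s q.1, x₀) -
      fderiv ℝ g (sinf, x₀) (0, q.2 - x₀))) (atTop ×ˢ 𝓝 x₀) (𝓝 0) := by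
  have h1 := (hg.hasStrictFDerivAt one_ne_zero).isLittleO
  have h2 : Tendsto (fun q : ℕ × F => ((s q.1, q.2), (s q.1, x₀))) (atTop ×ˢ 𝓝 x₀)
      (𝓝 ((sinf, x₀), (sinf, x₀))) :=
    ((hs.comp tendsto_fst).prodMk_nhds tendsto_snd).prodMk_nhds
      ((hs.comp tendsto_fst).prodMk_nhds tendsto_const_nhds)
  rw [Metric.tendsto_nhds]
  intro ε hε
  filter_upwards [(h1.comp_tendsto h2).def (half_pos hε)] with q hq
  simp only [Function.comp_apply, Prod.mk_sub_mk, sub_self, Prod.norm_mk, norm_zero] at hq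
  rw [max_eq_right (norm_nonneg _)] at hq
  rw [dist_zero_right, norm_mul, norm_inv, norm_norm]
  refine lt_of_le_of_lt (mul_le_mul_of_nonneg_left hq (by positivity)) ?_
  rw [mul_left_comm]
  have h3 : ‖q.2 - x₀‖⁻¹ * ‖q.2 - x₀‖ ≤ 1 := inv_mul_le_one_of_le₀ le_rfl (norm_nonneg _)
  nlinarith

lemma exists_eventually_diff_quotient_le {t : E} (hg : ContDiffAt ℝ 1 g (t, x₀))
    (D : E × F →L[ℝ] ℝ) : ∃ B, ∀ᶠ x in 𝓝 x₀,
      |‖x - x₀‖⁻¹ * (g (t, x) - g (t, x₀) - D (0, x - x₀))| ≤ B := by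
  have h1 := (hg.differentiableAt one_ne_zero).isBigO_sub
  have h2 : Tendsto (fun x : F => (t, x)) (𝓝 x₀) (𝓝 (t, x₀)) :=
    tendsto_const_nhds.prodMk_nhds tendsto_id
  obtain ⟨c, hc⟩ := (h1.comp_tendsto h2).bound
  refine ⟨|c| + ‖D‖, hc.mono fun x hx => ?_⟩
  simp only [Function.comp_apply, Prod.mk_sub_mk, sub_self, Prod.norm_mk, norm_zero] at hx
  rw [max_eq_right (norm_nonneg _), Real.norm_eq_abs] at hx
  have h3 : |D (0, x - x₀)| ≤ ‖D‖ * ‖x - x₀‖ := by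
    have := D.le_opNorm (0, x - x₀)
    rwa [Prod.norm_mk, norm_zero, max_eq_right (norm_nonneg _)] at this
  have h4 : |g (t, x) - g (t, x₀) - D (0, x - x₀)| ≤ (|c| + ‖D‖) * ‖x - x₀‖ := by
    refine (abs_sub _ _).trans ?_
    have := mul_le_mul_of_nonneg_right (le_abs_self c) (norm_nonneg (x - x₀))
    linarith
  rw [abs_mul, abs_inv, abs_norm]
  refine (mul_le_mul_of_nonneg_left h4 (by positivity)).trans ?_
  have h5 : ‖x - x₀‖⁻¹ * ‖x - x₀‖ ≤ 1 := inv_mul_le_one_of_le₀ le_rfl (norm_nonneg _)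
  have h6 : 0 ≤ |c| + ‖D‖ := by positivity
  calc ‖x - x₀‖⁻¹ * ((|c| + ‖D‖) * ‖x - x₀‖) = (|c| + ‖D‖) * (‖x - x₀‖⁻¹ * ‖x - x₀‖) := by ring
    _ ≤ _ := mul_le_of_le_one_right h6 h5

/-- In a normalized sum of centered variables, smooth weights `g (s i, x̂)` at a consistent
estimator `x̂` may be replaced by their limit, with an error negligible relative to
`1 + √m ‖x̂ - x₀‖`. -/
theorem isLittleO_normalized_sum_weight (hg : ContDiffAt ℝ 1 g (sinf, x₀))
    (hgi : ∀ i, ContDiffAt ℝ 1 g (s i, x₀)) (hs : Tendsto s atTop (𝓝 sinf)) {w : ℕ → Ω → ℝ}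
    (hw : IsCenteredSeq P w) {xh : ℕ × Ω → F} (hx : Tendsto xh (inProb P) (𝓝 x₀)) :
    (fun p : ℕ × Ω => (√(p.1 : ℝ))⁻¹ * ∑ i ∈ Finset.range p.1,
      w i p.2 * (g (s i, xh p) - g (sinf, x₀))) =o[inProb P]
      fun p => 1 + √(p.1 : ℝ) * ‖xh p - x₀‖ := by
  set D := fderiv ℝ g (sinf, x₀) with hD
  -- `φ i` is the relative error of the linearization
  let φ : ℕ → F → ℝ := fun i x => ‖x - x₀‖⁻¹ * (g (s i, x) - g (s i, x₀) - D (0, x - x₀))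
  obtain ⟨C, hC⟩ := hw.bdd
  obtain ⟨C', hC'⟩ := hw.exists_avg_abs_le
  have hu : ∀ p : ℕ × Ω, 0 ≤ √(p.1 : ℝ) * ‖xh p - x₀‖ := fun p => by positivity
  have h1 : Tendsto (fun p : ℕ × Ω => (p.1 : ℝ)⁻¹ * ∑ i ∈ Finset.range p.1,
      w i p.2 * (φ i (xh p) - 0)) (inProb P) (𝓝 0) :=
    tendsto_avg_weight_sub (tendsto_diff_quotient hg hs)
      (fun i => exists_eventually_diff_quotient_le (hgi i) D)
      (fun i => (hw.memLp i).integrable one_le_two) hC' hx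
  have h2 := tendsto_avg_centered hw.memLp hw.mean hw.indep hC
  have h3 : Tendsto (fun i => g (s i, x₀) - g (sinf, x₀)) atTop (𝓝 0) := by
    have h4 : Tendsto (fun i => (s i, x₀)) atTop (𝓝 (sinf, x₀)) :=
      hs.prodMk_nhds tendsto_const_nhds
    simpa using (hg.continuousAt.tendsto.comp h4).sub_const (g (sinf, x₀))
  have h4 := tendsto_normalized_sum_weight hw.memLp hw.mean hw.indep hC h3
  have e1 := isLittleO_one_add (K := 1) (v := fun p => √(p.1 : ℝ) * ‖xh p - x₀‖) h1 hu
    fun p => by rw [abs_of_nonneg (hu p), one_mul]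
  have e2 := isLittleO_one_add (K := ‖D‖) (v := fun p => √(p.1 : ℝ) * D (0, xh p - x₀)) h2 hu
    fun p => by
      have := D.le_opNorm (0, xh p - x₀)
      rw [Prod.norm_mk, norm_zero, max_eq_right (norm_nonneg _), Real.norm_eq_abs] at this
      rw [abs_mul, abs_of_nonneg (Real.sqrt_nonneg _), mul_left_comm]
      exact mul_le_mul_of_nonneg_left this (Real.sqrt_nonneg _)
  have e3 := isLittleO_one_add (K := 0) (u := fun p : ℕ × Ω => √(p.1 : ℝ) * ‖xh p - x₀‖)
    (v := fun _ => 0) h4 hu fun p => by simp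
  have e4 : (fun p : ℕ × Ω => (√(p.1 : ℝ))⁻¹ * ∑ i ∈ Finset.range p.1,
      (g (s i, x₀) - g (sinf, x₀)) * w i p.2) =o[inProb P]
      fun p => 1 + √(p.1 : ℝ) * ‖xh p - x₀‖ := by
    refine ((isLittleO_one_iff ℝ).2 h4).trans_isBigO (IsBigO.of_bound 1 (Eventually.of_forall
      fun p => ?_))
    rw [norm_one, one_mul, Real.norm_eq_abs, abs_of_nonneg (by linarith [hu p])]
    linarith [hu p]
  refine ((e1.add e2).add e4).congr_left fun p => ?_
  have h5 : ∀ i, w i p.2 * (g (s i, xh p) - g (sinf, x₀)) =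
      w i p.2 * (φ i (xh p) - 0) * ‖xh p - x₀‖ + w i p.2 * D (0, xh p - x₀) +
        (g (s i, x₀) - g (sinf, x₀)) * w i p.2 := by
    intro i
    have h6 : (φ i (xh p) - 0) * ‖xh p - x₀‖ = g (s i, xh p) - g (s i, x₀) - D (0, xh p - x₀) := by
      rcases eq_or_ne (xh p) x₀ with he | he
      · have h7 : ((0 : E), (0 : F)) = 0 := rfl
        simp [φ, he, h7]
      · have h7 : ‖xh p - x₀‖ ≠ 0 := norm_ne_zero_iff.2 (sub_ne_zero.2 he)
        simp only [φ, sub_zero]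
        field_simp
    rw [mul_assoc, h6]
    ring
  simp only [h5, Finset.sum_add_distrib, ← Finset.sum_mul]
  rw [mul_add, mul_add, inv_sqrt_eq]
  ring

end SmoothWeights

section ContinuousWeights

variable {E F : Type*} [TopologicalSpace E] [TopologicalSpace F] {g : E × F → ℝ} {s : ℕ → E}
  {sinf : E} {x₀ : F}

lemma tendsto_weight (hg : ContinuousAt g (sinf, x₀)) (hs : Tendsto s atTop (𝓝 sinf)) :
    Tendsto (fun q : ℕ × F => g (s q.1, q.2)) (atTop ×ˢ 𝓝 x₀) (𝓝 (g (sinf, x₀))) :=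
  Tendsto.comp (g := g) (f := fun q : ℕ × F => (s q.1, q.2)) hg
    ((hs.comp tendsto_fst).prodMk_nhds tendsto_snd)

lemma exists_eventually_weight_le {t : E} (hg : ContinuousAt g (t, x₀)) :
    ∃ B, ∀ᶠ x in 𝓝 x₀, |g (t, x)| ≤ B := by
  have h1 : Tendsto (fun x : F => g (t, x)) (𝓝 x₀) (𝓝 (g (t, x₀))) :=
    Tendsto.comp (g := g) (f := fun x : F => (t, x)) hg
      (tendsto_const_nhds.prodMk_nhds tendsto_id)
  exact ⟨|g (t, x₀)| + 1, h1.abs.eventually_le_const (lt_add_one _)⟩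

end ContinuousWeights

/-! ### Smoothness of the coefficients of the score -/

section Coefficients

-- the entrywise maximum norm, which induces the product topology
attribute [local instance] Matrix.normedAddCommGroup Matrix.normedSpace

variable {n d : ℕ}

/-- The matrix `[I, 0] - [S_a, S_ab] Z (Zᵀ S Z)⁻¹ Zᵀ`, by which the score depends linearly on
`c cᵀ Z`. -/
def coefA (S : Matrix (Col n d) (Col n d) ℝ) (X : Matrix (Fin n) (Fin d) ℝ) :
    Matrix (Fin n) (Col n d) ℝ :=
  fromCols 1 0 - S.toRows₁ * Zmat X * (gram S X)⁻¹ * (Zmat X)ᵀ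

variable {q₀ : Matrix (Col n d) (Col n d) ℝ × Matrix (Fin n) (Fin d) ℝ}

lemma smoothAt_fst : SmoothAt (fun q : Matrix (Col n d) (Col n d) ℝ × Matrix (Fin n) (Fin d) ℝ =>
    q.1) q₀ := fun j k =>
  ((contDiff_apply_apply ℝ ℝ j k).comp contDiff_fst).contDiffAt

lemma smoothAt_snd : SmoothAt (fun q : Matrix (Col n d) (Col n d) ℝ × Matrix (Fin n) (Fin d) ℝ =>
    q.2) q₀ := fun j k =>
  ((contDiff_apply_apply ℝ ℝ j k).comp contDiff_snd).contDiffAt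

lemma smoothAt_Zmat : SmoothAt (fun q : Matrix (Col n d) (Col n d) ℝ × Matrix (Fin n) (Fin d) ℝ =>
    Zmat q.2) q₀ := by
  intro j l
  rcases j with j | j
  · exact smoothAt_snd j l
  · exact contDiffAt_const

lemma smoothAt_gram : SmoothAt (fun q : Matrix (Col n d) (Col n d) ℝ × Matrix (Fin n) (Fin d) ℝ =>
    gram q.1 q.2) q₀ :=
  (smoothAt_Zmat.transpose.mul smoothAt_fst).mul smoothAt_Zmat

lemma smoothAt_inv_gram (h0 : IsUnit (gram q₀.1 q₀.2).det) :
    SmoothAt (fun q : Matrix (Col n d) (Col n d) ℝ × Matrix (Fin n) (Fin d) ℝ =>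
      (gram q.1 q.2)⁻¹) q₀ :=
  smoothAt_gram.inv h0

lemma smoothAt_coefA (h0 : IsUnit (gram q₀.1 q₀.2).det) :
    SmoothAt (fun q : Matrix (Col n d) (Col n d) ℝ × Matrix (Fin n) (Fin d) ℝ =>
      coefA q.1 q.2) q₀ := by
  have h1 : SmoothAt (fun q : Matrix (Col n d) (Col n d) ℝ × Matrix (Fin n) (Fin d) ℝ =>
      q.1.toRows₁) q₀ := fun j k => smoothAt_fst (Sum.inl j) k
  exact (smoothAt_const _ _).sub
    (((h1.mul smoothAt_Zmat).mul (smoothAt_inv_gram h0)).mul smoothAt_Zmat.transpose)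

lemma score_eq_coefA (c : Col n d → ℝ) (S : Matrix (Col n d) (Col n d) ℝ)
    (X : Matrix (Fin n) (Fin d) ℝ) : score c S X = coefA S X * vecMulVec c c * Zmat X := by
  have h1 : vecMulVec (fun k => c (Sum.inl k)) c =
      (fromCols 1 0 : Matrix (Fin n) (Col n d) ℝ) * vecMulVec c c := by
    rw [mul_vecMulVec, fromCols_mulVec, one_mulVec, zero_mulVec, add_zero]
    rfl
  rw [score, h1, coefA, Matrix.sub_mul, Matrix.sub_mul]
  rfl

lemma coefA_mul_mul_Zmat {S : Matrix (Col n d) (Col n d) ℝ} {X : Matrix (Fin n) (Fin d) ℝ}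
    (h0 : IsUnit (gram S X).det) : coefA S X * S * Zmat X = 0 := by
  have h1 : (fromCols 1 0 : Matrix (Fin n) (Col n d) ℝ) * S = S.toRows₁ := by
    conv_lhs => rw [← fromRows_toRows S]
    rw [fromCols_mul_fromRows, Matrix.one_mul, Matrix.zero_mul, add_zero]
  have h2 : S.toRows₁ * Zmat X * (gram S X)⁻¹ * (Zmat X)ᵀ * S * Zmat X =
      S.toRows₁ * Zmat X * ((gram S X)⁻¹ * gram S X) := by
    simp only [gram, Matrix.mul_assoc]
  rw [coefA, Matrix.sub_mul, Matrix.sub_mul, h1, h2, nonsing_inv_mul _ h0, Matrix.mul_one, sub_self]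

lemma coefA_mul_lift (S : Matrix (Col n d) (Col n d) ℝ) (X₀ : Matrix (Fin n) (Fin d) ℝ) :
    coefA S X₀ * lift X₀ = 1 := by
  have h1 : (Zmat X₀)ᵀ * lift X₀ = 0 := by
    rw [← transpose_transpose (lift X₀), ← transpose_mul, lift_transpose_mul_Zmat, sub_self,
      transpose_zero]
  rw [coefA, Matrix.sub_mul, Matrix.mul_assoc _ _ (lift X₀), h1, Matrix.mul_zero, sub_zero, lift,
    fromCols_mul_fromRows, Matrix.one_mul, Matrix.zero_mul, add_zero]

/-- The score at an arbitrary `X`, decomposed into the random terms and the drift. -/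
lemma score_eq_add {S : Matrix (Col n d) (Col n d) ℝ} {X : Matrix (Fin n) (Fin d) ℝ}
    (h0 : IsUnit (gram S X).det) (X₀ : Matrix (Fin n) (Fin d) ℝ) (a : Fin n → ℝ)
    (e : Col n d → ℝ) (σsq : ℝ) :
    score (trueRow X₀ a + e) S X =
      (coefA S X * lift X₀) * (pairW a e σsq S).1 * Zmat X +
      coefA S X * ((pairW a e σsq S).1)ᵀ * (X - X₀) +
      coefA S X * (pairW a e σsq S).2 * Zmat X +
      (coefA S X * lift X₀) * vecMulVec a a * (X - X₀) := by
  have h1 : vecMulVec (trueRow X₀ a + e) (trueRow X₀ a + e) =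
      lift X₀ * vecMulVec a e + vecMulVec e a * (lift X₀)ᵀ +
      (vecMulVec e e - σsq • S) + lift X₀ * vecMulVec a a * (lift X₀)ᵀ + σsq • S := by
    rw [← lift_mulVec, mul_vecMulVec, mul_vecMulVec, vecMulVec_mul, vecMulVec_mul, vecMul_transpose,
      add_vecMulVec, vecMulVec_add, vecMulVec_add]
    abel
  have h2 : (pairW a e σsq S).1 = vecMulVec a e := rfl
  have h3 : (pairW a e σsq S).2 = vecMulVec e e - σsq • S := rfl
  rw [score_eq_coefA, h1, h2, h3, transpose_vecMulVec]
  simp only [Matrix.mul_add, Matrix.add_mul, Matrix.mul_smul, Matrix.smul_mul,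
    coefA_mul_mul_Zmat h0, smul_zero, add_zero]
  simp only [Matrix.mul_assoc, lift_transpose_mul_Zmat]

lemma GammaOf_eq (S : Matrix (Col n d) (Col n d) ℝ) (X₀ : Matrix (Fin n) (Fin d) ℝ)
    (G : MatPair n d) : GammaOf S X₀ G =
      (coefA S X₀ * lift X₀) * G.1 * Zmat X₀ + coefA S X₀ * G.2 * Zmat X₀ := by
  rw [coefA_mul_lift, Matrix.one_mul, coefA, Matrix.sub_mul, Matrix.sub_mul, GammaOf]
  simp only [gram, Matrix.mul_assoc, add_sub_assoc]

end Coefficients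

/-! ### Expansion of the estimating equation -/

open Asymptotics

section MatrixWeights

variable {Ω : Type*} [MeasurableSpace Ω] {P : Measure Ω} [IsProbabilityMeasure P]
  {E F : Type*} [NormedAddCommGroup E] [NormedSpace ℝ E] [NormedAddCommGroup F]
  [NormedSpace ℝ F] {s : ℕ → E} {sinf : E} {x₀ : F}
  {ι α β κ : Type*} [Fintype α] [Fintype β]

lemma mul_mul_apply_eq_sum (A : Matrix ι α ℝ) (W : Matrix α β ℝ) (B : Matrix β κ ℝ) (j : ι)
    (l : κ) : (A * W * B) j l = ∑ k, ∑ k', W k k' * (A j k * B k' l) := by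
  simp only [mul_apply, Finset.sum_mul]
  rw [Finset.sum_comm]
  exact Finset.sum_congr rfl fun k _ => Finset.sum_congr rfl fun k' _ => by ring

lemma isLittleO_normalized_matrix_sum {A : E × F → Matrix ι α ℝ} {B : E × F → Matrix β κ ℝ}
    (hA : SmoothAt A (sinf, x₀)) (hAi : ∀ i, SmoothAt A (s i, x₀)) (hB : SmoothAt B (sinf, x₀))
    (hBi : ∀ i, SmoothAt B (s i, x₀)) (hs : Tendsto s atTop (𝓝 sinf))
    {W : ℕ → Ω → Matrix α β ℝ} (hW : ∀ k k', IsCenteredSeq P fun i ω => W i ω k k')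
    {xh : ℕ × Ω → F} (hx : Tendsto xh (inProb P) (𝓝 x₀)) (j : ι) (l : κ) :
    (fun p : ℕ × Ω => (√(p.1 : ℝ))⁻¹ * ∑ i ∈ Finset.range p.1,
      (A (s i, xh p) * W i p.2 * B (s i, xh p)) j l -
      (A (sinf, x₀) * ((√(p.1 : ℝ))⁻¹ • ∑ i ∈ Finset.range p.1, W i p.2) * B (sinf, x₀)) j l)
      =o[inProb P] fun p => 1 + √(p.1 : ℝ) * ‖xh p - x₀‖ := by
  have h1 : ∀ k k', (fun p : ℕ × Ω => (√(p.1 : ℝ))⁻¹ * ∑ i ∈ Finset.range p.1,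
      W i p.2 k k' * (A (s i, xh p) j k * B (s i, xh p) k' l -
        A (sinf, x₀) j k * B (sinf, x₀) k' l)) =o[inProb P]
      fun p => 1 + √(p.1 : ℝ) * ‖xh p - x₀‖ := fun k k' =>
    isLittleO_normalized_sum_weight (g := fun y => A y j k * B y k' l) ((hA j k).mul (hB k' l))
      (fun i => (hAi i j k).mul (hBi i k' l)) hs (hW k k') hx
  refine (IsLittleO.sum fun k (_ : k ∈ Finset.univ) => IsLittleO.sum
    fun k' (_ : k' ∈ Finset.univ) => h1 k k').congr_left fun p => ?_
  simp only [Finset.sum_apply, mul_mul_apply_eq_sum, mul_sub, Finset.sum_sub_distrib]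
  congr 1
  · conv_rhs => rw [Finset.sum_comm, Finset.mul_sum]
    refine Finset.sum_congr rfl fun k _ => ?_
    conv_rhs => rw [Finset.sum_comm, Finset.mul_sum]
  · refine Finset.sum_congr rfl fun k _ => Finset.sum_congr rfl fun k' _ => ?_
    rw [Matrix.smul_apply, Matrix.sum_apply, smul_eq_mul, ← Finset.sum_mul, mul_assoc]

end MatrixWeights

lemma IsLyapunovSeq.isCenteredSeq {Ω κ : Type*} [MeasurableSpace Ω] {P : Measure Ω} {δ : ℝ}
    {W : ℕ → Ω → κ → ℝ} {V : Matrix κ κ ℝ} (h : IsLyapunovSeq P δ W V) (k : κ) :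
    IsCenteredSeq P fun i ω => W i ω k :=
  ⟨fun i => h.memLp i k, fun i => h.mean i k, h.indep_apply k, h.exists_avg_sq_le k⟩

/-- The normalized sum of the pairs `W_i`. -/
def normSum {n d : ℕ} {Ω : Type*} (a₀ : ℕ → Fin n → ℝ) (e : ℕ → Ω → Col n d → ℝ) (σsq : ℝ)
    (S : ℕ → Matrix (Col n d) (Col n d) ℝ) (m : ℕ) (ω : Ω) : MatPair n d :=
  (√(m : ℝ))⁻¹ • ∑ i ∈ Finset.range m, pairW (a₀ i) (e i ω) σsq (S i)

lemma BddInProb.mul_const {Ω : Type*} [MeasurableSpace Ω] {P : Measure Ω} {f : ℕ → Ω → ℝ}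
    (hf : BddInProb P f) (t : ℝ) : BddInProb P fun m ω => f m ω * t := by
  intro ε hε
  obtain ⟨M, hM⟩ := hf ε hε
  refine ⟨|M| * |t|, hM.mono fun m hm => (measure_mono fun ω hω => ?_).trans hm⟩
  simp only [Set.mem_ofPred_eq, abs_mul] at hω ⊢
  have h1 : |M| < |f m ω| := lt_of_mul_lt_mul_right hω (abs_nonneg t)
  exact (le_abs_self M).trans_lt h1

namespace IsModel

variable {n d : ℕ} {Ω : Type*} [MeasurableSpace Ω] {P : Measure Ω} {δ ϰ σsq : ℝ}
  {J : Finset (Col n d)} {X₀ : Matrix (Fin n) (Fin d) ℝ} {a₀ : ℕ → Fin n → ℝ}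
  {e : ℕ → Ω → Col n d → ℝ} {Sg : ℕ → Matrix J J ℝ} {S : ℕ → Matrix (Col n d) (Col n d) ℝ}
  {Sginf : Matrix J J ℝ} {Sinf : Matrix (Col n d) (Col n d) ℝ} {VA : Matrix (Fin n) (Fin n) ℝ}
  {μ₄ : Col n d → Col n d → Col n d → Col n d → ℝ}
  (h : IsModel P δ ϰ σsq J X₀ a₀ e Sg S Sginf Sinf VA μ₄) [IsProbabilityMeasure P]
include h

lemma isCenteredSeq_fst (k : Fin n) (l : Col n d) :
    IsCenteredSeq P fun i ω => (pairW (a₀ i) (e i ω) σsq (S i)).1 k l :=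
  h.error.isLyapunovSeq.isCenteredSeq (Sum.inl (k, l))

lemma isCenteredSeq_snd (k l : Col n d) :
    IsCenteredSeq P fun i ω => (pairW (a₀ i) (e i ω) σsq (S i)).2 k l :=
  h.error.isLyapunovSeq.isCenteredSeq (Sum.inr (k, l))

lemma bddInProb_normSum_fst (k : Fin n) (l : Col n d) :
    BddInProb P fun m ω => (normSum a₀ e σsq S m ω).1 k l := by
  have h1 := h.error.isLyapunovSeq.bddInProb (Sum.inl (k, l))
  have h2 : (fun m ω => (normSum a₀ e σsq S m ω).1 k l) = fun (m : ℕ) ω =>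
      (√(m : ℝ))⁻¹ * ∑ i ∈ Finset.range m, vecW (a₀ i) (e i ω) σsq (S i) (Sum.inl (k, l)) := by
    funext m ω
    rw [normSum, Prod.smul_fst, Prod.fst_sum, Matrix.smul_apply, Matrix.sum_apply]
    rfl
  rwa [h2]

lemma bddInProb_normSum_snd (k l : Col n d) :
    BddInProb P fun m ω => (normSum a₀ e σsq S m ω).2 k l := by
  have h1 := h.error.isLyapunovSeq.bddInProb (Sum.inr (k, l))
  have h2 : (fun m ω => (normSum a₀ e σsq S m ω).2 k l) = fun (m : ℕ) ω =>
      (√(m : ℝ))⁻¹ * ∑ i ∈ Finset.range m, vecW (a₀ i) (e i ω) σsq (S i) (Sum.inr (k, l)) := by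
    funext m ω
    rw [normSum, Prod.smul_snd, Prod.snd_sum, Matrix.smul_apply, Matrix.sum_apply]
    rfl
  rwa [h2]

lemma bddInProb_GammaOf (j : Fin n) (l : Fin d) :
    BddInProb P fun m ω => GammaOf Sinf X₀ (normSum a₀ e σsq S m ω) j l := by
  simp only [GammaOf_eq, Matrix.add_apply, mul_mul_apply_eq_sum]
  refine BddInProb.add (BddInProb.sum _ fun k _ => BddInProb.sum _ fun k' _ => ?_)
    (BddInProb.sum _ fun k _ => BddInProb.sum _ fun k' _ => ?_)
  · exact (h.bddInProb_normSum_fst k k').mul_const _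
  · exact (h.bddInProb_normSum_snd k k').mul_const _

section Norm

-- the entrywise maximum norm, which induces the product topology
attribute [local instance] Matrix.normedAddCommGroup Matrix.normedSpace

lemma isLittleO_drift {A : Matrix (Col n d) (Col n d) ℝ × Matrix (Fin n) (Fin d) ℝ →
      Matrix (Fin n) (Fin n) ℝ}
    {B : Matrix (Col n d) (Col n d) ℝ × Matrix (Fin n) (Fin d) ℝ → Matrix (Fin d) (Fin d) ℝ}
    (hA : SmoothAt A (Sinf, X₀)) (hAi : ∀ i, SmoothAt A (S i, X₀)) (hB : SmoothAt B (Sinf, X₀))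
    (hBi : ∀ i, SmoothAt B (S i, X₀)) {xh : ℕ × Ω → Matrix (Fin n) (Fin d) ℝ}
    (hx : Tendsto xh (inProb P) (𝓝 X₀)) (j : Fin n) (l : Fin d) :
    (fun p : ℕ × Ω => (√(p.1 : ℝ))⁻¹ * ∑ i ∈ Finset.range p.1,
      (A (S i, xh p) * vecMulVec (a₀ i) (a₀ i) * ((xh p - X₀) * B (S i, xh p))) j l -
      (A (Sinf, X₀) * VA * ((√(p.1 : ℝ) • (xh p - X₀)) * B (Sinf, X₀))) j l)
      =o[inProb P] fun p => 1 + √(p.1 : ℝ) * ‖xh p - X₀‖ := by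
  have hu : ∀ p : ℕ × Ω, 0 ≤ √(p.1 : ℝ) * ‖xh p - X₀‖ := fun p => by positivity
  have h1 : ∀ (k k' : Fin n) (q : Fin d), Tendsto (fun p : ℕ × Ω => (p.1 : ℝ)⁻¹ *
      ∑ i ∈ Finset.range p.1, a₀ i k * a₀ i k' * (A (S i, xh p) j k * B (S i, xh p) q l) -
      VA k k' * (A (Sinf, X₀) j k * B (Sinf, X₀) q l)) (inProb P) (𝓝 0) := by
    intro k k' q
    obtain ⟨C, hC⟩ := h.error.exists_avg_abs_mul_le k k'
    have h2 := tendsto_avg_weight_mul (P := P)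
      (g := fun i x => A (S i, x) j k * B (S i, x) q l)
      (tendsto_weight (g := fun y => A y j k * B y q l)
        ((hA j k).continuousAt.mul (hB q l).continuousAt) h.tendsto_S)
      (fun i => exists_eventually_weight_le (g := fun y => A y j k * B y q l)
        ((hAi i j k).continuousAt.mul (hBi i q l).continuousAt))
      (v := fun i _ => a₀ i k * a₀ i k') (fun i => integrable_const _) (C := C)
      (by simpa using hC) hx ((h.error.tendsto_VA k k').comp (tendsto_fst_inProb (P := P)))
    simpa using h2.sub_const (VA k k' * (A (Sinf, X₀) j k * B (Sinf, X₀) q l))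
  have h2 : ∀ (k k' : Fin n) (q : Fin d), _ := fun k k' q =>
    isLittleO_one_add (K := 1) (v := fun p => √(p.1 : ℝ) * (xh p - X₀) k' q) (h1 k k' q) hu
      fun p => by
        rw [abs_mul, abs_of_nonneg (Real.sqrt_nonneg _), one_mul]
        exact mul_le_mul_of_nonneg_left ((Real.norm_eq_abs _).symm.trans_le
          (Matrix.norm_entry_le_entrywise_sup_norm (xh p - X₀))) (Real.sqrt_nonneg _)
  refine (IsLittleO.sum fun k (_ : k ∈ Finset.univ) => IsLittleO.sum
    fun k' (_ : k' ∈ Finset.univ) => IsLittleO.sum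
    fun q (_ : q ∈ Finset.univ) => h2 k k' q).congr_left fun p => ?_
  have h3 : ∀ (A' V : Matrix (Fin n) (Fin n) ℝ) (D : Matrix (Fin n) (Fin d) ℝ)
      (B' : Matrix (Fin d) (Fin d) ℝ), (A' * V * (D * B')) j l =
      ∑ k, ∑ k', ∑ q, V k k' * (A' j k * B' q l) * D k' q := by
    intro A' V D B'
    rw [mul_mul_apply_eq_sum]
    refine Finset.sum_congr rfl fun k _ => Finset.sum_congr rfl fun k' _ => ?_
    rw [mul_apply, Finset.mul_sum, Finset.mul_sum]
    exact Finset.sum_congr rfl fun q _ => by ring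
  simp only [Finset.sum_apply, h3, sub_mul, Finset.sum_sub_distrib]
  congr 1
  conv_rhs => rw [Finset.sum_comm, Finset.mul_sum]
  refine Finset.sum_congr rfl fun k _ => ?_
  conv_rhs => rw [Finset.sum_comm, Finset.mul_sum]
  refine Finset.sum_congr rfl fun k' _ => ?_
  conv_rhs => rw [Finset.sum_comm, Finset.mul_sum]
  refine Finset.sum_congr rfl fun q _ => ?_
  rw [← Finset.sum_mul, inv_sqrt_eq]
  simp only [vecMulVec_apply]
  ring

/-- For a consistent solution of the estimating equation, `V_A √m (x̂ - X₀) + Γ(T_m)` is negligible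
relative to `1 + √m ‖x̂ - X₀‖`. -/
theorem isLittleO_remainder {xh : ℕ × Ω → Matrix (Fin n) (Fin d) ℝ}
    (hx : Tendsto xh (inProb P) (𝓝 X₀))
    (heq : ∀ᶠ p in inProb P, (∀ i, IsUnit (gram (S i) (xh p)).det) ∧
      ∑ i ∈ Finset.range p.1,
        score (trueRow X₀ (a₀ i) + e i p.2) (S i) (xh p) * (gram (S i) (xh p))⁻¹ = 0)
    (j : Fin n) (l : Fin d) :
    (fun p : ℕ × Ω => (VA * (√(p.1 : ℝ) • (xh p - X₀)) +
      GammaOf Sinf X₀ (normSum a₀ e σsq S p.1 p.2)) j l) =o[inProb P]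
      fun p => 1 + √(p.1 : ℝ) * ‖xh p - X₀‖ := by
  let W : ℕ → Ω → MatPair n d := fun i ω => pairW (a₀ i) (e i ω) σsq (S i)
  let N : Matrix (Col n d) (Col n d) ℝ × Matrix (Fin n) (Fin d) ℝ → Matrix (Fin d) (Fin d) ℝ :=
    fun y => (gram y.1 y.2)⁻¹
  let A : Matrix (Col n d) (Col n d) ℝ × Matrix (Fin n) (Fin d) ℝ → Matrix (Fin n) (Col n d) ℝ :=
    fun y => coefA y.1 y.2
  have hN : SmoothAt N (Sinf, X₀) := smoothAt_inv_gram h.isUnit_gram_inf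
  have hNi : ∀ i, SmoothAt N (S i, X₀) := fun i => smoothAt_inv_gram (h.isUnit_gram i)
  have hA : SmoothAt A (Sinf, X₀) := smoothAt_coefA h.isUnit_gram_inf
  have hAi : ∀ i, SmoothAt A (S i, X₀) := fun i => smoothAt_coefA (h.isUnit_gram i)
  -- the estimating equation carries the factor `N`, which is removed at the end by multiplication
  -- with `Z₀ᵀ S_∞ Z₀`
  have key : ∀ r : Fin d, (fun p : ℕ × Ω => ((VA * (√(p.1 : ℝ) • (xh p - X₀)) +
      GammaOf Sinf X₀ (normSum a₀ e σsq S p.1 p.2)) * N (Sinf, X₀)) j r) =o[inProb P]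
      fun p => 1 + √(p.1 : ℝ) * ‖xh p - X₀‖ := by
    intro r
    have t1 := isLittleO_normalized_matrix_sum (A := fun y => A y * lift X₀)
      (B := fun y => Zmat y.2 * N y) (hA.mul (smoothAt_const _ _))
      (fun i => (hAi i).mul (smoothAt_const _ _)) (smoothAt_Zmat.mul hN)
      (fun i => smoothAt_Zmat.mul (hNi i)) h.tendsto_S (W := fun i ω => (W i ω).1)
      h.isCenteredSeq_fst hx j r
    have t2 := isLittleO_normalized_matrix_sum (A := A) (B := fun y => (y.2 - X₀) * N y) hA hAi
      ((smoothAt_snd.sub (smoothAt_const _ _)).mul hN)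
      (fun i => (smoothAt_snd.sub (smoothAt_const _ _)).mul (hNi i)) h.tendsto_S
      (W := fun i ω => ((W i ω).1)ᵀ) (fun k k' => h.isCenteredSeq_fst k' k) hx j r
    have t3 := isLittleO_normalized_matrix_sum (A := A) (B := fun y => Zmat y.2 * N y) hA hAi
      (smoothAt_Zmat.mul hN) (fun i => smoothAt_Zmat.mul (hNi i)) h.tendsto_S
      (W := fun i ω => (W i ω).2) h.isCenteredSeq_snd hx j r
    have t4 := h.isLittleO_drift (A := fun y => A y * lift X₀) (B := N)
      (hA.mul (smoothAt_const _ _)) (fun i => (hAi i).mul (smoothAt_const _ _)) hN hNi hx j r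
    refine ((((t1.add t2).add t3).add t4).neg_left).congr' ?_ EventuallyEq.rfl
    filter_upwards [heq] with p hp
    have e1 : ((√(p.1 : ℝ))⁻¹ * ∑ i ∈ Finset.range p.1,
          (A (S i, xh p) * lift X₀ * (W i p.2).1 * (Zmat (xh p) * N (S i, xh p))) j r) +
        ((√(p.1 : ℝ))⁻¹ * ∑ i ∈ Finset.range p.1,
          (A (S i, xh p) * ((W i p.2).1)ᵀ * ((xh p - X₀) * N (S i, xh p))) j r) +
        ((√(p.1 : ℝ))⁻¹ * ∑ i ∈ Finset.range p.1,
          (A (S i, xh p) * (W i p.2).2 * (Zmat (xh p) * N (S i, xh p))) j r) +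
        ((√(p.1 : ℝ))⁻¹ * ∑ i ∈ Finset.range p.1,
          (A (S i, xh p) * lift X₀ * vecMulVec (a₀ i) (a₀ i) *
            ((xh p - X₀) * N (S i, xh p))) j r) = 0 := by
      rw [← mul_add, ← mul_add, ← mul_add, ← Finset.sum_add_distrib, ← Finset.sum_add_distrib,
        ← Finset.sum_add_distrib]
      have e2 := congrFun (congrFun hp.2 j) r
      rw [Matrix.sum_apply, Matrix.zero_apply] at e2
      refine mul_eq_zero_of_right _ (e2.symm.trans ?_).symm
      refine Finset.sum_congr rfl fun i _ => ?_
      rw [score_eq_add (hp.1 i) X₀ (a₀ i) (e i p.2) σsq]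
      simp only [Matrix.add_mul, Matrix.add_apply, A, N, W, Matrix.mul_assoc]
    -- the second term drops out in the limit because of its factor `X₀ - X₀`
    have e3 : (A (Sinf, X₀) * lift X₀ * ((√(p.1 : ℝ))⁻¹ • ∑ i ∈ Finset.range p.1, (W i p.2).1) *
          (Zmat X₀ * N (Sinf, X₀))) j r +
        (A (Sinf, X₀) * ((√(p.1 : ℝ))⁻¹ • ∑ i ∈ Finset.range p.1, ((W i p.2).1)ᵀ) *
          ((X₀ - X₀) * N (Sinf, X₀))) j r +
        (A (Sinf, X₀) * ((√(p.1 : ℝ))⁻¹ • ∑ i ∈ Finset.range p.1, (W i p.2).2) *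
          (Zmat X₀ * N (Sinf, X₀))) j r +
        (A (Sinf, X₀) * lift X₀ * VA * ((√(p.1 : ℝ) • (xh p - X₀)) * N (Sinf, X₀))) j r =
        ((VA * (√(p.1 : ℝ) • (xh p - X₀)) +
          GammaOf Sinf X₀ (normSum a₀ e σsq S p.1 p.2)) * N (Sinf, X₀)) j r := by
      have e4 : A (Sinf, X₀) * lift X₀ = 1 := coefA_mul_lift Sinf X₀
      rw [GammaOf_eq, normSum, Prod.smul_fst, Prod.fst_sum, Prod.smul_snd, Prod.snd_sum]
      change _ = (((VA * (√(p.1 : ℝ) • (xh p - X₀)) + (A (Sinf, X₀) * lift X₀ * _ * Zmat X₀ +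
        A (Sinf, X₀) * _ * Zmat X₀)) * N (Sinf, X₀) : Matrix (Fin n) (Fin d) ℝ)) j r
      rw [e4, sub_self, Matrix.zero_mul, Matrix.mul_zero]
      simp only [Matrix.add_mul, Matrix.add_apply, Matrix.one_mul, Matrix.mul_assoc,
        Matrix.zero_apply, W]
      ring
    rw [← e3]
    linarith [e1]
  have hR : ∀ M : Matrix (Fin n) (Fin d) ℝ,
      M j l = ∑ r, (M * N (Sinf, X₀)) j r * gram Sinf X₀ r l := by
    intro M
    rw [← mul_apply, Matrix.mul_assoc]
    change M j l = (M * ((gram Sinf X₀)⁻¹ * gram Sinf X₀)) j l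
    rw [nonsing_inv_mul _ h.isUnit_gram_inf, Matrix.mul_one]
  refine (IsLittleO.sum fun r (_ : r ∈ Finset.univ) =>
    (key r).const_mul_left (gram Sinf X₀ r l)).congr_left fun p => ?_
  rw [Finset.sum_apply]
  exact (Finset.sum_congr rfl fun r _ => mul_comm _ _).trans (hR _).symm

end Norm

end IsModel

open Asymptotics

/-! ### Asymptotic normality -/

section LimitLaw

variable {n d : ℕ}

lemma map_neg_multivariateGaussian {κ : Type*} [Fintype κ] [DecidableEq κ] {V : Matrix κ κ ℝ}
    (hV : V.PosSemidef) :
    (multivariateGaussian (0 : EuclideanSpace ℝ κ) V).map (fun x => (-1 : ℝ) • x) =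
      multivariateGaussian 0 V := by
  have : IsProbabilityMeasure
      ((multivariateGaussian (0 : EuclideanSpace ℝ κ) V).map (fun x => (-1 : ℝ) • x)) :=
    Measure.isProbabilityMeasure_map (measurable_const_smul (-1 : ℝ)).aemeasurable
  refine Measure.ext_of_charFun (funext fun t => ?_)
  rw [charFun_map_smul, charFun_multivariateGaussian hV, charFun_multivariateGaussian hV]
  simp [mulVec_neg, neg_dotProduct, dotProduct_neg]

lemma TendstoInDistribution.of_map_eq {Ω Ω' Ω'' E : Type*} [MeasurableSpace Ω] {P : Measure Ω}
    [IsProbabilityMeasure P] [MeasurableSpace Ω'] {μ' : Measure Ω'} [IsProbabilityMeasure μ']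
    [MeasurableSpace Ω''] {μ'' : Measure Ω''} [IsProbabilityMeasure μ''] [MeasurableSpace E]
    [TopologicalSpace E] [OpensMeasurableSpace E] {X : ℕ → Ω → E} {Z : Ω' → E} {Z' : Ω'' → E}
    (h : TendstoInDistribution X atTop Z (fun _ => P) μ') (hZ' : AEMeasurable Z' μ'')
    (heq : μ'.map Z = μ''.map Z') : TendstoInDistribution X atTop Z' (fun _ => P) μ'' := by
  refine ⟨h.forall_aemeasurable, hZ', ?_⟩
  have h1 : (⟨μ''.map Z', Measure.isProbabilityMeasure_map hZ'⟩ : ProbabilityMeasure E) =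
      ⟨μ'.map Z, Measure.isProbabilityMeasure_map h.aemeasurable_limit⟩ := Subtype.ext heq.symm
  rw [h1]
  exact h.tendsto

lemma continuous_GammaOf (S : Matrix (Col n d) (Col n d) ℝ) (X : Matrix (Fin n) (Fin d) ℝ) :
    Continuous (GammaOf S X) := by
  unfold GammaOf
  exact ((continuous_fst.matrix_mul continuous_const).add
    ((continuous_const.matrix_mul continuous_snd).matrix_mul continuous_const)).sub
    (continuous_const.matrix_mul
      ((continuous_const.matrix_mul continuous_snd).matrix_mul continuous_const))

lemma GammaOf_smul (S : Matrix (Col n d) (Col n d) ℝ) (X : Matrix (Fin n) (Fin d) ℝ) (t : ℝ)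
    (G : MatPair n d) : GammaOf S X (t • G) = t • GammaOf S X G := by
  simp only [GammaOf, Prod.smul_fst, Prod.smul_snd, Matrix.mul_smul, Matrix.smul_mul, smul_sub,
    smul_add]

lemma continuous_limitMap (VA : Matrix (Fin n) (Fin n) ℝ) (S : Matrix (Col n d) (Col n d) ℝ)
    (X : Matrix (Fin n) (Fin d) ℝ) (u : Fin d → ℝ) :
    Continuous fun G => (VA⁻¹ * GammaOf S X G) *ᵥ u :=
  (continuous_const.matrix_mul (continuous_GammaOf S X)).matrix_mulVec continuous_const

/-- The limit law is symmetric, so that the sign of the limit is immaterial. -/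
lemma map_neg_limitMap {V : Matrix (PairIdx n d) (PairIdx n d) ℝ} (hV : V.PosSemidef)
    (VA : Matrix (Fin n) (Fin n) ℝ) (S : Matrix (Col n d) (Col n d) ℝ)
    (X : Matrix (Fin n) (Fin d) ℝ) (u : Fin d → ℝ) :
    (multivariateGaussian (0 : EuclideanSpace ℝ (PairIdx n d)) V).map
        (fun x => -((VA⁻¹ * GammaOf S X (toPair n d x)) *ᵥ u)) =
      (pairLaw V : Measure (MatPair n d)).map fun G => (VA⁻¹ * GammaOf S X G) *ᵥ u := by
  have hf := (continuous_limitMap VA S X u).measurable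
  have h1 : (fun x => -((VA⁻¹ * GammaOf S X (toPair n d x)) *ᵥ u)) =
      ((fun G => (VA⁻¹ * GammaOf S X G) *ᵥ u) ∘ toPair n d) ∘ fun x => (-1 : ℝ) • x := by
    funext x
    rw [Function.comp_apply, Function.comp_apply, map_smul, GammaOf_smul, Matrix.mul_smul,
      smul_mulVec, neg_one_smul]
  have hcoe : (pairLaw V : Measure (MatPair n d)) =
      (multivariateGaussian (0 : EuclideanSpace ℝ (PairIdx n d)) V).map (toPair n d) := rfl
  rw [h1, ← Measure.map_map (hf.comp measurable_toPair) (measurable_const_smul (-1 : ℝ)),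
    map_neg_multivariateGaussian hV, hcoe, Measure.map_map hf measurable_toPair]

lemma toPair_normSum {Ω : Type*} (a₀ : ℕ → Fin n → ℝ) (e : ℕ → Ω → Col n d → ℝ) (σsq : ℝ)
    (S : ℕ → Matrix (Col n d) (Col n d) ℝ) (m : ℕ) (ω : Ω) : toPair n d (WithLp.toLp 2
    ((√(m : ℝ))⁻¹ • ∑ i ∈ Finset.range m, vecW (a₀ i) (e i ω) σsq (S i))) =
      normSum a₀ e σsq S m ω := by
  rw [WithLp.toLp_smul, WithLp.toLp_sum, map_smul, map_sum, normSum]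
  simp only [toPair_vecW]

lemma measurable_finitePart : @Measurable _ _ (borel _) inferInstance
    (finitePart : OnePoint (Matrix (Fin n) (Fin d) ℝ) → _) := by
  borelize (OnePoint (Matrix (Fin n) (Fin d) ℝ))
  refine measurable_of_isOpen fun U hU => ?_
  have h1 : MeasurableSet ((fun x : Matrix (Fin n) (Fin d) ℝ => OnePoint.some x) '' U) :=
    (OnePoint.isOpenMap_coe U hU).measurableSet
  have h2 : MeasurableSet ({OnePoint.infty} : Set (OnePoint (Matrix (Fin n) (Fin d) ℝ))) :=
    measurableSet_singleton _
  by_cases h0 : (0 : Matrix (Fin n) (Fin d) ℝ) ∈ U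
  · convert h1.union h2 using 1
    ext x
    induction x using OnePoint.rec <;> simp [finitePart, h0]
  · convert h1 using 1
    ext x
    induction x using OnePoint.rec <;> simp [finitePart, h0]

end LimitLaw

namespace IsModel

variable {n d : ℕ} {Ω : Type*} [MeasurableSpace Ω] {P : Measure Ω} {δ ϰ σsq : ℝ}
  {J : Finset (Col n d)} {X₀ : Matrix (Fin n) (Fin d) ℝ} {a₀ : ℕ → Fin n → ℝ}
  {e : ℕ → Ω → Col n d → ℝ} {Sg : ℕ → Matrix J J ℝ} {S : ℕ → Matrix (Col n d) (Col n d) ℝ}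
  {Sginf : Matrix J J ℝ} {Sinf : Matrix (Col n d) (Col n d) ℝ} {VA : Matrix (Fin n) (Fin n) ℝ}
  {μ₄ : Col n d → Col n d → Col n d → Col n d → ℝ}
  (h : IsModel P δ ϰ σsq J X₀ a₀ e Sg S Sginf Sinf VA μ₄)

section Estimator

variable {est : (m : ℕ) → Matrix (Fin m) (Col n d) ℝ → OnePoint (Matrix (Fin n) (Fin d) ℝ)}
  (hest : IsEWTLS J Sg est) {Xhat : ℕ → Ω → OnePoint (Matrix (Fin n) (Fin d) ℝ)}
  (hXhat : ∀ m ω, Xhat m ω = est m (dataMatrix (fun i => trueRow X₀ (a₀ i) + e i ω) m))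
include h hest hXhat

lemma measurable_estimator (m : ℕ) : Measurable fun ω => finitePart (Xhat m ω) := by
  have h1 : Measurable fun ω => dataMatrix (fun i => trueRow X₀ (a₀ i) + e i ω) m :=
    measurable_pi_lambda _ fun i => measurable_pi_lambda _ fun j =>
      (h.error.meas_apply i j).const_add _
  have h2 := (measurable_finitePart.comp (hest.measurable m)).comp h1
  have h3 : (fun ω => finitePart (Xhat m ω)) =
      (finitePart ∘ est m) ∘ fun ω => dataMatrix (fun i => trueRow X₀ (a₀ i) + e i ω) m :=
    funext fun ω => by rw [hXhat]; rfl
  rw [h3]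
  exact h2

end Estimator

variable [IsProbabilityMeasure P]
include h

section Norm

-- the entrywise maximum norm, which induces the product topology
attribute [local instance] Matrix.normedAddCommGroup Matrix.normedSpace

/-- `√m`-consistency, and convergence to zero of the remainder in the linear expansion. -/
theorem tendsto_remainder {xh : ℕ × Ω → Matrix (Fin n) (Fin d) ℝ}
    (hx : Tendsto xh (inProb P) (𝓝 X₀))
    (heq : ∀ᶠ p in inProb P, (∀ i, IsUnit (gram (S i) (xh p)).det) ∧
      ∑ i ∈ Finset.range p.1,
        score (trueRow X₀ (a₀ i) + e i p.2) (S i) (xh p) * (gram (S i) (xh p))⁻¹ = 0) :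
    (∃ k : ℕ → Ω → ℝ, BddInProb P k ∧
      ∀ᶠ p in inProb P, ∀ j l, |√(p.1 : ℝ) * (xh p - X₀) j l| ≤ k p.1 p.2) ∧
    ∀ j l, Tendsto (fun p : ℕ × Ω => (VA * (√(p.1 : ℝ) • (xh p - X₀)) +
      GammaOf Sinf X₀ (normSum a₀ e σsq S p.1 p.2)) j l) (inProb P) (𝓝 0) := by
  let U : ℕ × Ω → Matrix (Fin n) (Fin d) ℝ := fun p => √(p.1 : ℝ) • (xh p - X₀)
  let G : ℕ × Ω → Matrix (Fin n) (Fin d) ℝ := fun p =>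
    GammaOf Sinf X₀ (normSum a₀ e σsq S p.1 p.2)
  let R : ℕ × Ω → Matrix (Fin n) (Fin d) ℝ := fun p => VA * U p + G p
  have hR : ∀ j l, (fun p => R p j l) =o[inProb P] fun p => 1 + √(p.1 : ℝ) * ‖xh p - X₀‖ :=
    fun j l => h.isLittleO_remainder hx heq j l
  have hU : ∀ p, ‖U p‖ = √(p.1 : ℝ) * ‖xh p - X₀‖ := fun p => by
    rw [norm_smul, Real.norm_of_nonneg (Real.sqrt_nonneg _)]
  set c := ∑ j, ∑ k, |VA⁻¹ j k| with hc
  have hc0 : 0 ≤ c := Finset.sum_nonneg fun _ _ => Finset.sum_nonneg fun _ _ => abs_nonneg _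
  -- `U = V_A⁻¹ (R - G)` with `R` negligible relative to `1 + ‖U‖` and `G` tight, so that `U` is tight
  have hbound : ∀ p, ‖U p‖ ≤ c * (∑ j, ∑ l, |R p j l| + ∑ j, ∑ l, |G p j l|) := by
    intro p
    have h1 : U p = VA⁻¹ * (R p - G p) := by
      simp only [R, add_sub_cancel_right]
      rw [← Matrix.mul_assoc, nonsing_inv_mul _ h.isUnit_VA, Matrix.one_mul]
    have hs : ∀ (M : Matrix (Fin n) (Fin d) ℝ) j l, |M j l| ≤ ∑ j, ∑ l, |M j l| := fun M j l =>
      (Finset.single_le_sum (f := fun l => |M j l|) (fun _ _ => abs_nonneg _)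
        (Finset.mem_univ l)).trans (Finset.single_le_sum (f := fun j => ∑ l, |M j l|)
          (fun _ _ => Finset.sum_nonneg fun _ _ => abs_nonneg _) (Finset.mem_univ j))
    have hnn : ∀ M : Matrix (Fin n) (Fin d) ℝ, 0 ≤ ∑ j, ∑ l, |M j l| := fun M =>
      Finset.sum_nonneg fun _ _ => Finset.sum_nonneg fun _ _ => abs_nonneg _
    refine (Matrix.norm_le_iff (mul_nonneg hc0 (add_nonneg (hnn _) (hnn _)))).2 fun j l => ?_
    rw [h1, mul_apply, Real.norm_eq_abs]
    refine (Finset.abs_sum_le_sum_abs _ _).trans ?_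
    calc ∑ k, |VA⁻¹ j k * (R p - G p) k l|
        ≤ ∑ k, |VA⁻¹ j k| * (∑ j, ∑ l, |R p j l| + ∑ j, ∑ l, |G p j l|) := by
          refine Finset.sum_le_sum fun k _ => ?_
          rw [abs_mul, Matrix.sub_apply]
          exact mul_le_mul_of_nonneg_left ((abs_sub _ _).trans
            (add_le_add (hs (R p) k l) (hs (G p) k l))) (abs_nonneg _)
      _ ≤ _ := by
          rw [← Finset.sum_mul]
          refine mul_le_mul_of_nonneg_right ?_ (add_nonneg (hnn _) (hnn _))
          exact Finset.single_le_sum (f := fun j => ∑ k, |VA⁻¹ j k|)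
            (fun _ _ => Finset.sum_nonneg fun _ _ => abs_nonneg _) (Finset.mem_univ j)
  have hρ : (fun p => c * ∑ j, ∑ l, |R p j l|) =o[inProb P]
      fun p => 1 + √(p.1 : ℝ) * ‖xh p - X₀‖ := by
    refine IsLittleO.const_mul_left ?_ c
    refine (IsLittleO.sum fun j (_ : j ∈ Finset.univ) => IsLittleO.sum
      fun l (_ : l ∈ Finset.univ) => (hR j l).abs_left).congr_left fun p => ?_
    simp only [Finset.sum_apply]
  let k : ℕ → Ω → ℝ := fun m ω => 1 + (∑ j, ∑ l, |G (m, ω) j l|) * (2 * c)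
  have hk0 : ∀ m ω, 1 ≤ k m ω := fun m ω => by
    have : 0 ≤ ∑ j, ∑ l, |G (m, ω) j l| :=
      Finset.sum_nonneg fun _ _ => Finset.sum_nonneg fun _ _ => abs_nonneg _
    have h2 : 0 ≤ (∑ j, ∑ l, |G (m, ω) j l|) * (2 * c) := mul_nonneg this (by linarith)
    simp only [k]
    linarith
  have hk : BddInProb P k := by
    refine (bddInProb_const 1).add (BddInProb.mul_const (BddInProb.sum _ fun j _ =>
      BddInProb.sum _ fun l _ => ?_) _)
    exact (h.bddInProb_GammaOf j l).mono fun m ω => by rw [abs_abs]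
  have hle : ∀ᶠ p in inProb P, ‖U p‖ ≤ k p.1 p.2 := by
    filter_upwards [hρ.def (half_pos one_pos)] with p hp
    have h1 := hbound p
    have h2 : 0 ≤ √(p.1 : ℝ) * ‖xh p - X₀‖ := by positivity
    rw [Real.norm_eq_abs, Real.norm_eq_abs, abs_of_nonneg (by linarith : (0 : ℝ) ≤ 1 + _)] at hp
    have h3 := (le_abs_self _).trans hp
    rw [← hU p] at h3
    simp only [k, Prod.mk.eta]
    linarith
  refine ⟨⟨k, hk, hle.mono fun p hp j l => ?_⟩, fun j l => ?_⟩
  · exact (Matrix.norm_entry_le_entrywise_sup_norm (U p)).trans hp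
  · refine tendsto_inProb_of_le_mul_add hk fun ε hε => ⟨fun _ => 0, tendsto_const_nhds, ?_⟩
    filter_upwards [(hR j l).def (half_pos hε), hle] with p hp hp'
    have h2 : 0 ≤ √(p.1 : ℝ) * ‖xh p - X₀‖ := by positivity
    rw [Real.norm_eq_abs, Real.norm_eq_abs, abs_of_nonneg (by linarith : (0 : ℝ) ≤ 1 + _)] at hp
    rw [hU p] at hp'
    have h3 := hk0 p.1 p.2
    rw [abs_of_nonneg (by linarith : 0 ≤ k p.1 p.2), add_zero]
    change |R p j l| ≤ _
    nlinarith

end Norm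

/-- Convergence in law of the normalized sums of the pairs `W_i`. -/
theorem tendstoInDistribution_normSum :
    TendstoInDistribution (normSum a₀ e σsq S) atTop (fun G => G) (fun _ => P)
      (pairLaw (covW σsq Sinf VA μ₄) : Measure (MatPair n d)) := by
  have h1 := h.error.isLyapunovSeq.tendstoInDistribution.continuous_comp (toPair n d).continuous
  have h2 : normSum a₀ e σsq S = fun (m : ℕ) => toPair n d ∘ fun ω => WithLp.toLp 2
      ((√(m : ℝ))⁻¹ • ∑ i ∈ Finset.range m, vecW (a₀ i) (e i ω) σsq (S i)) :=
    funext fun m => funext fun ω => (toPair_normSum a₀ e σsq S m ω).symm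
  rw [h2]
  refine TendstoInDistribution.of_map_eq h1 aemeasurable_id' ?_
  rw [Measure.map_id']
  rfl

/-- A random sequence whose linear expansion has a vanishing remainder is asymptotically normal. -/
theorem tendstoInDistribution_of_remainder {x : ℕ → Ω → Matrix (Fin n) (Fin d) ℝ}
    (hmeas : ∀ m, Measurable (x m))
    (hR : ∀ j l, Tendsto (fun p : ℕ × Ω => (VA * (√(p.1 : ℝ) • (x p.1 p.2 - X₀)) +
      GammaOf Sinf X₀ (normSum a₀ e σsq S p.1 p.2)) j l) (inProb P) (𝓝 0)) (u : Fin d → ℝ) :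
    TendstoInDistribution (fun (m : ℕ) ω => √(m : ℝ) • (x m ω *ᵥ u - X₀ *ᵥ u)) atTop
      (fun G => (VA⁻¹ * GammaOf Sinf X₀ G) *ᵥ u) (fun _ => P)
      (pairLaw (covW σsq Sinf VA μ₄) : Measure (MatPair n d)) := by
  let f : EuclideanSpace ℝ (PairIdx n d) → Fin n → ℝ := fun x =>
    -((VA⁻¹ * GammaOf Sinf X₀ (toPair n d x)) *ᵥ u)
  have hf : Continuous f :=
    ((continuous_limitMap VA Sinf X₀ u).comp (toPair n d).continuous).neg
  have h1 := h.error.isLyapunovSeq.tendstoInDistribution.continuous_comp hf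
  have h2 := TendstoInDistribution.of_map_eq h1
    (continuous_limitMap VA Sinf X₀ u).measurable.aemeasurable
    (map_neg_limitMap h.error.isLyapunovSeq.posSemidef VA Sinf X₀ u)
  refine tendstoInDistribution_of_tendstoInMeasure_sub _ _ h2 ?_ fun m => ?_
  · refine tendstoInMeasure_of_inProb ?_
    have h3 : Tendsto (fun p : ℕ × Ω => VA⁻¹ *ᵥ ((VA * (√(p.1 : ℝ) • (x p.1 p.2 - X₀)) +
        GammaOf Sinf X₀ (normSum a₀ e σsq S p.1 p.2)) *ᵥ u)) (inProb P) (𝓝 0) := by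
      have h4 : Tendsto (fun p : ℕ × Ω => (VA * (√(p.1 : ℝ) • (x p.1 p.2 - X₀)) +
          GammaOf Sinf X₀ (normSum a₀ e σsq S p.1 p.2))) (inProb P) (𝓝 0) :=
        tendsto_pi_nhds.2 fun j => tendsto_pi_nhds.2 fun l => hR j l
      have h5 : Continuous fun M : Matrix (Fin n) (Fin d) ℝ => VA⁻¹ *ᵥ (M *ᵥ u) :=
        continuous_const.matrix_mulVec (continuous_id.matrix_mulVec continuous_const)
      have h6 := (h5.tendsto 0).comp h4
      rw [zero_mulVec, mulVec_zero] at h6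
      exact h6
    refine h3.congr fun p => ?_
    have h7 : f (WithLp.toLp 2 ((√(p.1 : ℝ))⁻¹ •
        ∑ i ∈ Finset.range p.1, vecW (a₀ i) (e i p.2) σsq (S i))) =
        -((VA⁻¹ * GammaOf Sinf X₀ (normSum a₀ e σsq S p.1 p.2)) *ᵥ u) := by
      simp only [f, toPair_normSum]
    simp only [Pi.sub_apply, Function.comp_apply]
    rw [h7, mulVec_mulVec, Matrix.mul_add, ← Matrix.mul_assoc, nonsing_inv_mul _ h.isUnit_VA,
      Matrix.one_mul, add_mulVec, smul_mulVec, sub_mulVec, sub_neg_eq_add]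
  · have h3 : Continuous fun M : Matrix (Fin n) (Fin d) ℝ => √(m : ℝ) • (M *ᵥ u - X₀ *ᵥ u) := by
      have h4 : Continuous fun M : Matrix (Fin n) (Fin d) ℝ => M *ᵥ u :=
        continuous_id.matrix_mulVec continuous_const
      fun_prop
    exact (h3.measurable.comp (hmeas m)).aemeasurable

variable {est : (m : ℕ) → Matrix (Fin m) (Col n d) ℝ → OnePoint (Matrix (Fin n) (Fin d) ℝ)}
  (hest : IsEWTLS J Sg est) {Xhat : ℕ → Ω → OnePoint (Matrix (Fin n) (Fin d) ℝ)}
  (hXhat : ∀ m ω, Xhat m ω = est m (dataMatrix (fun i => trueRow X₀ (a₀ i) + e i ω) m))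
include hest hXhat

lemma eventually_estimating_equation : ∀ᶠ p in inProb P,
    (∀ i, IsUnit (gram (S i) (finitePart (Xhat p.1 p.2))).det) ∧
      ∑ i ∈ Finset.range p.1, score (trueRow X₀ (a₀ i) + e i p.2) (S i)
        (finitePart (Xhat p.1 p.2)) * (gram (S i) (finitePart (Xhat p.1 p.2)))⁻¹ = 0 := by
  filter_upwards [h.eventually_isSolution hest hXhat] with p hp
  refine ⟨fun i => ((h.weight i).rank_iff _).1 ((isSolution_iff h.weight).1 hp.2).1, ?_⟩
  have h1 := sum_score_mul_inv_gram_eq_zero h.weight hp.2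
  rw [← Fin.sum_univ_eq_sum_range (fun i => score (trueRow X₀ (a₀ i) + e i p.2) (S i)
    (finitePart (Xhat p.1 p.2)) * (gram (S i) (finitePart (Xhat p.1 p.2)))⁻¹)]
  exact h1

end IsModel

/-! ### Triangular arrays that are negligible in mean square -/

section Negligible

lemma avg_sq_nonneg {Ω : Type*} (D : ℕ → ℕ × Ω → ℝ) (p : ℕ × Ω) :
    0 ≤ (p.1 : ℝ)⁻¹ * ∑ i ∈ Finset.range p.1, D i p ^ 2 :=
  mul_nonneg (by positivity) (Finset.sum_nonneg fun _ _ => sq_nonneg _)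

variable {Ω : Type*} [MeasurableSpace Ω] {P : Measure Ω}

/-- The averages of `D i p ^ 2` over `i < m` converge to zero in probability, where
`p = (m, ω)`. -/
def NegligibleSq (P : Measure Ω) (D : ℕ → ℕ × Ω → ℝ) : Prop :=
  Tendsto (fun p : ℕ × Ω => (p.1 : ℝ)⁻¹ * ∑ i ∈ Finset.range p.1, D i p ^ 2) (inProb P) (𝓝 0)

lemma NegligibleSq.add {D D' : ℕ → ℕ × Ω → ℝ} (hD : NegligibleSq P D) (hD' : NegligibleSq P D') :
    NegligibleSq P fun i p => D i p + D' i p := by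
  have h1 := (hD.const_mul 2).add (hD'.const_mul 2)
  rw [mul_zero, add_zero] at h1
  refine squeeze_zero (fun p => avg_sq_nonneg (fun i p => D i p + D' i p) p) (fun p => ?_) h1
  have h2 : 2 * ((p.1 : ℝ)⁻¹ * ∑ i ∈ Finset.range p.1, D i p ^ 2) +
      2 * ((p.1 : ℝ)⁻¹ * ∑ i ∈ Finset.range p.1, D' i p ^ 2) =
      (p.1 : ℝ)⁻¹ * ∑ i ∈ Finset.range p.1, (2 * D i p ^ 2 + 2 * D' i p ^ 2) := by
    rw [Finset.sum_add_distrib, ← Finset.mul_sum, ← Finset.mul_sum]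
    ring
  rw [h2]
  refine mul_le_mul_of_nonneg_left (Finset.sum_le_sum fun i _ => ?_) (by positivity)
  nlinarith [sq_nonneg (D i p - D' i p)]

lemma NegligibleSq.zero : NegligibleSq P fun _ _ => 0 := by
  unfold NegligibleSq
  simpa using tendsto_const_nhds

lemma NegligibleSq.sum {ι : Type*} (s : Finset ι) {D : ι → ℕ → ℕ × Ω → ℝ}
    (hD : ∀ k ∈ s, NegligibleSq P (D k)) : NegligibleSq P fun i p => ∑ k ∈ s, D k i p := by
  classical
  induction s using Finset.induction_on with
  | empty => simpa using NegligibleSq.zero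
  | insert k s hk ih =>
    simp only [Finset.sum_insert hk]
    exact (hD k (Finset.mem_insert_self k s)).add
      (ih fun l hl => hD l (Finset.mem_insert_of_mem hl))

lemma NegligibleSq.congr' {D D' : ℕ → ℕ × Ω → ℝ} (hD : NegligibleSq P D)
    (h : ∀ᶠ p in inProb P, ∀ i, D i p = D' i p) : NegligibleSq P D' := by
  refine Tendsto.congr' ?_ hD
  filter_upwards [h] with p hp
  simp only [hp]

lemma tendsto_avg_mul_of_negligibleSq {D q : ℕ → ℕ × Ω → ℝ} (hD : NegligibleSq P D) {l : ℝ}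
    (hq : Tendsto (fun p : ℕ × Ω => (p.1 : ℝ)⁻¹ * ∑ i ∈ Finset.range p.1, q i p ^ 2)
      (inProb P) (𝓝 l)) :
    Tendsto (fun p : ℕ × Ω => (p.1 : ℝ)⁻¹ * ∑ i ∈ Finset.range p.1, D i p * q i p)
      (inProb P) (𝓝 0) := by
  have h1 := (hD.mul hq).sqrt
  rw [zero_mul, Real.sqrt_zero] at h1
  refine squeeze_zero_norm (fun p => ?_) h1
  rw [Real.norm_eq_abs]
  refine Real.abs_le_sqrt ?_
  rw [mul_pow, mul_mul_mul_comm, ← pow_two]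
  exact mul_le_mul_of_nonneg_left (Finset.sum_mul_sq_le_sq_mul_sq _ _ _) (by positivity)

/-- Averages of products are insensitive to perturbations that are negligible in mean square. -/
lemma tendsto_avg_mul_of_sub_negligibleSq {x y q r : ℕ → ℕ × Ω → ℝ}
    (hx : NegligibleSq P fun i p => x i p - q i p) (hy : NegligibleSq P fun i p => y i p - r i p)
    {l₁ l₂ l : ℝ}
    (hq : Tendsto (fun p : ℕ × Ω => (p.1 : ℝ)⁻¹ * ∑ i ∈ Finset.range p.1, q i p ^ 2)
      (inProb P) (𝓝 l₁))
    (hr : Tendsto (fun p : ℕ × Ω => (p.1 : ℝ)⁻¹ * ∑ i ∈ Finset.range p.1, r i p ^ 2)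
      (inProb P) (𝓝 l₂))
    (hqr : Tendsto (fun p : ℕ × Ω => (p.1 : ℝ)⁻¹ * ∑ i ∈ Finset.range p.1, q i p * r i p)
      (inProb P) (𝓝 l)) :
    Tendsto (fun p : ℕ × Ω => (p.1 : ℝ)⁻¹ * ∑ i ∈ Finset.range p.1, x i p * y i p)
      (inProb P) (𝓝 l) := by
  have h1 := ((tendsto_avg_mul_of_negligibleSq hx hy).add
    (tendsto_avg_mul_of_negligibleSq hx hr)).add
      ((tendsto_avg_mul_of_negligibleSq hy hq).add hqr)
  rw [zero_add, zero_add, zero_add] at h1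
  refine h1.congr fun p => ?_
  rw [← mul_add, ← mul_add, ← mul_add, ← Finset.sum_add_distrib, ← Finset.sum_add_distrib,
    ← Finset.sum_add_distrib]
  exact congrArg _ (Finset.sum_congr rfl fun i _ => by ring)

variable [IsProbabilityMeasure P] {E F : Type*} [TopologicalSpace E] [TopologicalSpace F]
  {g : E × F → ℝ} {s : ℕ → E} {sinf : E} {x₀ : F}

/-- In mean square, continuous weights `g (s i, x̂)` at a consistent estimator `x̂` may be replaced
by their limit. -/
lemma negligibleSq_weight (hg : ContinuousAt g (sinf, x₀)) (hgi : ∀ i, ContinuousAt g (s i, x₀))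
    (hs : Tendsto s atTop (𝓝 sinf)) {w : ℕ → Ω → ℝ} (hw : IsCenteredSeq P w) {xh : ℕ × Ω → F}
    (hx : Tendsto xh (inProb P) (𝓝 x₀)) :
    NegligibleSq P fun i p => w i p.2 * (g (s i, xh p) - g (sinf, x₀)) := by
  obtain ⟨C, hC⟩ := hw.bdd
  have hg' : ContinuousAt (fun y => (g y - g (sinf, x₀)) ^ 2) (sinf, x₀) :=
    (hg.sub continuousAt_const).pow 2
  have h1 := tendsto_avg_weight_sub (P := P) (g := fun i x => (g (s i, x) - g (sinf, x₀)) ^ 2)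
    (tendsto_weight (g := fun y => (g y - g (sinf, x₀)) ^ 2) hg' hs)
    (fun i => exists_eventually_weight_le (g := fun y => (g y - g (sinf, x₀)) ^ 2)
      (((hgi i).sub continuousAt_const).pow 2))
    (v := fun i ω => w i ω ^ 2) (fun i => (hw.memLp i).integrable_sq) (C := C)
    (by simpa using hC) hx
  refine h1.congr fun p => ?_
  simp only [sub_self, ne_eq, OfNat.ofNat_ne_zero, not_false_eq_true, zero_pow, sub_zero, mul_pow]

end Negligible

/-! ### Consistency of the sandwich estimator -/

section Coefficients

variable {n d : ℕ}

lemma mul_mul_mulVec_apply {ι α β κ : Type*} [Fintype α] [Fintype β] [Fintype κ]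
    (A : Matrix ι α ℝ) (W : Matrix α β ℝ) (B : Matrix β κ ℝ) (u : κ → ℝ) (j : ι) :
    ((A * W * B) *ᵥ u) j = ∑ k, ∑ k', W k k' * (A j k * (B *ᵥ u) k') := by
  rw [← mulVec_mulVec, ← mulVec_mulVec]
  simp only [mulVec, dotProduct, Finset.mul_sum]
  refine Finset.sum_congr rfl fun k _ => Finset.sum_congr rfl fun k' _ =>
    Finset.sum_congr rfl fun l _ => by ring

/-- The coefficients of the linear map `G ↦ Γ(X) u` in the entries of `G`. -/
def gammaCoef (S : Matrix (Col n d) (Col n d) ℝ) (X : Matrix (Fin n) (Fin d) ℝ) (u : Fin d → ℝ) :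
    Matrix (Fin n) (PairIdx n d) ℝ :=
  of fun j => Sum.elim (fun p => (coefA S X * lift X) j p.1 * (Zmat X *ᵥ u) p.2)
    fun p => coefA S X j p.1 * (Zmat X *ᵥ u) p.2

lemma GammaOf_mulVec_toPair (S : Matrix (Col n d) (Col n d) ℝ) (X : Matrix (Fin n) (Fin d) ℝ)
    (u : Fin d → ℝ) (x : EuclideanSpace ℝ (PairIdx n d)) (j : Fin n) :
    (GammaOf S X (toPair n d x) *ᵥ u) j = ∑ k, gammaCoef S X u j k * x k := by
  rw [GammaOf_eq, add_mulVec, Pi.add_apply, mul_mul_mulVec_apply, mul_mul_mulVec_apply]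
  conv_rhs => rw [Fintype.sum_sum_type, Fintype.sum_prod_type, Fintype.sum_prod_type]
  congr 1 <;>
  exact Finset.sum_congr rfl fun k _ => Finset.sum_congr rfl fun k' _ => mul_comm _ _

lemma GammaOf_mulVec_pairW (S : Matrix (Col n d) (Col n d) ℝ) (X : Matrix (Fin n) (Fin d) ℝ)
    (u : Fin d → ℝ) (a : Fin n → ℝ) (e : Col n d → ℝ) (σsq : ℝ)
    (S' : Matrix (Col n d) (Col n d) ℝ) (j : Fin n) :
    (GammaOf S X (pairW a e σsq S') *ᵥ u) j = ∑ k, gammaCoef S X u j k * vecW a e σsq S' k := by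
  rw [← toPair_vecW, GammaOf_mulVec_toPair]

lemma avg_apply {ι κ : Type*} (M : ℕ → Matrix ι κ ℝ) (m : ℕ) (j : ι) (k : κ) :
    avg M m j k = (m : ℝ)⁻¹ * ∑ i ∈ Finset.range m, M i j k := by
  rw [avg, Matrix.smul_apply, Matrix.sum_apply, smul_eq_mul]

end Coefficients

/-- Lyapunov's condition on the regressors makes the averaged fourth powers of the regressors `o(m)`. -/
lemma IsErrorModel.tendsto_regressor_four {n d : ℕ} {Ω : Type*} [MeasurableSpace Ω] {P : Measure Ω}
    {δ : ℝ} {a₀ : ℕ → Fin n → ℝ} {e : ℕ → Ω → Col n d → ℝ} {σsq : ℝ}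
    {S : ℕ → Matrix (Col n d) (Col n d) ℝ} {Sinf : Matrix (Col n d) (Col n d) ℝ}
    {VA : Matrix (Fin n) (Fin n) ℝ} {μ₄ : Col n d → Col n d → Col n d → Col n d → ℝ}
    (h : IsErrorModel P δ a₀ e σsq S Sinf VA μ₄) (k k' : Fin n) :
    Tendsto (fun m : ℕ => (m : ℝ)⁻¹ * ((m : ℝ)⁻¹ *
      ∑ i ∈ Finset.range m, (a₀ i k * a₀ i k') ^ 2)) atTop (𝓝 0) := by
  obtain ⟨C, hC⟩ := h.exists_avg_regressor_sq_le
  have hδ := h.pos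
  have hC0 : 0 ≤ C := (hC 0).trans' (by simp)
  rw [Metric.tendsto_nhds]
  intro η hη
  set ε := η / (C + 1) with hε
  have hε0 : 0 < ε := by positivity
  filter_upwards [h.lyapunov.eventually_le_const (Real.rpow_pos_of_pos hε0 (1 + δ / 2)),
    eventually_gt_atTop 0] with m hm hm0
  have hm0' : (0 : ℝ) < m := Nat.cast_pos.2 hm0
  have hmax : ∀ i ∈ Finset.range m, a₀ i k ^ 2 ≤ ε * m := by
    intro i hi
    have h1 : |a₀ i k| ^ (2 + δ) ≤ (ε * m) ^ (1 + δ / 2) := by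
      rw [inv_mul_le_iff₀ (Real.rpow_pos_of_pos hm0' _)] at hm
      rw [Real.mul_rpow hε0.le hm0'.le, mul_comm]
      exact ((h.abs_regressor_rpow_le i k).trans (Finset.single_le_sum
        (f := fun i => ‖WithLp.toLp 2 (a₀ i)‖ ^ (2 + δ)) (fun _ _ => by positivity) hi)).trans hm
    have h2 : |a₀ i k| ^ (2 + δ) = (a₀ i k ^ 2) ^ (1 + δ / 2) := by
      rw [← sq_abs, ← Real.rpow_natCast, ← Real.rpow_mul (abs_nonneg _)]
      congr 1
      push_cast
      ring
    rw [h2] at h1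
    exact (Real.rpow_le_rpow_iff (sq_nonneg _) (by positivity) (by positivity)).1 h1
  have hnn : 0 ≤ (m : ℝ)⁻¹ * ((m : ℝ)⁻¹ * ∑ i ∈ Finset.range m, (a₀ i k * a₀ i k') ^ 2) :=
    mul_nonneg (by positivity) (mul_nonneg (by positivity)
      (Finset.sum_nonneg fun _ _ => sq_nonneg _))
  rw [dist_zero_right, Real.norm_of_nonneg hnn]
  have h1 : ∑ i ∈ Finset.range m, (a₀ i k * a₀ i k') ^ 2 ≤
      ∑ i ∈ Finset.range m, ε * m * ∑ j, a₀ i j ^ 2 := by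
    refine Finset.sum_le_sum fun i hi => ?_
    rw [mul_pow]
    exact mul_le_mul (hmax i hi) (Finset.single_le_sum (f := fun j => a₀ i j ^ 2)
      (fun _ _ => sq_nonneg _) (Finset.mem_univ k')) (sq_nonneg _) (by positivity)
  calc (m : ℝ)⁻¹ * ((m : ℝ)⁻¹ * ∑ i ∈ Finset.range m, (a₀ i k * a₀ i k') ^ 2)
      ≤ (m : ℝ)⁻¹ * ((m : ℝ)⁻¹ * ∑ i ∈ Finset.range m, ε * m * ∑ j, a₀ i j ^ 2) := by gcongr
    _ = ε * ((m : ℝ)⁻¹ * ∑ i ∈ Finset.range m, ∑ j, a₀ i j ^ 2) := by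
        rw [← Finset.mul_sum]
        field_simp
    _ ≤ ε * C := mul_le_mul_of_nonneg_left (hC m) hε0.le
    _ < η := by
        rw [hε, div_mul_eq_mul_div, div_lt_iff₀ (by linarith)]
        nlinarith

namespace IsModel

variable {n d : ℕ} {Ω : Type*} [MeasurableSpace Ω] {P : Measure Ω} {δ ϰ σsq : ℝ}
  {J : Finset (Col n d)} {X₀ : Matrix (Fin n) (Fin d) ℝ} {a₀ : ℕ → Fin n → ℝ}
  {e : ℕ → Ω → Col n d → ℝ} {Sg : ℕ → Matrix J J ℝ} {S : ℕ → Matrix (Col n d) (Col n d) ℝ}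
  {Sginf : Matrix J J ℝ} {Sinf : Matrix (Col n d) (Col n d) ℝ} {VA : Matrix (Fin n) (Fin n) ℝ}
  {μ₄ : Col n d → Col n d → Col n d → Col n d → ℝ}
  (h : IsModel P δ ϰ σsq J X₀ a₀ e Sg S Sginf Sinf VA μ₄)
include h

lemma tendsto_avg_S : Tendsto (avg S) atTop (𝓝 Sinf) :=
  tendsto_pi_nhds.2 fun j => tendsto_pi_nhds.2 fun k =>
    (tendsto_avg_of_tendsto (h.error.tendsto_S j k)).congr fun m => (avg_apply S m j k).symm

lemma tendsto_gram_avg {xh : ℕ × Ω → Matrix (Fin n) (Fin d) ℝ}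
    (hx : Tendsto xh (inProb P) (𝓝 X₀)) : Tendsto (fun p => gram (avg S p.1) (xh p)) (inProb P)
    (𝓝 (gram Sinf X₀)) := by
  have h1 : Continuous fun q : Matrix (Col n d) (Col n d) ℝ × Matrix (Fin n) (Fin d) ℝ =>
      gram q.1 q.2 :=
    ((continuous_Zmat.comp continuous_snd).matrix_transpose.matrix_mul continuous_fst).matrix_mul
      (continuous_Zmat.comp continuous_snd)
  exact Tendsto.comp (g := fun q : Matrix (Col n d) (Col n d) ℝ × Matrix (Fin n) (Fin d) ℝ =>
    gram q.1 q.2) (f := fun p : ℕ × Ω => (avg S p.1, xh p)) (h1.tendsto (Sinf, X₀))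
    ((h.tendsto_avg_S.comp tendsto_fst_inProb).prodMk_nhds hx)

/-- The contribution of the drift term to the sandwich estimator is negligible. -/
lemma negligibleSq_drift {g : Matrix (Col n d) (Col n d) ℝ × Matrix (Fin n) (Fin d) ℝ → ℝ}
    (hg : ContinuousAt g (Sinf, X₀)) (hgi : ∀ i, ContinuousAt g (S i, X₀))
    {xh : ℕ × Ω → Matrix (Fin n) (Fin d) ℝ} (hx : Tendsto xh (inProb P) (𝓝 X₀))
    {r : ℕ × Ω → ℝ} {k : ℕ → Ω → ℝ} (hk : BddInProb P k)
    (hr : ∀ᶠ p in inProb P, |√(p.1 : ℝ) * r p| ≤ k p.1 p.2) (j l : Fin n) :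
    NegligibleSq P fun i p => a₀ i j * a₀ i l * (g (S i, xh p) * r p) := by
  obtain ⟨B, hB⟩ := eventually_forall_abs_le (φ := fun i x => g (S i, x))
    (tendsto_weight hg h.tendsto_S) fun i => exists_eventually_weight_le (hgi i)
  have h1 := (h.error.tendsto_regressor_four j l).comp (tendsto_fst_inProb (P := P))
  have h2 := hk.tendsto_mul (hk.tendsto_mul h1)
  have h3 := h2.const_mul (B ^ 2)
  rw [mul_zero] at h3
  refine squeeze_zero' (Eventually.of_forall fun p => avg_sq_nonneg
    (fun i p => a₀ i j * a₀ i l * (g (S i, xh p) * r p)) p) ?_ h3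
  filter_upwards [hr, hx.eventually hB] with p hp hb
  have hm : ((p.1 : ℝ)⁻¹ * √(p.1 : ℝ) ^ 2) * (p.1 : ℝ)⁻¹ = (p.1 : ℝ)⁻¹ := by
    rw [Real.sq_sqrt (Nat.cast_nonneg _)]
    rcases Nat.eq_zero_or_pos p.1 with h0 | h0
    · simp [h0]
    · field_simp
  -- `r² = O_p(1 / m)` is balanced against the averaged fourth powers, which are `o(m)`
  have h4 : (√(p.1 : ℝ) * r p) ^ 2 ≤ k p.1 p.2 * k p.1 p.2 := by
    rw [← pow_two]
    exact sq_le_sq' (by linarith [neg_abs_le (√(p.1 : ℝ) * r p)]) ((le_abs_self _).trans hp)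
  calc (p.1 : ℝ)⁻¹ * ∑ i ∈ Finset.range p.1, (a₀ i j * a₀ i l * (g (S i, xh p) * r p)) ^ 2
      ≤ (p.1 : ℝ)⁻¹ * ∑ i ∈ Finset.range p.1, B ^ 2 * r p ^ 2 * (a₀ i j * a₀ i l) ^ 2 := by
        refine mul_le_mul_of_nonneg_left (Finset.sum_le_sum fun i _ => ?_) (by positivity)
        have h5 : g (S i, xh p) ^ 2 ≤ B ^ 2 :=
          sq_le_sq' (by linarith only [neg_abs_le (g (S i, xh p)), hb i]) ((le_abs_self _).trans (hb i))
        have h6 := mul_le_mul_of_nonneg_right h5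
          (mul_nonneg (sq_nonneg (r p)) (sq_nonneg (a₀ i j * a₀ i l)))
        nlinarith
    _ = B ^ 2 * ((p.1 : ℝ)⁻¹ * ((p.1 : ℝ)⁻¹ * ∑ i ∈ Finset.range p.1, (a₀ i j * a₀ i l) ^ 2) *
          (√(p.1 : ℝ) * r p) ^ 2) := by
        rw [← Finset.mul_sum]
        nth_rewrite 1 [← hm]
        ring
    _ ≤ B ^ 2 * ((p.1 : ℝ)⁻¹ * ((p.1 : ℝ)⁻¹ * ∑ i ∈ Finset.range p.1, (a₀ i j * a₀ i l) ^ 2) *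
          (k p.1 p.2 * k p.1 p.2)) := by
        refine mul_le_mul_of_nonneg_left (mul_le_mul_of_nonneg_left h4 ?_) (sq_nonneg _)
        exact mul_nonneg (by positivity) (mul_nonneg (by positivity)
          (Finset.sum_nonneg fun _ _ => sq_nonneg _))
    _ = _ := by
        simp only [Function.comp_apply]
        ring

variable [IsProbabilityMeasure P]

lemma tendsto_avg_row : Tendsto (fun p : ℕ × Ω => avg (fun i =>
    vecMulVec (trueRow X₀ (a₀ i) + e i p.2) (trueRow X₀ (a₀ i) + e i p.2)) p.1) (inProb P)
    (𝓝 (rowLimit σsq X₀ VA Sinf)) :=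
  tendsto_pi_nhds.2 fun j => tendsto_pi_nhds.2 fun k =>
    (h.tendsto_avg_row_mul j k).congr fun p => by
      rw [avg_apply]
      rfl

section Estimate

variable {xh : ℕ × Ω → Matrix (Fin n) (Fin d) ℝ} (hx : Tendsto xh (inProb P) (𝓝 X₀))
include hx

/-- Consistency of `σ̂²`. -/
lemma tendsto_sigmaSqHat (hd : d ≠ 0) : Tendsto (fun p : ℕ × Ω =>
    sigmaSqHat (fun i => trueRow X₀ (a₀ i) + e i p.2) S p.1 (xh p)) (inProb P) (𝓝 σsq) := by
  have h1 : Continuous fun q : (Matrix (Fin n) (Fin d) ℝ × Matrix (Col n d) (Col n d) ℝ) ×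
      Matrix (Fin d) (Fin d) ℝ =>
      (d : ℝ)⁻¹ * trace (((Zmat q.1.1)ᵀ * q.1.2 * Zmat q.1.1) * q.2) := by
    have hZ : Continuous fun q : (Matrix (Fin n) (Fin d) ℝ × Matrix (Col n d) (Col n d) ℝ) ×
        Matrix (Fin d) (Fin d) ℝ => Zmat q.1.1 :=
      continuous_Zmat.comp (continuous_fst.comp continuous_fst)
    exact continuous_const.mul ((((hZ.matrix_transpose.matrix_mul
      (continuous_snd.comp continuous_fst)).matrix_mul hZ).matrix_mul continuous_snd).matrix_trace)
  have h2 := tendsto_inv_gram (h.tendsto_avg_S.comp (tendsto_fst_inProb (P := P))) hx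
    h.isUnit_gram_inf
  have h3 := Tendsto.comp (g := fun q : (Matrix (Fin n) (Fin d) ℝ ×
      Matrix (Col n d) (Col n d) ℝ) × Matrix (Fin d) (Fin d) ℝ =>
      (d : ℝ)⁻¹ * trace (((Zmat q.1.1)ᵀ * q.1.2 * Zmat q.1.1) * q.2))
    (h1.tendsto ((X₀, rowLimit σsq X₀ VA Sinf), (gram Sinf X₀)⁻¹))
    ((hx.prodMk_nhds h.tendsto_avg_row).prodMk_nhds h2)
  have h4 : (Zmat X₀)ᵀ * rowLimit σsq X₀ VA Sinf * Zmat X₀ = σsq • gram Sinf X₀ := by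
    rw [rowLimit, Matrix.mul_add, Matrix.add_mul, Matrix.mul_smul, Matrix.smul_mul]
    have h5 : (Zmat X₀)ᵀ * (lift X₀ * VA * (lift X₀)ᵀ) * Zmat X₀ = 0 := by
      simp only [Matrix.mul_assoc, lift_transpose_mul_Zmat, sub_self, Matrix.mul_zero]
    rw [h5, zero_add]
    rfl
  have h5 : (d : ℝ)⁻¹ * trace ((Zmat X₀)ᵀ * rowLimit σsq X₀ VA Sinf * Zmat X₀ *
      (gram Sinf X₀)⁻¹) = σsq := by
    rw [h4, Matrix.smul_mul, mul_nonsing_inv _ h.isUnit_gram_inf, trace_smul, trace_one,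
      Fintype.card_fin, smul_eq_mul]
    field_simp
  rw [← h5]
  exact h3

/-- Consistency of `V̂_A`. -/
lemma tendsto_VHat (hd : d ≠ 0) : Tendsto (fun p : ℕ × Ω =>
    VHat (fun i => trueRow X₀ (a₀ i) + e i p.2) S p.1 (xh p)) (inProb P) (𝓝 VA) := by
  refine tendsto_pi_nhds.2 fun j => tendsto_pi_nhds.2 fun k => ?_
  have h1 := (h.tendsto_avg_row_mul (Sum.inl j) (Sum.inl k)).sub
    ((h.tendsto_sigmaSqHat hx hd).mul ((tendsto_pi_nhds.1 (tendsto_pi_nhds.1 h.tendsto_avg_S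
      (Sum.inl j)) (Sum.inl k)).comp (tendsto_fst_inProb (P := P))))
  have h2 : rowLimit σsq X₀ VA Sinf (Sum.inl j) (Sum.inl k) -
      σsq * Sinf (Sum.inl j) (Sum.inl k) = VA j k := by
    have h3 : (lift X₀ * VA * (lift X₀)ᵀ) (Sum.inl j) (Sum.inl k) = VA j k := by
      rw [lift, fromRows_mul, transpose_fromRows, fromRows_mul_fromCols, fromBlocks_apply₁₁,
        transpose_one, Matrix.one_mul, Matrix.mul_one]
    rw [rowLimit, Matrix.add_apply, h3, Matrix.smul_apply, smul_eq_mul, add_sub_cancel_right]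
  rw [h2] at h1
  refine h1.congr fun p => ?_
  rw [VHat, Matrix.sub_apply, Matrix.smul_apply, avg_apply]
  rfl

end Estimate

/-- The averaged products of the terms of the limiting linear form converge to its covariances. -/
lemma tendsto_avg_Gamma_mul (u : Fin d → ℝ) (j k : Fin n) :
    Tendsto (fun p : ℕ × Ω => (p.1 : ℝ)⁻¹ * ∑ i ∈ Finset.range p.1,
      (GammaOf Sinf X₀ (pairW (a₀ i) (e i p.2) σsq (S i)) *ᵥ u) j *
        (GammaOf Sinf X₀ (pairW (a₀ i) (e i p.2) σsq (S i)) *ᵥ u) k) (inProb P)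
      (𝓝 ((gammaCoef Sinf X₀ u * covW σsq Sinf VA μ₄ * (gammaCoef Sinf X₀ u)ᵀ) j k)) := by
  have h1 := tendsto_avg_sum (F := inProb P) (f := fun (q : PairIdx n d × PairIdx n d) i ω =>
      vecW (a₀ i) (e i ω) σsq (S i) q.1 * vecW (a₀ i) (e i ω) σsq (S i) q.2)
    (fun q => gammaCoef Sinf X₀ u j q.1 * gammaCoef Sinf X₀ u k q.2)
    fun q => h.error.isLyapunovSeq.tendsto_avg_mul q.1 q.2
  have h2 : ∑ q : PairIdx n d × PairIdx n d, gammaCoef Sinf X₀ u j q.1 *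
      gammaCoef Sinf X₀ u k q.2 * covW σsq Sinf VA μ₄ q.1 q.2 =
      (gammaCoef Sinf X₀ u * covW σsq Sinf VA μ₄ * (gammaCoef Sinf X₀ u)ᵀ) j k := by
    rw [mul_mul_apply_eq_sum, Fintype.sum_prod_type]
    exact Finset.sum_congr rfl fun s _ => Finset.sum_congr rfl fun t _ => mul_comm _ _
  rw [h2] at h1
  refine h1.congr fun p => congrArg _ (Finset.sum_congr rfl fun i _ => ?_)
  rw [GammaOf_mulVec_pairW, GammaOf_mulVec_pairW, Finset.sum_mul_sum, Fintype.sum_prod_type]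
  exact Finset.sum_congr rfl fun s _ => Finset.sum_congr rfl fun t _ => by ring

section Norm

-- the entrywise maximum norm, which induces the product topology
attribute [local instance] Matrix.normedAddCommGroup Matrix.normedSpace

/-- The estimated scores are close, in mean square, to the terms of the limiting linear form. -/
theorem negligibleSq_score {xh : ℕ × Ω → Matrix (Fin n) (Fin d) ℝ}
    (hx : Tendsto xh (inProb P) (𝓝 X₀))
    (hdet : ∀ᶠ p in inProb P, ∀ i, IsUnit (gram (S i) (xh p)).det)
    (hk : ∃ k : ℕ → Ω → ℝ, BddInProb P k ∧
      ∀ᶠ p in inProb P, ∀ j l, |√(p.1 : ℝ) * (xh p - X₀) j l| ≤ k p.1 p.2)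
    (u : Fin d → ℝ) (j : Fin n) :
    NegligibleSq P fun i p => (score (trueRow X₀ (a₀ i) + e i p.2) (S i) (xh p) *ᵥ u) j -
      (GammaOf Sinf X₀ (pairW (a₀ i) (e i p.2) σsq (S i)) *ᵥ u) j := by
  obtain ⟨k, hk, hkb⟩ := hk
  let A : Matrix (Col n d) (Col n d) ℝ × Matrix (Fin n) (Fin d) ℝ → Matrix (Fin n) (Col n d) ℝ :=
    fun y => coefA y.1 y.2
  have hA : SmoothAt A (Sinf, X₀) := smoothAt_coefA h.isUnit_gram_inf
  have hAi : ∀ i, SmoothAt A (S i, X₀) := fun i => smoothAt_coefA (h.isUnit_gram i)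
  have hAL : SmoothAt (fun y => A y * lift X₀) (Sinf, X₀) := hA.mul (smoothAt_const _ _)
  have hALi : ∀ i, SmoothAt (fun y => A y * lift X₀) (S i, X₀) := fun i =>
    (hAi i).mul (smoothAt_const _ _)
  have hZ : ∀ (t : Matrix (Col n d) (Col n d) ℝ) (l : Col n d),
      ContinuousAt (fun y : Matrix (Col n d) (Col n d) ℝ × Matrix (Fin n) (Fin d) ℝ =>
        (Zmat y.2 *ᵥ u) l) (t, X₀) := fun t l =>
    ((continuous_apply l).comp ((continuous_Zmat.comp continuous_snd).matrix_mulVec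
      continuous_const)).continuousAt
  have hD : ∀ (t : Matrix (Col n d) (Col n d) ℝ) (l : Fin n),
      ContinuousAt (fun y : Matrix (Col n d) (Col n d) ℝ × Matrix (Fin n) (Fin d) ℝ =>
        ((y.2 - X₀) *ᵥ u) l) (t, X₀) := fun t l =>
    ((continuous_apply l).comp ((continuous_snd.sub continuous_const).matrix_mulVec
      continuous_const)).continuousAt
  have t1 := NegligibleSq.sum Finset.univ fun s (_ : s ∈ Finset.univ) =>
    NegligibleSq.sum Finset.univ fun t (_ : t ∈ Finset.univ) =>
    negligibleSq_weight (g := fun y => (A y * lift X₀) j s * (Zmat y.2 *ᵥ u) t)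
      ((hAL j s).continuousAt.mul (hZ _ t)) (fun i => (hALi i j s).continuousAt.mul (hZ _ t))
      h.tendsto_S (h.isCenteredSeq_fst s t) hx
  have t2 := NegligibleSq.sum Finset.univ fun s (_ : s ∈ Finset.univ) =>
    NegligibleSq.sum Finset.univ fun t (_ : t ∈ Finset.univ) =>
    negligibleSq_weight (g := fun y => A y j s * ((y.2 - X₀) *ᵥ u) t)
      ((hA j s).continuousAt.mul (hD _ t)) (fun i => (hAi i j s).continuousAt.mul (hD _ t))
      h.tendsto_S (h.isCenteredSeq_fst t s) hx
  have t3 := NegligibleSq.sum Finset.univ fun s (_ : s ∈ Finset.univ) =>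
    NegligibleSq.sum Finset.univ fun t (_ : t ∈ Finset.univ) =>
    negligibleSq_weight (g := fun y => A y j s * (Zmat y.2 *ᵥ u) t)
      ((hA j s).continuousAt.mul (hZ _ t)) (fun i => (hAi i j s).continuousAt.mul (hZ _ t))
      h.tendsto_S (h.isCenteredSeq_snd s t) hx
  have t4 := NegligibleSq.sum Finset.univ fun s (_ : s ∈ Finset.univ) =>
    NegligibleSq.sum Finset.univ fun t (_ : t ∈ Finset.univ) =>
    NegligibleSq.sum Finset.univ fun l (_ : l ∈ Finset.univ) =>
    h.negligibleSq_drift (g := fun y => (A y * lift X₀) j s * u l)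
      ((hAL j s).continuousAt.mul continuousAt_const)
      (fun i => (hALi i j s).continuousAt.mul continuousAt_const) hx hk
      (r := fun p => (xh p - X₀) t l) (hkb.mono fun p hp => hp t l) s t
  refine (((t1.add t2).add t3).add t4).congr' ?_
  filter_upwards [hdet] with p hp i
  have e4 : ∑ s, ∑ t, ∑ l, a₀ i s * a₀ i t * ((A (S i, xh p) * lift X₀) j s * u l *
      (xh p - X₀) t l) = (((A (S i, xh p) * lift X₀) * vecMulVec (a₀ i) (a₀ i) *
        (xh p - X₀)) *ᵥ u) j := by
    rw [mul_mul_mulVec_apply]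
    refine Finset.sum_congr rfl fun s _ => Finset.sum_congr rfl fun t _ => ?_
    rw [mulVec, dotProduct, Finset.mul_sum, Finset.mul_sum]
    exact Finset.sum_congr rfl fun l _ => by rw [vecMulVec_apply]; ring
  rw [e4, score_eq_add (hp i) X₀ (a₀ i) (e i p.2) σsq, GammaOf_eq]
  simp only [add_mulVec, Pi.add_apply, mul_mul_mulVec_apply, mul_sub, Finset.sum_sub_distrib,
    sub_self, zero_mulVec, Pi.zero_apply, mul_zero, sub_zero,
    transpose_apply, A]
  ring

end Norm

end IsModel

namespace IsModel

variable {n d : ℕ} {Ω : Type*} [MeasurableSpace Ω] {P : Measure Ω} {δ ϰ σsq : ℝ}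
  {J : Finset (Col n d)} {X₀ : Matrix (Fin n) (Fin d) ℝ} {a₀ : ℕ → Fin n → ℝ}
  {e : ℕ → Ω → Col n d → ℝ} {Sg : ℕ → Matrix J J ℝ} {S : ℕ → Matrix (Col n d) (Col n d) ℝ}
  {Sginf : Matrix J J ℝ} {Sinf : Matrix (Col n d) (Col n d) ℝ} {VA : Matrix (Fin n) (Fin n) ℝ}
  {μ₄ : Col n d → Col n d → Col n d → Col n d → ℝ} [IsProbabilityMeasure P]
  (h : IsModel P δ ϰ σsq J X₀ a₀ e Sg S Sginf Sinf VA μ₄)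
include h

/-- The covariance matrix of `V_A⁻¹ Γ(X₀) u` in terms of the covariances of the entries of `Γ`. -/
lemma covMatrix_limit (u : Fin d → ℝ) :
    covMatrix (pairLaw (covW σsq Sinf VA μ₄) : Measure (MatPair n d))
      (fun G => (VA⁻¹ * GammaOf Sinf X₀ G) *ᵥ u) =
    VA⁻¹ * (gammaCoef Sinf X₀ u * covW σsq Sinf VA μ₄ * (gammaCoef Sinf X₀ u)ᵀ) * VA⁻¹ := by
  have hVA : (VA⁻¹)ᵀ = VA⁻¹ := by
    rw [transpose_nonsing_inv, show VAᵀ = VA from h.posDef_VA.1]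
  have hs : ∀ (j : Fin n) (x : EuclideanSpace ℝ (PairIdx n d)),
      ((VA⁻¹ * GammaOf Sinf X₀ (toPair n d x)) *ᵥ u) j =
        ∑ k, (VA⁻¹ * gammaCoef Sinf X₀ u) j k * x k := by
    intro j x
    rw [← mulVec_mulVec,
      show GammaOf Sinf X₀ (toPair n d x) *ᵥ u = gammaCoef Sinf X₀ u *ᵥ x.ofLp from
        funext fun j => GammaOf_mulVec_toPair Sinf X₀ u x j, mulVec_mulVec]
    rfl
  have hm : ∀ j : Fin n, Measurable fun G : MatPair n d => ((VA⁻¹ * GammaOf Sinf X₀ G) *ᵥ u) j :=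
    fun j => ((continuous_apply j).comp (continuous_limitMap VA Sinf X₀ u)).measurable
  have h1 : VA⁻¹ * (gammaCoef Sinf X₀ u * covW σsq Sinf VA μ₄ * (gammaCoef Sinf X₀ u)ᵀ) * VA⁻¹ =
      (VA⁻¹ * gammaCoef Sinf X₀ u) * covW σsq Sinf VA μ₄ * (VA⁻¹ * gammaCoef Sinf X₀ u)ᵀ := by
    rw [transpose_mul, hVA]
    simp only [Matrix.mul_assoc]
  rw [h1]
  ext j k
  rw [mul_mul_apply_eq_sum, covMatrix, of_apply,
    cov_pairLaw h.error.isLyapunovSeq.posSemidef (hm j) (hm k) _ _ (hs j) (hs k)]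
  exact Finset.sum_congr rfl fun s _ => Finset.sum_congr rfl fun t _ => by
    rw [transpose_apply]; ring

section Norm

-- the entrywise maximum norm, which induces the product topology
attribute [local instance] Matrix.normedAddCommGroup Matrix.normedSpace

/-- The averaged outer products of the estimated scores estimate the covariance of `Γ(X₀) u`. -/
lemma tendsto_avg_score {xh : ℕ × Ω → Matrix (Fin n) (Fin d) ℝ}
    (hx : Tendsto xh (inProb P) (𝓝 X₀))
    (heq : ∀ᶠ p in inProb P, (∀ i, IsUnit (gram (S i) (xh p)).det) ∧
      ∑ i ∈ Finset.range p.1,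
        score (trueRow X₀ (a₀ i) + e i p.2) (S i) (xh p) * (gram (S i) (xh p))⁻¹ = 0)
    (u : Fin d → ℝ) :
    Tendsto (fun p : ℕ × Ω => avg (fun i => score (trueRow X₀ (a₀ i) + e i p.2) (S i) (xh p) *
      vecMulVec u u * (score (trueRow X₀ (a₀ i) + e i p.2) (S i) (xh p))ᵀ) p.1) (inProb P)
      (𝓝 (gammaCoef Sinf X₀ u * covW σsq Sinf VA μ₄ * (gammaCoef Sinf X₀ u)ᵀ)) := by
  have hn := h.negligibleSq_score hx (heq.mono fun p hp => hp.1) (h.tendsto_remainder hx heq).1 u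
  refine tendsto_pi_nhds.2 fun j => tendsto_pi_nhds.2 fun k => ?_
  have h1 := tendsto_avg_mul_of_sub_negligibleSq (hn j) (hn k)
    ((h.tendsto_avg_Gamma_mul u j j).congr fun p => by simp only [pow_two])
    ((h.tendsto_avg_Gamma_mul u k k).congr fun p => by simp only [pow_two])
    (h.tendsto_avg_Gamma_mul u j k)
  refine h1.congr fun p => ?_
  rw [avg_apply]
  refine congrArg _ (Finset.sum_congr rfl fun i _ => ?_)
  rw [mul_vecMulVec, vecMulVec_mul, vecMul_transpose, vecMulVec_apply]

end Norm

/-- Consistency of the sandwich estimator. -/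
theorem tendsto_sandwich (hd : d ≠ 0) {xh : ℕ × Ω → Matrix (Fin n) (Fin d) ℝ}
    (hx : Tendsto xh (inProb P) (𝓝 X₀))
    (heq : ∀ᶠ p in inProb P, (∀ i, IsUnit (gram (S i) (xh p)).det) ∧
      ∑ i ∈ Finset.range p.1,
        score (trueRow X₀ (a₀ i) + e i p.2) (S i) (xh p) * (gram (S i) (xh p))⁻¹ = 0)
    (u : Fin d → ℝ) :
    Tendsto (fun p : ℕ × Ω => sandwich (fun i => trueRow X₀ (a₀ i) + e i p.2) S p.1 (xh p) u)
      (inProb P) (𝓝 (covMatrix (pairLaw (covW σsq Sinf VA μ₄) : Measure (MatPair n d))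
        (fun G => (VA⁻¹ * GammaOf Sinf X₀ G) *ᵥ u))) := by
  rw [h.covMatrix_limit u]
  have h1 : ContinuousAt (fun M : Matrix (Fin n) (Fin n) ℝ => M⁻¹) VA :=
    continuousAt_inv continuousAt_id h.isUnit_VA
  have h2 : Tendsto (fun p => (VHat (fun i => trueRow X₀ (a₀ i) + e i p.2) S p.1 (xh p))⁻¹)
      (inProb P) (𝓝 VA⁻¹) :=
    Tendsto.comp (g := fun M : Matrix (Fin n) (Fin n) ℝ => M⁻¹) h1.tendsto (h.tendsto_VHat hx hd)
  have h3 : Continuous fun q : (Matrix (Fin n) (Fin n) ℝ) × Matrix (Fin n) (Fin n) ℝ =>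
      q.1 * q.2 * q.1 := (continuous_fst.matrix_mul continuous_snd).matrix_mul continuous_fst
  have h4 := Tendsto.comp (g := fun q : (Matrix (Fin n) (Fin n) ℝ) × Matrix (Fin n) (Fin n) ℝ =>
    q.1 * q.2 * q.1) (h3.tendsto (VA⁻¹, gammaCoef Sinf X₀ u * covW σsq Sinf VA μ₄ *
      (gammaCoef Sinf X₀ u)ᵀ)) (h2.prodMk_nhds (h.tendsto_avg_score hx heq u))
  exact h4

/-- With probability tending to one, all the inverses in the sandwich estimator are genuine. -/
lemma eventually_isUnit (hd : d ≠ 0) {xh : ℕ × Ω → Matrix (Fin n) (Fin d) ℝ}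
    (hx : Tendsto xh (inProb P) (𝓝 X₀)) : ∀ᶠ p in inProb P,
      IsUnit (gram (avg S p.1) (xh p)).det ∧
        IsUnit (VHat (fun i => trueRow X₀ (a₀ i) + e i p.2) S p.1 (xh p)).det := by
  have hdet : ∀ {k : ℕ} {M : ℕ × Ω → Matrix (Fin k) (Fin k) ℝ} {L : Matrix (Fin k) (Fin k) ℝ},
      IsUnit L.det → Tendsto M (inProb P) (𝓝 L) → ∀ᶠ p in inProb P, IsUnit (M p).det := by
    intro k M L hL hM
    have h1 := Tendsto.comp (g := fun A : Matrix (Fin k) (Fin k) ℝ => A.det)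
      (continuous_id.matrix_det.tendsto L) hM
    exact (h1.eventually_ne hL.ne_zero).mono fun p hp => isUnit_iff_ne_zero.2 hp
  exact (hdet h.isUnit_gram_inf (h.tendsto_gram_avg hx)).and
    (hdet h.isUnit_VA (h.tendsto_VHat hx hd))

end IsModel

/-! ### Reduction of the model assumptions -/

section Reduction

/-- A lower bound on the eigenvalues of a symmetric matrix bounds its quadratic form. -/
lemma lower_of_hasEigenvalue {ι : Type*} [Fintype ι] [DecidableEq ι] {A : Matrix ι ι ℝ}
    (hA : A.IsHermitian) {b : ℝ}
    (hb : ∀ t : ℝ, Module.End.HasEigenvalue (Matrix.toLin' A) t → b ≤ t) (v : ι → ℝ) :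
    b * (v ⬝ᵥ v) ≤ v ⬝ᵥ A *ᵥ v := by
  have hB : (A - b • (1 : Matrix ι ι ℝ)).IsHermitian := by
    refine hA.sub ?_
    rw [IsHermitian, conjTranspose_smul, conjTranspose_one, star_trivial]
  have hps : (A - b • (1 : Matrix ι ι ℝ)).PosSemidef := by
    refine hB.posSemidef_iff_eigenvalues_nonneg.2 fun i => ?_
    have h1 := hB.mulVec_eigenvectorBasis i
    have h2 : Module.End.HasEigenvalue (Matrix.toLin' A) (hB.eigenvalues i + b) := by
      refine Module.End.hasEigenvalue_of_hasEigenvector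
        (x := (hB.eigenvectorBasis i).ofLp) ⟨?_, ?_⟩
      · rw [Module.End.mem_eigenspace_iff, toLin'_apply, add_smul, ← h1, sub_mulVec, smul_mulVec,
          one_mulVec, sub_add_cancel]
      · intro h0
        exact hB.eigenvectorBasis.orthonormal.ne_zero i (by ext k; exact congrFun h0 k)
    have h3 := hb _ h2
    change 0 ≤ hB.eigenvalues i
    linarith
  have h1 := hps.dotProduct_mulVec_nonneg v
  rw [star_trivial, sub_mulVec, smul_mulVec, one_mulVec, dotProduct_sub, dotProduct_smul,
    smul_eq_mul] at h1
  linarith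

lemma integrable_abs_rpow_of_lintegral_le {Ω : Type*} [MeasurableSpace Ω] {P : Measure Ω}
    {f : Ω → ℝ} (hf : Measurable f) {p : ℝ} (hp : 0 ≤ p) {K : ℝ≥0}
    (hK : ∫⁻ ω, ‖f ω‖ₑ ^ p ∂P ≤ K) :
    Integrable (fun ω => |f ω| ^ p) P ∧ ∫ ω, |f ω| ^ p ∂P ≤ K := by
  have h1 : ∀ ω, ENNReal.ofReal (|f ω| ^ p) = ‖f ω‖ₑ ^ p := fun ω => by
    rw [Real.enorm_eq_ofReal_abs, ENNReal.ofReal_rpow_of_nonneg (abs_nonneg _) hp]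
  have h0 : ∀ ω, 0 ≤ |f ω| ^ p := fun ω => by positivity
  have hm : AEStronglyMeasurable (fun ω => |f ω| ^ p) P :=
    (hf.abs.pow_const p).aestronglyMeasurable
  refine ⟨⟨hm, ?_⟩, ?_⟩
  · rw [hasFiniteIntegral_iff_ofReal (ae_of_all _ h0)]
    simp only [h1]
    exact hK.trans_lt ENNReal.coe_lt_top
  · rw [integral_eq_lintegral_of_nonneg_ae (ae_of_all _ h0) hm]
    simp only [h1]
    exact ENNReal.toReal_le_coe_of_le_coe hK

variable {n d : ℕ} {Ω : Type*} [MeasurableSpace Ω] {P : Measure Ω}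
  {X₀ : Matrix (Fin n) (Fin d) ℝ} {a₀ : ℕ → Fin n → ℝ} {e : ℕ → Ω → Col n d → ℝ}
  {J : Finset (Col n d)} {σsq : ℝ} {Sg : ℕ → Matrix J J ℝ} {ϰ δ : ℝ}
  {VA : Matrix (Fin n) (Fin n) ℝ} {S : ℕ → Matrix (Col n d) (Col n d) ℝ}

/-- The extension by zero of a matrix indexed by `J`. -/
def extendZero (J : Finset (Col n d)) (M : Matrix J J ℝ) : Matrix (Col n d) (Col n d) ℝ :=
  of fun j k => if h : j ∈ J ∧ k ∈ J then M ⟨j, h.1⟩ ⟨k, h.2⟩ else 0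

lemma extendZero_apply_mem (M : Matrix J J ℝ) (j k : J) : extendZero J M j k = M j k := by
  rw [extendZero, of_apply, dif_pos ⟨j.2, k.2⟩]

lemma extendZero_apply_of_not_mem (M : Matrix J J ℝ) {j k : Col n d} (h : ¬ (j ∈ J ∧ k ∈ J)) :
    extendZero J M j k = 0 := by
  rw [extendZero, of_apply, dif_neg h]

/-- The relative covariance matrix of an error vector carried by the columns in `J` is the
extension by zero of its block. -/
lemma relCov_eq_extendZero (hσ : 0 < σsq) {f : Ω → Col n d → ℝ} {M : Matrix J J ℝ}
    (hzero : ∀ j ∉ J, ∀ᵐ ω ∂P, f ω j = 0)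
    (hcov : ∀ j k : J, cov[fun ω => f ω j, fun ω => f ω k; P] = σsq * M j k) :
    relCov P σsq f = extendZero J M := by
  ext j k
  by_cases hjk : j ∈ J ∧ k ∈ J
  · rw [extendZero_apply_mem M ⟨j, hjk.1⟩ ⟨k, hjk.2⟩, relCov, of_apply,
      hcov ⟨j, hjk.1⟩ ⟨k, hjk.2⟩, inv_mul_cancel_left₀ hσ.ne']
  · have h1 : cov[fun ω => f ω j, fun ω => f ω k; P] = 0 := by
      have h2 : ∀ l ∉ J, (fun ω => f ω l) - (fun _ => ∫ ω, f ω l ∂P) =ᵐ[P] 0 := fun l hl => by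
        rw [integral_eq_zero_of_ae (hzero l hl)]
        filter_upwards [hzero l hl] with ω hω
        simp [hω]
      refine integral_eq_zero_of_ae ?_
      rcases not_and_or.1 hjk with hl | hl <;> filter_upwards [h2 _ hl] with ω hω <;>
      · simp only [Pi.sub_apply, Pi.zero_apply] at hω ⊢
        rw [hω]
        simp
    rw [extendZero_apply_of_not_mem M hjk, relCov, of_apply, h1, mul_zero]

lemma isWeight_extendZero (hϰ : 0 < ϰ) {M : Matrix J J ℝ} (hM : ∀ j k, M j k = M k j)
    (hlow : ∀ v : J → ℝ, ϰ ^ 2 * (v ⬝ᵥ v) ≤ v ⬝ᵥ M *ᵥ v) : IsWeight J ϰ M (extendZero J M) where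
  pos := hϰ
  apply_mem := extendZero_apply_mem M
  apply_left j hj k := extendZero_apply_of_not_mem M fun h => hj h.1
  symm := by
    ext j k
    rw [transpose_apply]
    by_cases h : j ∈ J ∧ k ∈ J
    · rw [extendZero_apply_mem M ⟨j, h.1⟩ ⟨k, h.2⟩, extendZero_apply_mem M ⟨k, h.2⟩ ⟨j, h.1⟩, hM]
    · rw [extendZero_apply_of_not_mem M h, extendZero_apply_of_not_mem M fun h' => h h'.symm]
  lower := hlow

lemma tendsto_extendZero {M : ℕ → Matrix J J ℝ} {L : Matrix J J ℝ}
    (hM : Tendsto M atTop (𝓝 L)) (j k : Col n d) :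
    Tendsto (fun i => extendZero J (M i) j k) atTop (𝓝 (extendZero J L j k)) := by
  by_cases h : j ∈ J ∧ k ∈ J
  · have h1 := tendsto_pi_nhds.1 (tendsto_pi_nhds.1 hM ⟨j, h.1⟩) ⟨k, h.2⟩
    rw [extendZero_apply_mem L ⟨j, h.1⟩ ⟨k, h.2⟩]
    exact h1.congr fun i => (extendZero_apply_mem (M i) ⟨j, h.1⟩ ⟨k, h.2⟩).symm
  · simp only [extendZero_apply_of_not_mem _ h, tendsto_const_nhds]

/-- The model assumptions, which concern the columns in `J` only, extend to all columns, since the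
errors in the other columns vanish almost surely. -/
theorem exists_isModel [IsProbabilityMeasure P]
    (he_meas : ∀ i, Measurable (e i)) (he_indep : iIndepFun e P)
    (he_sq : ∀ i j, MemLp (fun ω => e i ω j) 2 P) (he_mean : ∀ i j, ∫ ω, e i ω j ∂P = 0)
    (he_zero : ∀ i, ∀ j ∉ J, ∫ ω, (e i ω j) ^ 2 ∂P = 0) (hσ : 0 < σsq)
    (he_cov : ∀ i (j k : J), cov[fun ω => e i ω j, fun ω => e i ω k; P] = σsq * Sg i j k)
    (hϰ : 0 < ϰ)
    (hSg_min : ∀ i (t : ℝ), Module.End.HasEigenvalue (Matrix.toLin' (Sg i)) t → ϰ ^ 2 ≤ t)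
    (hrank : (rowsJ J (Zmat X₀)).rank = d) (hδ : 0 < δ)
    (hmom_δ : ∃ K : ℝ≥0, ∀ i, ∀ j ∈ J, ∫⁻ ω, ‖e i ω j‖ₑ ^ (4 + 2 * δ) ∂P ≤ K)
    (ha₀ : Tendsto (fun m : ℕ => ((m : ℝ) ^ (1 + δ / 2))⁻¹ *
      ∑ i ∈ Finset.range m, ‖WithLp.toLp 2 (a₀ i)‖ ^ (2 + δ)) atTop (𝓝 0))
    (hVA : IsUnit VA.det)
    (hVA_lim : Tendsto (avg fun i => vecMulVec (a₀ i) (a₀ i)) atTop (𝓝 VA))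
    (hSg_lim : ∃ Sginf : Matrix J J ℝ, Tendsto Sg atTop (𝓝 Sginf))
    (hthird : ∀ i, ∀ p ∈ J, ∀ q ∈ J, ∀ l ∈ J, ∫ ω, e i ω p * e i ω q * e i ω l ∂P = 0)
    (hfourth : ∀ p ∈ J, ∀ q ∈ J, ∀ l ∈ J, ∀ v ∈ J, ∃ μ₄ : ℝ,
      Tendsto (fun m : ℕ => (m : ℝ)⁻¹ *
        ∑ i ∈ Finset.range m, ∫ ω, e i ω p * e i ω q * e i ω l * e i ω v ∂P) atTop (𝓝 μ₄))
    (hS : ∀ i, S i = relCov P σsq (e i)) :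
    ∃ (Sginf : Matrix J J ℝ) (Sinf : Matrix (Col n d) (Col n d) ℝ)
      (μ₄ : Col n d → Col n d → Col n d → Col n d → ℝ),
      IsModel P δ ϰ σsq J X₀ a₀ e Sg S Sginf Sinf VA μ₄ := by
  obtain ⟨Sginf, hSginf⟩ := hSg_lim
  obtain ⟨K, hK⟩ := hmom_δ
  have hzero : ∀ i, ∀ j ∉ J, ∀ᵐ ω ∂P, e i ω j = 0 := fun i j hj => by
    have h1 := (integral_eq_zero_iff_of_nonneg (fun ω => sq_nonneg (e i ω j))
      (he_sq i j).integrable_sq).1 (he_zero i j hj)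
    exact h1.mono fun ω hω => pow_eq_zero_iff two_ne_zero |>.1 hω
  have hSe : ∀ i, S i = extendZero J (Sg i) := fun i =>
    (hS i).trans (relCov_eq_extendZero hσ (hzero i) (he_cov i))
  have hsymm : ∀ i j k, Sg i j k = Sg i k j := fun i j k =>
    mul_left_cancel₀ hσ.ne' (by rw [← he_cov, ← he_cov, covariance_comm])
  have hlow : ∀ i (v : J → ℝ), ϰ ^ 2 * (v ⬝ᵥ v) ≤ v ⬝ᵥ Sg i *ᵥ v := fun i =>
    lower_of_hasEigenvalue (by ext j k; exact hsymm i k j) (hSg_min i)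
  have hentry : ∀ j k, Tendsto (fun i => Sg i j k) atTop (𝓝 (Sginf j k)) := fun j k =>
    tendsto_pi_nhds.1 (tendsto_pi_nhds.1 hSginf j) k
  have hlim : IsWeight J ϰ Sginf (extendZero J Sginf) := by
    refine isWeight_extendZero hϰ (fun j k => tendsto_nhds_unique (hentry j k)
      ((hentry k j).congr fun i => hsymm i k j)) fun v => ?_
    have h1 : Continuous fun M : Matrix J J ℝ => v ⬝ᵥ M *ᵥ v :=
      continuous_const.dotProduct (continuous_id.matrix_mulVec continuous_const)
    exact ge_of_tendsto' ((h1.tendsto Sginf).comp hSginf) fun i => hlow i v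
  have hfourth' : ∀ p q l v, ∃ μ₄ : ℝ, Tendsto (fun m : ℕ => (m : ℝ)⁻¹ *
      ∑ i ∈ Finset.range m, ∫ ω, e i ω p * e i ω q * e i ω l * e i ω v ∂P) atTop (𝓝 μ₄) := by
    intro p q l v
    by_cases hJ : p ∈ J ∧ q ∈ J ∧ l ∈ J ∧ v ∈ J
    · exact hfourth p hJ.1 q hJ.2.1 l hJ.2.2.1 v hJ.2.2.2
    · refine ⟨0, tendsto_const_nhds.congr fun m => ?_⟩
      rw [Finset.sum_eq_zero fun i _ => ?_, mul_zero]
      refine integral_eq_zero_of_ae ?_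
      simp only [not_and_or] at hJ
      rcases hJ with hJ | hJ | hJ | hJ <;> filter_upwards [hzero i _ hJ] with ω hω <;> simp [hω]
  choose μ₄ hμ₄ using hfourth'
  refine ⟨Sginf, extendZero J Sginf, μ₄, ?_, fun i => ?_, hlim, hσ, hrank, hVA⟩
  · refine ⟨hδ, he_meas, he_indep, he_mean, ⟨K, fun i j => ?_⟩, fun i j k => ?_, fun i j k l => ?_,
      hμ₄, fun j k => ?_, fun j k => ?_, ha₀⟩
    · by_cases hj : j ∈ J
      · exact integrable_abs_rpow_of_lintegral_le
          ((measurable_pi_apply j).comp (he_meas i)) (by linarith) (hK i j hj)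
      · have h0 : (fun ω => |e i ω j| ^ (4 + 2 * δ)) =ᵐ[P] fun _ => 0 := by
          filter_upwards [hzero i j hj] with ω hω
          rw [hω, abs_zero, Real.zero_rpow (by linarith)]
        refine ⟨(integrable_zero _ _ _).congr h0.symm, ?_⟩
        rw [integral_congr_ae h0, integral_zero]
        exact K.2
    · rw [hS, relCov, of_apply, covariance_eq_sub (he_sq i j) (he_sq i k), he_mean, he_mean,
        mul_zero, sub_zero, mul_inv_cancel_left₀ hσ.ne']
      rfl
    · by_cases hJ : j ∈ J ∧ k ∈ J ∧ l ∈ J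
      · exact hthird i j hJ.1 k hJ.2.1 l hJ.2.2
      · refine integral_eq_zero_of_ae ?_
        simp only [not_and_or] at hJ
        rcases hJ with hJ | hJ | hJ <;> filter_upwards [hzero i _ hJ] with ω hω <;> simp [hω]
    · simp only [hSe]
      exact tendsto_extendZero hSginf j k
    · refine (tendsto_pi_nhds.1 (tendsto_pi_nhds.1 hVA_lim j) k).congr fun m => ?_
      rw [avg_apply]
      rfl
  · rw [hSe]
    exact isWeight_extendZero hϰ (hsymm i) (hlow i)

end Reduction

end

end EWTLS

theorem lemma9
    {n d : ℕ} {Ω : Type*} [MeasurableSpace Ω] (P : Measure Ω) [IsProbabilityMeasure P]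
    -- the model: `c_i = [a_{0i}; X₀ᵀ a_{0i}] + c̃_i`, the errors being `e i`
    (X₀ : Matrix (Fin n) (Fin d) ℝ) (a₀ : ℕ → Fin n → ℝ) (e : ℕ → Ω → EWTLS.Col n d → ℝ)
    (c : ℕ → Ω → EWTLS.Col n d → ℝ)
    (hc : ∀ i ω, c i ω = EWTLS.trueRow X₀ (a₀ i) + e i ω)
    -- (i) independent centered errors with finite second moments
    (he_meas : ∀ i, Measurable (e i)) (he_indep : iIndepFun e P)
    (he_sq : ∀ i j, MemLp (fun ω => e i ω j) 2 P)
    (he_mean : ∀ i j, ∫ ω, e i ω j ∂P = 0)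
    -- (ii) errors only in the columns `J`, where the covariance is `σ² Σ_i`
    (J : Finset (EWTLS.Col n d)) (he_zero : ∀ i, ∀ j ∉ J, ∫ ω, (e i ω j) ^ 2 ∂P = 0)
    (σsq : ℝ) (hσ : 0 < σsq) (Sg : ℕ → Matrix J J ℝ)
    (he_cov : ∀ i (j k : J), cov[fun ω => e i ω j, fun ω => e i ω k; P] = σsq * Sg i j k)
    -- (iii) `λ_min(Σ_i) ≥ ϰ²`
    (ϰ : ℝ) (hϰ : 0 < ϰ)
    (hSg_min : ∀ i (t : ℝ), Module.End.HasEigenvalue (Matrix.toLin' (Sg i)) t → ϰ ^ 2 ≤ t)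
    -- (iv)
    (hrank : (EWTLS.rowsJ J (EWTLS.Zmat X₀)).rank = d)
    -- (v)
    (r : ℝ) (hr2 : 2 ≤ r) (hr : (d : ℝ) * ((J.card : ℝ) - ((d : ℝ) + 1) / 2) < r)
    (hmom_r : ∃ K : ℝ≥0, ∀ i, ∀ j ∈ J, ∫⁻ ω, ‖e i ω j‖ₑ ^ (2 * r) ∂P ≤ K)
    -- (viii), (ix)
    (δ : ℝ) (hδ : 0 < δ)
    (hmom_δ : ∃ K : ℝ≥0, ∀ i, ∀ j ∈ J, ∫⁻ ω, ‖e i ω j‖ₑ ^ (4 + 2 * δ) ∂P ≤ K)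
    (ha₀ : Tendsto (fun m : ℕ => ((m : ℝ) ^ (1 + δ / 2))⁻¹ *
      ∑ i ∈ Finset.range m, ‖WithLp.toLp 2 (a₀ i)‖ ^ (2 + δ)) atTop (𝓝 0))
    -- (x) `m⁻¹ A₀ᵀ A₀ → V_A`, nonsingular
    (VA : Matrix (Fin n) (Fin n) ℝ) (hVA : IsUnit VA.det)
    (hVA_lim : Tendsto (EWTLS.avg fun i => Matrix.vecMulVec (a₀ i) (a₀ i)) atTop (𝓝 VA))
    -- (xi)
    (hSg_lim : ∃ Sginf : Matrix J J ℝ, Tendsto Sg atTop (𝓝 Sginf))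
    -- (xii) vanishing third moments
    (hthird : ∀ i, ∀ p ∈ J, ∀ q ∈ J, ∀ l ∈ J, ∫ ω, e i ω p * e i ω q * e i ω l ∂P = 0)
    -- (xiii) converging averaged fourth moments
    (hfourth : ∀ p ∈ J, ∀ q ∈ J, ∀ l ∈ J, ∀ v ∈ J, ∃ μ₄ : ℝ,
      Tendsto (fun m : ℕ => (m : ℝ)⁻¹ *
        ∑ i ∈ Finset.range m, ∫ ω, e i ω p * e i ω q * e i ω l * e i ω v ∂P) atTop (𝓝 μ₄))
    -- the relative covariance matrices `S_i = σ⁻² cov(c̃_i)`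
    (S : ℕ → Matrix (EWTLS.Col n d) (EWTLS.Col n d) ℝ)
    (hS : ∀ i, S i = EWTLS.relCov P σsq (e i))
    -- the EW-TLS estimator, as a map of the data and as a random element
    (est : (m : ℕ) → Matrix (Fin m) (EWTLS.Col n d) ℝ → OnePoint (Matrix (Fin n) (Fin d) ℝ))
    (hest : EWTLS.IsEWTLS J Sg est)
    (Xhat : ℕ → Ω → OnePoint (Matrix (Fin n) (Fin d) ℝ))
    (hXhat : ∀ m ω, Xhat m ω = est m (EWTLS.dataMatrix (fun i => c i ω) m)) :
    -- `S_∞ = lim S_i`, and the law `ν` of `Γ = lim m^{-1/2} ∑ W_i`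
    ∃ (Sinf : Matrix (EWTLS.Col n d) (EWTLS.Col n d) ℝ)
      (ν : ProbabilityMeasure (EWTLS.MatPair n d)),
      Tendsto S atTop (𝓝 Sinf) ∧
      EWTLS.IsCenteredGaussianIndep (ν : Measure (EWTLS.MatPair n d)) ∧
      TendstoInDistribution
        (fun (m : ℕ) ω => (√(m : ℝ))⁻¹ •
          ∑ i ∈ Finset.range m, EWTLS.pairW (a₀ i) (e i ω) σsq (S i))
        atTop (fun G => G) (fun _ => P) (ν : Measure (EWTLS.MatPair n d)) ∧
      ∀ u : Fin d → ℝ, u ≠ 0 →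
        -- `√m (X̂ u - X₀ u)` converges in law to `V_A⁻¹ Γ(X₀) u`
        TendstoInDistribution
          (fun (m : ℕ) ω => √(m : ℝ) • (EWTLS.finitePart (Xhat m ω) *ᵥ u - X₀ *ᵥ u))
          atTop (fun G => (VA⁻¹ * EWTLS.GammaOf Sinf X₀ G) *ᵥ u)
          (fun _ => P) (ν : Measure (EWTLS.MatPair n d)) ∧
        -- `Ŝ_u` is well defined (no infinite estimate, no singular inverse) with probability → 1
        Tendsto (fun m : ℕ => P {ω | Xhat m ω = OnePoint.infty ∨
          ¬ IsUnit ((EWTLS.Zmat (EWTLS.finitePart (Xhat m ω)))ᵀ * EWTLS.avg S m *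
            EWTLS.Zmat (EWTLS.finitePart (Xhat m ω))).det ∨
          ¬ IsUnit (EWTLS.VHat (fun i => c i ω) S m (EWTLS.finitePart (Xhat m ω))).det})
          atTop (𝓝 0) ∧
        -- `Ŝ_u` converges in probability to `S_u = cov(V_A⁻¹ Γ(X₀) u)`, entry by entry
        ∀ j k, TendstoInMeasure P
          (fun (m : ℕ) ω => EWTLS.sandwich (fun i => c i ω) S m
            (EWTLS.finitePart (Xhat m ω)) u j k)
          atTop
          (fun _ => EWTLS.covMatrix (ν : Measure (EWTLS.MatPair n d))
            (fun G => (VA⁻¹ * EWTLS.GammaOf Sinf X₀ G) *ᵥ u) j k) := by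

  obtain rfl : c = fun i ω => EWTLS.trueRow X₀ (a₀ i) + e i ω := funext fun i => funext (hc i)
  obtain ⟨Sginf, Sinf, μ₄, h⟩ := EWTLS.exists_isModel (X₀ := X₀) (VA := VA) he_meas he_indep he_sq
    he_mean he_zero hσ he_cov hϰ hSg_min hrank hδ hmom_δ ha₀ hVA hVA_lim hSg_lim hthird hfourth hS
  have hx := h.tendsto_estimator hest hXhat
  have heq := h.eventually_estimating_equation hest hXhat
  refine ⟨Sinf, EWTLS.pairLaw (EWTLS.covW σsq Sinf VA μ₄), h.tendsto_S,
    EWTLS.isCenteredGaussianIndep_pairLaw h.error.isLyapunovSeq.posSemidef fun _ _ => rfl,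
    h.tendstoInDistribution_normSum, fun u hu => ⟨?_, ?_, fun j k => ?_⟩⟩
  · exact h.tendstoInDistribution_of_remainder (h.measurable_estimator hest hXhat)
      (h.tendsto_remainder hx heq).2 u
  all_goals
    have hd : d ≠ 0 := by
      rintro rfl
      exact hu (Subsingleton.elim _ _)
  · have h1 := (h.eventually_isSolution hest hXhat).and (h.eventually_isUnit hd hx)
    rw [EWTLS.eventually_inProb] at h1
    refine tendsto_of_tendsto_of_tendsto_of_le_of_le tendsto_const_nhds h1 (fun _ => zero_le)
      fun m => measure_mono fun ω hω hgood => ?_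
    rcases hω with hω | hω | hω
    · rw [hω] at hgood
      exact OnePoint.infty_ne_coe _ hgood.1.1
    · exact hω hgood.2.1
    · exact hω hgood.2.2
  · rw [EWTLS.tendstoInMeasure_iff_inProb]
    exact tendsto_pi_nhds.1 (tendsto_pi_nhds.1 (h.tendsto_sandwich hd hx heq u) j) k
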